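/- Let $R$ be an Iwanaga-Gorenstein ring, i.e. a left and right Noetherian ring with finite injective dimension both as a left and as a right module over itself. Let $\mathsf{CM}\,R$ be the category of finitely presented right $R$-modules $X$ with $\operatorname{Ext}^i_R(X,R)=0$ for all $i>0$. Let $\mathsf{Mor}^{\mathrm e}(\mathsf{CM}\,R)$ be the category whose objects are the surjective $R$-linear maps $\alpha:X\to T$ with $X,T\in\mathsf{CM}\,R$ and whose morphisms are the commutative squares. With the (componentwise) short exact sequences both are exact categories; let $\underline{\mathsf{CM}}\,R$ and $\underline{\mathsf{Mor}}^{\mathrm e}(\mathsf{CM}\,R)$ be their stable categories (morphisms modulo those factoring through a projective object of the exact category). Let $\underline{\mathsf{Mor}}^{01}$, $\underline{\mathsf{Mor}}^{10}$, $\underline{\mathsf{Mor}}^{11}$ be the full subcategories of $\underline{\mathsf{Mor}}^{\mathrm e}(\mathsf{CM}\,R)$ of the objects isomorphic in it to some $P\to T$ with $P$ projective, to some $X\to 0$, and to some identity $T\xrightarrow{1}T$, respectively. A pair $(\mathcal U,\mathcal V)$ of full subcategories of a triangulated category $\mathcal D$ with translation $\Sigma$ is a stable t-structure if $\mathcal U=\Sigma\mathcal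 U$, $\mathcal V=\Sigma\mathcal V$, $\operatorname{Hom}_{\mathcal D}(\mathcal U,\mathcal V)=0$ and every $X\in\mathcal D$ lies in a triangle $U\to X\to V\to\Sigma U$ with $U\in\mathcal U$, $V\in\mathcal V$. Triangulated full subcategories $(\mathcal U,\mathcal V,\mathcal W)$ form a triangle of recollements in $\mathcal D$ if $(\mathcal U,\mathcal V)$, $(\mathcal V,\mathcal W)$ and $(\mathcal W,\mathcal U)$ are stable t-structures. Then $\underline{\mathsf{CM}}\,R$ and $\underline{\mathsf{Mor}}^{\mathrm e}(\mathsf{CM}\,R)$ carry the usual (Happel) triangulated structure of the stable category of a Frobenius category, and with respect to it: (1) $(\underline{\mathsf{Mor}}^{01},\underline{\mathsf{Mor}}^{10},\underline{\mathsf{Mor}}^{11})$ is a triangle of recollements in $\underline{\mathsf{Mor}}^{\mathrm e}(\mathsf{CM}\,R)$; in particular the three are triangulated subcategories. (2) Let $i_*:\underline{\mathsf{Mor}}^{10}\to\underline{\mathsf{Mor}}^{\mathrm e}(\mathsf{CM}\,R)$ be the inclusion and $j^*:\underline{\mathsf{Mor}}^{\mathrm e}(\mathsf{CM}\,R)\to\underline{\mathsf{Mor}}^{\mathrm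 e}(\mathsf{CM}\,R)/\underline{\mathsf{Mor}}^{10}$ the Verdier quotient functor. There is a recollement $(i^*,i_*,i^!;\,j_!,j^*,j_*)$, that is, there are triangle functors $i^*,i^!,j_!,j_*$ with $i^*\dashv i_*\dashv i^!$ and $j_!\dashv j^*\dashv j_*$, with $i_*,j_!,j_*$ fully faithful, and with essential images $\operatorname{Im}j_!=\operatorname{Ker}i^*$, $\operatorname{Im}i_*=\operatorname{Ker}j^*$, $\operatorname{Im}j_*=\operatorname{Ker}i^!$, such that moreover $\operatorname{Im}j_!=\underline{\mathsf{Mor}}^{01}$ and $\operatorname{Im}j_*=\underline{\mathsf{Mor}}^{11}$. (3) There are triangle equivalences $\underline{\mathsf{CM}}\,R\simeq\underline{\mathsf{Mor}}^{10}\simeq\underline{\mathsf{Mor}}^{11}\simeq\underline{\mathsf{Mor}}^{01}$. -/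

import Mathlib

open CategoryTheory CategoryTheory.Limits CategoryTheory.Pretriangulated
open scoped ZeroObject

universe u

namespace Frobenius

section StableCategory

variable {C : Type*} [Category C] [Preadditive C]

/-! An exact category is given by an additive category `C` together with its class
`E` of conflations (admissible short exact sequences). -/

/-- Projective objects of the exact category `(C, E)`. -/
def relProjective (E : ObjectProperty (ShortComplex C)) : ObjectProperty C := fun Q =>
  ∀ (S : ShortComplex C), E S → ∀ f : Q ⟶ S.X₃, ∃ g : Q ⟶ S.X₂, g ≫ S.g = f

/-- Injective objects of the exact category `(C, E)`. -/
def relInjective (E : ObjectProperty (ShortComplex C)) : ObjectProperty C := fun I =>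
  ∀ (S : ShortComplex C), E S → ∀ f : S.X₁ ⟶ I, ∃ g : S.X₂ ⟶ I, S.f ≫ g = f

/-- Two parallel morphisms are identified in the stable category when their difference
factors through a projective object of the exact category. -/
def stableRel (E : ObjectProperty (ShortComplex C)) : HomRel C := fun X Y f g =>
  ∃ (Q : C) (_ : relProjective E Q) (a : X ⟶ Q) (b : Q ⟶ Y), f - g = a ≫ b

variable (E : ObjectProperty (ShortComplex C)) [HasBinaryBiproducts C]

lemma stableRel_add {X Y : C} (f₁ f₂ g₁ g₂ : X ⟶ Y)
    (hf : stableRel E f₁ f₂) (hg : stableRel E g₁ g₂) :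
    stableRel E (f₁ + g₁) (f₂ + g₂) := by
  obtain ⟨Q, hQ, a, b, h⟩ := hf
  obtain ⟨Q', hQ', a', b', h'⟩ := hg
  refine ⟨Q ⊞ Q', ?_, biprod.lift a a', biprod.desc b b', ?_⟩
  · intro S hS f
    obtain ⟨g, hg⟩ := hQ S hS (biprod.inl ≫ f)
    obtain ⟨g', hg'⟩ := hQ' S hS (biprod.inr ≫ f)
    exact ⟨biprod.desc g g', by ext <;> simp [hg, hg']⟩
  · rw [biprod.lift_desc, ← h, ← h']
    abel

variable [HasZeroObject C]

instance stableRel_congruence : Congruence (stableRel E) where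
  comp_left := by
    rintro X Y Z f g g' ⟨Q, hQ, a, b, h⟩
    exact ⟨Q, hQ, f ≫ a, b, by rw [← Preadditive.comp_sub, h, Category.assoc]⟩
  comp_right := by
    rintro X Y Z f f' g ⟨Q, hQ, a, b, h⟩
    exact ⟨Q, hQ, a, b ≫ g, by rw [← Preadditive.sub_comp, h, Category.assoc]⟩
  equivalence := by
    intro X Y
    have hrefl : ∀ f : X ⟶ Y, stableRel E f f := fun f =>
      ⟨Classical.choose (HasZeroObject.zero (C := C)), fun S _ f =>
        ⟨0, (Classical.choose_spec (HasZeroObject.zero (C := C))).eq_of_src _ _⟩,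
        0, 0, by simp⟩
    refine ⟨hrefl, ?_, ?_⟩
    · rintro f g ⟨Q, hQ, a, b, h⟩
      exact ⟨Q, hQ, -a, b, by rw [Preadditive.neg_comp, ← h, neg_sub]⟩
    · intro f g k hfg hgk
      have := stableRel_add E _ _ _ _ (stableRel_add E _ _ _ _ hfg hgk) (hrefl (-g))
      simpa [add_comm, add_left_comm, add_assoc] using this

/-- The stable category of the exact category `(C, E)`. -/
abbrev StableCategory : Type _ := CategoryTheory.Quotient (stableRel E)

/-- The projection onto the stable category. -/
abbrev toStable : C ⥤ StableCategory E := CategoryTheory.Quotient.functor (stableRel E)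

instance : Preadditive (StableCategory E) :=
  CategoryTheory.Quotient.preadditive _ (fun _ _ => stableRel_add E)

instance : (toStable E).Additive :=
  CategoryTheory.Quotient.functor_additive _ (fun _ _ => stableRel_add E)

instance : HasZeroObject (StableCategory E) := by
  obtain ⟨Z, hZ⟩ := HasZeroObject.zero (C := C)
  exact ⟨_, (toStable E).map_isZero hZ⟩

/-- Happel's triangulated structure on the stable category of a Frobenius exact category.
The translation of `X` is the third term of any conflation `X ⟶ I ⟶ X'` with `I`
projective-injective, naturally in the conflation, and the distinguished triangles
are the triangles isomorphic to a standard one `X ⟶ Y ⟶ Z ⟶ X⟦1⟧`, where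
`Z` is the pushout of `X ⟶ I` along some `u : X ⟶ Y` and `Z ⟶ X'` is the
morphism induced by `I ⟶ X'` and `0 : Y ⟶ X'`. These conditions determine the
structure up to isomorphism. -/
class StableTriangulation where
  hasShift : HasShift (StableCategory E) ℤ
  shift_additive : ∀ n : ℤ, (shiftFunctor (StableCategory E) n).Additive
  pretriangulated : Pretriangulated (StableCategory E)
  isTriangulated : IsTriangulated (StableCategory E)
  shiftIso (S : ShortComplex C) (hS : E S)
    (hp : relProjective E S.X₂) (hi : relInjective E S.X₂) :
    (toStable E).obj S.X₃ ≅ ((toStable E).obj S.X₁)⟦(1 : ℤ)⟧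
  shiftIso_naturality {S S' : ShortComplex C} (φ : S ⟶ S')
    (hS : E S) (hp : relProjective E S.X₂) (hi : relInjective E S.X₂)
    (hS' : E S') (hp' : relProjective E S'.X₂) (hi' : relInjective E S'.X₂) :
    (toStable E).map φ.τ₃ ≫ (shiftIso S' hS' hp' hi').hom =
      (shiftIso S hS hp hi).hom ≫ ((toStable E).map φ.τ₁)⟦(1 : ℤ)⟧'
  distinguished_iff (T : Triangle (StableCategory E)) :
    T ∈ distTriang (StableCategory E) ↔
      ∃ (S : ShortComplex C) (hS : E S) (hp : relProjective E S.X₂)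
        (hi : relInjective E S.X₂) (Y Z : C) (u : S.X₁ ⟶ Y) (v : Y ⟶ Z) (x : S.X₂ ⟶ Z)
        (w : Z ⟶ S.X₃),
        IsPushout S.f u x v ∧ x ≫ w = S.g ∧ v ≫ w = 0 ∧
        Nonempty (T ≅ Triangle.mk ((toStable E).map u) ((toStable E).map v)
          ((toStable E).map w ≫ (shiftIso S hS hp hi).hom))

attribute [reducible] StableTriangulation.hasShift StableTriangulation.pretriangulated

attribute [instance] StableTriangulation.hasShift StableTriangulation.shift_additive
  StableTriangulation.pretriangulated StableTriangulation.isTriangulated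

end StableCategory

end Frobenius

namespace Recoll

section

variable {D : Type*} [Category D] [HasZeroObject D] [HasShift D ℤ] [Preadditive D]
  [∀ n : ℤ, (shiftFunctor D n).Additive] [Pretriangulated D]

/-- Stable t-structures `(U, V)`; the full subcategories are given by
properties of objects. -/
structure IsStableTStructure (U V : ObjectProperty D) : Prop where
  shift_left : ∀ X : D, U (X⟦(1 : ℤ)⟧) ↔ U X
  shift_right : ∀ X : D, V (X⟦(1 : ℤ)⟧) ↔ V X
  hom_eq_zero : ∀ ⦃X Y : D⦄, U X → V Y → ∀ f : X ⟶ Y, f = 0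
  exists_triangle : ∀ X : D, ∃ (A B : D) (_ : U A) (_ : V B)
    (f : A ⟶ X) (g : X ⟶ B) (h : B ⟶ A⟦(1 : ℤ)⟧), Triangle.mk f g h ∈ distTriang D

/-- Triangles of recollements formed by three triangulated full subcategories. -/
structure IsTriangleOfRecollements (U V W : ObjectProperty D)
    [U.IsTriangulated] [V.IsTriangulated] [W.IsTriangulated] : Prop where
  fst : IsStableTStructure U V
  snd : IsStableTStructure V W
  thd : IsStableTStructure W U

variable {D' : Type*} [Category D'] [HasZeroObject D'] [HasShift D' ℤ] [Preadditive D']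
  [∀ n : ℤ, (shiftFunctor D' n).Additive] [Pretriangulated D']
  {D'' : Type*} [Category D''] [HasZeroObject D''] [HasShift D'' ℤ] [Preadditive D'']
  [∀ n : ℤ, (shiftFunctor D'' n).Additive] [Pretriangulated D'']

/-- Recollements `D' ⇄ D ⇄ D''` with prescribed triangle functors
`i_* = i : D' ⥤ D` and `j^* = j : D ⥤ D''`. -/
structure Recollement (i : D' ⥤ D) [i.CommShift ℤ] [i.IsTriangulated]
    (j : D ⥤ D'') [j.CommShift ℤ] [j.IsTriangulated] where
  /-- `i^*` -/
  iStar : D ⥤ D'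
  /-- `i^!` -/
  iShriek : D ⥤ D'
  /-- `j_!` -/
  jShriek : D'' ⥤ D
  /-- `j_*` -/
  jStar : D'' ⥤ D
  iStar_commShift : iStar.CommShift ℤ
  iShriek_commShift : iShriek.CommShift ℤ
  jShriek_commShift : jShriek.CommShift ℤ
  jStar_commShift : jStar.CommShift ℤ
  iStar_isTriangulated : iStar.IsTriangulated
  iShriek_isTriangulated : iShriek.IsTriangulated
  jShriek_isTriangulated : jShriek.IsTriangulated
  jStar_isTriangulated : jStar.IsTriangulated
  i_full : i.Full
  i_faithful : i.Faithful
  jShriek_full : jShriek.Full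
  jShriek_faithful : jShriek.Faithful
  jStar_full : jStar.Full
  jStar_faithful : jStar.Faithful
  adj_iStar : iStar ⊣ i
  adj_iShriek : i ⊣ iShriek
  adj_jShriek : jShriek ⊣ j
  adj_jStar : j ⊣ jStar
  essImage_jShriek : jShriek.essImage = iStar.kernel
  essImage_i : i.essImage = j.kernel
  essImage_jStar : jStar.essImage = iShriek.kernel

end

/-- Two triangulated categories are triangle equivalent. -/
def TriangleEquivalent (C : Type*) [Category C] [HasZeroObject C] [HasShift C ℤ] [Preadditive C]
    [∀ n : ℤ, (shiftFunctor C n).Additive] [Pretriangulated C]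
    (D : Type*) [Category D] [HasZeroObject D] [HasShift D ℤ] [Preadditive D]
    [∀ n : ℤ, (shiftFunctor D n).Additive] [Pretriangulated D] : Prop :=
  ∃ (F : C ⥤ D) (_ : F.CommShift ℤ), F.IsTriangulated ∧ F.IsEquivalence

end Recoll

namespace Gorenstein

/-- Iwanaga-Gorenstein rings: two-sided Noetherian, and of finite injective dimension both
as a left and as a right module over themselves. Right `R`-modules are `Rᵐᵒᵖ`-modules. -/
structure IsIwanagaGorenstein (R : Type u) [Ring R] : Prop where
  left_noetherian : IsNoetherianRing R
  right_noetherian : IsNoetherianRing Rᵐᵒᵖ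
  left_injectiveDimension :
    ∃ n : ℕ, HasInjectiveDimensionLE (ModuleCat.of.{u} R R) n
  right_injectiveDimension :
    ∃ n : ℕ, HasInjectiveDimensionLE (ModuleCat.of.{u} Rᵐᵒᵖ R) n

variable (R : Type u) [Ring R]

/-- Cohen-Macaulay right `R`-modules: finitely presented right modules `X`
with `Ext^i(X, R) = 0` for all `i > 0`. -/
def isCM : ObjectProperty (ModuleCat.{u} Rᵐᵒᵖ) := fun X =>
  Module.FinitePresentation Rᵐᵒᵖ X ∧
    ∀ i : ℕ, 0 < i → Subsingleton (Abelian.Ext.{u} X (ModuleCat.of.{u} Rᵐᵒᵖ R) i)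

/-- Surjective morphisms `α : X ⟶ T` between Cohen-Macaulay right modules. -/
def isMorE : ObjectProperty (Arrow (ModuleCat.{u} Rᵐᵒᵖ)) := fun α =>
  isCM R α.left ∧ isCM R α.right ∧ Function.Surjective α.hom

lemma hasBinaryBiproducts_fullSubcategory {C : Type*} [Category C] [Preadditive C]
    (P : ObjectProperty C)
    (h : ∀ X Y : C, P X → P Y → ∃ b : BinaryBicone X Y,
      P b.pt ∧ b.fst ≫ b.inl + b.snd ≫ b.inr = 𝟙 b.pt) :
    HasBinaryBiproducts P.FullSubcategory where
  has_binary_biproduct X Y := by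
    obtain ⟨b, hb, ht⟩ := h X.obj Y.obj X.property Y.property
    exact hasBinaryBiproduct_of_total
      { pt := ⟨b.pt, hb⟩
        fst := ObjectProperty.homMk b.fst
        snd := ObjectProperty.homMk b.snd
        inl := ObjectProperty.homMk b.inl
        inr := ObjectProperty.homMk b.inr
        inl_fst := by ext; simp
        inl_snd := by ext; simp
        inr_fst := by ext; simp
        inr_snd := by ext; simp }
      (by ext; exact ht)

lemma isCM_of_isZero {X : ModuleCat.{u} Rᵐᵒᵖ} (hX : IsZero X) : isCM R X := by
  have : Subsingleton X := ModuleCat.subsingleton_of_isZero hX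
  refine ⟨inferInstance, fun i _ => ⟨fun a b => ?_⟩⟩
  rw [← Abelian.Ext.mk₀_id_comp a, ← Abelian.Ext.mk₀_id_comp b, hX.eq_of_src (𝟙 X) 0,
    Abelian.Ext.mk₀_zero, Abelian.Ext.zero_comp, Abelian.Ext.zero_comp]

lemma isCM_biprod {X Y : ModuleCat.{u} Rᵐᵒᵖ} (hX : isCM R X) (hY : isCM R Y) :
    isCM R (X ⊞ Y) := by
  have := hX.1
  have := hY.1
  refine ⟨.of_equiv (ModuleCat.biprodIsoProd X Y).toLinearEquiv.symm, fun i hi => ?_⟩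
  have := hX.2 i hi
  have := hY.2 i hi
  refine ⟨fun a b => ?_⟩
  rw [← Abelian.Ext.mk₀_id_comp a, ← Abelian.Ext.mk₀_id_comp b, ← biprod.total,
    Abelian.Ext.mk₀_add, Abelian.Ext.add_comp, Abelian.Ext.add_comp,
    ← Abelian.Ext.mk₀_comp_mk₀_assoc, ← Abelian.Ext.mk₀_comp_mk₀_assoc,
    ← Abelian.Ext.mk₀_comp_mk₀_assoc, ← Abelian.Ext.mk₀_comp_mk₀_assoc]
  congr 2 <;> exact Subsingleton.elim _ _

instance : (isCM R).ContainsZero := ⟨_, isZero_zero _, isCM_of_isZero R (isZero_zero _)⟩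

instance : HasBinaryBiproducts (isCM R).FullSubcategory :=
  hasBinaryBiproducts_fullSubcategory _ fun X Y hX hY =>
    ⟨BinaryBiproduct.bicone X Y, isCM_biprod R hX hY, biprod.total⟩

instance : (isMorE R).ContainsZero where
  exists_zero := by
    have hZ := isZero_zero (ModuleCat.{u} Rᵐᵒᵖ)
    refine ⟨Arrow.mk (𝟙 (0 : ModuleCat.{u} Rᵐᵒᵖ)), ?_, isCM_of_isZero R hZ, isCM_of_isZero R hZ,
      Function.surjective_id⟩
    rw [IsZero.iff_id_eq_zero]
    ext1 <;> exact hZ.eq_of_src _ _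

instance : HasBinaryBiproducts (isMorE R).FullSubcategory :=
  hasBinaryBiproducts_fullSubcategory _ fun α β hα hβ =>
    ⟨{  pt := Arrow.mk (biprod.map α.hom β.hom)
        fst := Arrow.homMk biprod.fst biprod.fst
        snd := Arrow.homMk biprod.snd biprod.snd
        inl := Arrow.homMk biprod.inl biprod.inl
        inr := Arrow.homMk biprod.inr biprod.inr },
      ⟨isCM_biprod R hα.1 hβ.1, isCM_biprod R hα.2.1 hβ.2.1, by
        have := (ModuleCat.epi_iff_surjective _).2 hα.2.2
        have := (ModuleCat.epi_iff_surjective _).2 hβ.2.2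
        exact (ModuleCat.epi_iff_surjective (biprod.map α.hom β.hom)).1 inferInstance⟩,
      by ext1 <;> exact biprod.total⟩

/-- The conflations of `CM R`: the sequences that are short exact in `Mod R`. -/
def cmConflation : ObjectProperty (ShortComplex (isCM R).FullSubcategory) := fun S =>
  (S.map (isCM R).ι).ShortExact

/-- The conflations of `Mor^e(CM R)`: the sequences that are short exact in `Mor(Mod R)`, that is,
short exact at the sources and at the targets. -/
def morEConflation : ObjectProperty (ShortComplex (isMorE R).FullSubcategory) := fun S =>
  (S.map ((isMorE R).ι ⋙ Arrow.leftFunc)).ShortExact ∧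
    (S.map ((isMorE R).ι ⋙ Arrow.rightFunc)).ShortExact

/-- The stable category of `CM R`. -/
abbrev StableCM : Type _ := Frobenius.StableCategory (cmConflation R)

/-- The stable category of `Mor^e(CM R)`. -/
abbrev StableMorE : Type _ := Frobenius.StableCategory (morEConflation R)

/-- The objects of the stable category of `Mor^e(CM R)` corresponding to the `P ⟶ T`
with `P` projective; `ObjectProperty.map` closes under isomorphisms. -/
def mor01 : ObjectProperty (StableMorE R) :=
  ObjectProperty.map (fun α => Module.Projective Rᵐᵒᵖ α.obj.left)
    (Frobenius.toStable (morEConflation R))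

/-- The objects of the stable category of `Mor^e(CM R)` corresponding to the `X ⟶ 0`. -/
def mor10 : ObjectProperty (StableMorE R) :=
  ObjectProperty.map (fun α => IsZero α.obj.right)
    (Frobenius.toStable (morEConflation R))

/-- The objects of the stable category of `Mor^e(CM R)` corresponding to the identities
`T ⟶ T`. -/
def mor11 : ObjectProperty (StableMorE R) :=
  ObjectProperty.map (fun α => ∃ T : ModuleCat.{u} Rᵐᵒᵖ, Nonempty (α.obj ≅ Arrow.mk (𝟙 T)))
    (Frobenius.toStable (morEConflation R))

end Gorenstein

/-!
If the left module `R` has finite injective dimension and `X` is a Cohen-Macaulay right module,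
dimension shifting along the syzygies of `X` shows that the dual `Hom(X, R)` has no higher
extensions by `R`. Hence the elements of `X` are separated by linear forms, and finitely many
generators of the dual embed `X` in a finite free module with Cohen-Macaulay cokernel. So `CM R` is
a Frobenius category whose projective objects are the projective modules; the same argument on
sources and targets makes `Mor^e(CM R)` one, its projective objects being the surjections between
projective modules.

The suspension of a Frobenius category is a cokernel of an embedding into an injective object. It
is an autoequivalence of the stable category, and replacing objects by their `ℤ`-indexed orbits
turns it into a strict shift.

Every surjection `α : X → T` lies in three conflations, `(K → 0) → α → (T = T)` with `K = ker α`,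
`(L → 0) → (P → T) → α` with `P → X` a free cover of kernel `L`, and `α → (Q → S) → (C = C)` with
`X → Q → C` a conflation, `Q` free and `S` the cokernel of `K → X → Q`. Each gives a distinguished
triangle; together with the vanishing of the stable morphisms from `P → T` to `X → 0`, from
`X → 0` to `T = T`, and from `T = T` to `P → T`, they give the three stable t-structures. The
recollement follows formally from two of them, and taking sources or targets gives the equivalences.
-/

/-! ### Shifts by the integers -/

lemma exists_forall_int_succ_eq {T : ℤ → Type*} (e : ∀ n, T n ≃ T (n + 1)) (t₀ : T 0) :
    ∃ t : ∀ n, T n, t 0 = t₀ ∧ ∀ n, t (n + 1) = e n (t n) := by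
  let nonneg : ∀ n : ℕ, T (Int.ofNat n) := fun n ↦
    Nat.rec (motive := fun n ↦ T (Int.ofNat n)) t₀ (fun k x ↦ e (Int.ofNat k) x) n
  let neg : ∀ n : ℕ, T (Int.negSucc n) := fun n ↦
    Nat.rec (motive := fun n ↦ T (Int.negSucc n)) ((e (Int.negSucc 0)).symm t₀)
      (fun k x ↦ (e (Int.negSucc (k + 1))).symm x) n
  refine ⟨fun n ↦ Int.rec nonneg neg n, rfl, ?_⟩
  rintro (n | _ | n)
  · rfl
  · exact ((e (Int.negSucc 0)).apply_symm_apply t₀).symm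
  · exact ((e (Int.negSucc (n + 1))).apply_symm_apply (neg n)).symm

/-- The `ℤ`-indexed orbits of an endofunctor `S`: sequences of objects in which `S` of each term
is identified with the next one. They carry a strict reindexing shift, and when `S` is an
equivalence they form a category equivalent to the original one. -/
structure ShiftOrbit {A : Type*} [Category A] (S : A ⥤ A) where
  obj : ℤ → A
  /-- the transition isomorphisms; the index equation is a variable, so that reindexing
  does not introduce casts -/
  iso : ∀ m n : ℤ, m + 1 = n → (S.obj (obj m) ≅ obj n)

namespace ShiftOrbit

variable {A : Type*} [Category A] {S : A ⥤ A}

/-- Morphisms of orbits: families of morphisms compatible with the transition isomorphisms. -/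
@[ext]
structure Hom (X Y : ShiftOrbit S) where
  f : ∀ n, X.obj n ⟶ Y.obj n
  comm : ∀ (m n : ℤ) (h : m + 1 = n),
    (X.iso m n h).hom ≫ f n = S.map (f m) ≫ (Y.iso m n h).hom

instance : Category (ShiftOrbit S) where
  Hom := Hom
  id X := { f := fun _ ↦ 𝟙 _, comm := by simp }
  comp φ ψ :=
    { f := fun n ↦ φ.f n ≫ ψ.f n
      comm := fun m n h ↦ by rw [← Category.assoc, φ.comm]; simp [ψ.comm] }

@[ext]
lemma hom_ext {X Y : ShiftOrbit S} (φ ψ : X ⟶ Y) (h : ∀ n, φ.f n = ψ.f n) : φ = ψ :=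
  Hom.ext (funext h)

@[simp]
lemma id_f (X : ShiftOrbit S) (n : ℤ) : Hom.f (𝟙 X) n = 𝟙 _ := rfl

@[simp]
lemma comp_f {X Y Z : ShiftOrbit S} (φ : X ⟶ Y) (ψ : Y ⟶ Z) (n : ℤ) :
    Hom.f (φ ≫ ψ) n = φ.f n ≫ ψ.f n := rfl

lemma eqToHom_f {X Y : ShiftOrbit S} (h : X = Y) (n : ℤ) :
    Hom.f (eqToHom h) n = eqToHom (by rw [h]) := by
  subst h
  rfl

lemma iso_hom_comp_eqToHom (X : ShiftOrbit S) {m n m' n' : ℤ} (h : m + 1 = n) (hm : m = m')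
    (hn : n = n') :
    (X.iso m n h).hom ≫ eqToHom (congrArg X.obj hn) =
      S.map (eqToHom (congrArg X.obj hm)) ≫ (X.iso m' n' (by rw [← hm, ← hn, h])).hom := by
  subst hm hn
  simp

/-- The translation of orbits by `k`. -/
@[simps]
def reindex (k : ℤ) : ShiftOrbit S ⥤ ShiftOrbit S where
  obj X :=
    { obj := fun n ↦ X.obj (n + k)
      iso := fun m n h ↦ X.iso (m + k) (n + k) (by omega) }
  map φ :=
    { f := fun n ↦ φ.f (n + k)
      comm := fun _ _ _ ↦ φ.comm _ _ _ }

@[simps]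
def isoMk {X Y : ShiftOrbit S} (e : ∀ n, X.obj n ≅ Y.obj n)
    (he : ∀ (m n : ℤ) (h : m + 1 = n),
      (X.iso m n h).hom ≫ (e n).hom = S.map (e m).hom ≫ (Y.iso m n h).hom) : X ≅ Y where
  hom := ⟨fun n ↦ (e n).hom, he⟩
  inv := ⟨fun n ↦ (e n).inv, fun m n h ↦ by
    rw [← cancel_mono (e n).hom, Category.assoc, Category.assoc, he]
    simp [← S.map_comp_assoc]⟩
  hom_inv_id := by ext n; simp
  inv_hom_id := by ext n; simp

def reindexZeroIso : reindex (S := S) 0 ≅ 𝟭 _ :=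
  NatIso.ofComponents
    (fun X ↦ isoMk (fun n ↦ eqToIso (congrArg X.obj (add_zero n)))
      (fun _ _ _ ↦ X.iso_hom_comp_eqToHom _ (add_zero _) (add_zero _)))
    (fun φ ↦ by ext n; exact eqToHom_naturality φ.f (add_zero n))

def reindexAddIso (a b : ℤ) : reindex (S := S) (a + b) ≅ reindex a ⋙ reindex b :=
  have h (n : ℤ) : n + (a + b) = n + b + a := by omega
  NatIso.ofComponents
    (fun X ↦ isoMk (fun n ↦ eqToIso (congrArg X.obj (h n)))
      (fun _ _ _ ↦ X.iso_hom_comp_eqToHom _ (h _) (h _)))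
    (fun φ ↦ by ext n; exact eqToHom_naturality φ.f (h n))

lemma reindexZeroIso_inv_app_f (X : ShiftOrbit S) (n : ℤ) :
    Hom.f (reindexZeroIso.inv.app X) n = eqToHom (congrArg X.obj (add_zero n).symm) := rfl

lemma reindexAddIso_hom_app_f (a b : ℤ) (X : ShiftOrbit S) (n : ℤ) :
    Hom.f ((reindexAddIso a b).hom.app X) n = eqToHom (congrArg X.obj (by omega)) := rfl

instance : HasShift (ShiftOrbit S) ℤ :=
  hasShiftMk _ _
    { F := reindex
      zero := reindexZeroIso
      add := reindexAddIso
      assoc_hom_app := fun a b c X ↦ by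
        ext n
        simp only [comp_f, eqToHom_f, reindexAddIso_hom_app_f, reindex_map_f]
        exact (eqToHom_trans _ _).trans
          ((congrArg _ (eqToHom_trans _ _)).trans (eqToHom_trans _ _)).symm
      zero_add_hom_app := fun a X ↦ by
        ext n
        simp only [comp_f, eqToHom_f, reindexAddIso_hom_app_f, reindexZeroIso_inv_app_f,
          reindex_map_f]
        exact (eqToHom_trans _ _).symm
      add_zero_hom_app := fun a X ↦ by
        ext n
        simp only [comp_f, eqToHom_f, reindexAddIso_hom_app_f, reindexZeroIso_inv_app_f]
        exact (eqToHom_trans _ _).symm }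

variable (S) in
/-- The zeroth term of an orbit. -/
@[simps]
def eval : ShiftOrbit S ⥤ A where
  obj X := X.obj 0
  map φ := φ.f 0

variable (S) in
def shiftOneCompEvalIso : shiftFunctor (ShiftOrbit S) (1 : ℤ) ⋙ eval S ≅ eval S ⋙ S :=
  NatIso.ofComponents (fun X ↦ (X.iso 0 (0 + 1) rfl).symm) (fun {X Y} φ ↦ by
    change φ.f (0 + 1) ≫ (Y.iso 0 (0 + 1) rfl).inv = (X.iso 0 (0 + 1) rfl).inv ≫ S.map (φ.f 0)
    rw [Iso.comp_inv_eq, Category.assoc, Iso.eq_inv_comp]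
    exact φ.comm 0 (0 + 1) rfl)

lemma f_eq_of_f_zero_eq [S.Faithful] {X Y : ShiftOrbit S} {φ ψ : X ⟶ Y} (h : φ.f 0 = ψ.f 0)
    (n : ℤ) : φ.f n = ψ.f n := by
  induction n using Int.induction_on with
  | zero => exact h
  | succ i hi =>
    rw [← cancel_epi (X.iso i (i + 1) rfl).hom, φ.comm, ψ.comm, hi]
  | pred i hi =>
    apply S.map_injective
    rw [← cancel_mono (Y.iso (-i - 1) (-i) (by omega)).hom, ← φ.comm, ← ψ.comm, hi]

instance [S.Faithful] : (eval S).Faithful where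
  map_injective h := by ext n; exact f_eq_of_f_zero_eq h n

instance [S.Full] [S.Faithful] : (eval S).Full where
  map_surjective {X Y} g := by
    obtain ⟨f, hf₀, hf⟩ := exists_forall_int_succ_eq (T := fun n ↦ X.obj n ⟶ Y.obj n)
      (fun n ↦ ((Functor.FullyFaithful.ofFullyFaithful S).homEquiv).trans
        ((X.iso n (n + 1) rfl).homCongr (Y.iso n (n + 1) rfl))) g
    refine ⟨⟨f, ?_⟩, hf₀⟩
    rintro m n rfl
    rw [hf]
    simp [Functor.FullyFaithful.homEquiv]

instance [S.IsEquivalence] : (eval S).EssSurj where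
  mem_essImage X := by
    let o : ℤ → A := fun n ↦ Int.rec
      (fun k ↦ Nat.rec (motive := fun _ ↦ A) X (fun _ Y ↦ S.obj Y) k)
      (fun k ↦ Nat.rec (motive := fun _ ↦ A) (S.inv.obj X) (fun _ Y ↦ S.inv.obj Y) k) n
    refine ⟨⟨o, ?_⟩, ⟨Iso.refl _⟩⟩
    rintro m n rfl
    match m with
    | .ofNat k => exact Iso.refl _
    | .negSucc 0 => exact S.asEquivalence.counitIso.app X
    | .negSucc (k + 1) => exact S.asEquivalence.counitIso.app (o (Int.negSucc k))

instance [S.IsEquivalence] : (eval S).IsEquivalence where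

end ShiftOrbit

theorem exists_hasShift_of_isEquivalence {A : Type*} [Category A] (S : A ⥤ A)
    [S.IsEquivalence] :
    ∃ (_ : HasShift A ℤ), Nonempty (shiftFunctor A (1 : ℤ) ≅ S) := by
  let F := ShiftOrbit.eval S
  let s : ℤ → A ⥤ A := fun a ↦ F.inv ⋙ shiftFunctor (ShiftOrbit S) a ⋙ F
  let i : ∀ a, F ⋙ s a ≅ shiftFunctor (ShiftOrbit S) a ⋙ F := fun a ↦
    Functor.isoWhiskerRight F.asEquivalence.unitIso.symm (shiftFunctor (ShiftOrbit S) a ⋙ F)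
  let e : s 1 ≅ S :=
    Functor.isoWhiskerLeft F.inv (ShiftOrbit.shiftOneCompEvalIso S) ≪≫
      (Functor.associator _ _ _).symm ≪≫
      Functor.isoWhiskerRight F.asEquivalence.counitIso S ≪≫ S.leftUnitor
  exact ⟨HasShift.induced F ℤ s i, ⟨e⟩⟩

/-- The isomorphisms witnessing that `F` commutes with the shift by an element of `M`, in all
degrees together. Under composition they form a group, so that a commutation isomorphism in
degree `1` is extended to all integers by taking powers. -/
structure GradedCommIso {C D : Type*} [Category C] [Category D] (F : C ⥤ D) (M : Type*)
    [AddMonoid M] [HasShift C M] [HasShift D M] where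
  deg : M
  iso : shiftFunctor C deg ⋙ F ≅ F ⋙ shiftFunctor D deg

namespace GradedCommIso

open Functor.CommShift

variable {C D : Type*} [Category C] [Category D] {F : C ⥤ D}

section AddMonoid

variable {M : Type*} [AddMonoid M] [HasShift C M] [HasShift D M]

/-- Transport of the commutation isomorphism along an equality of degrees. -/
def isoOfDegEq (x : GradedCommIso F M) (n : M) (h : x.deg = n) :
    shiftFunctor C n ⋙ F ≅ F ⋙ shiftFunctor D n := h ▸ x.iso

lemma isoOfDegEq_congr {x y : GradedCommIso F M} (h : x = y) (n : M) (hx : x.deg = n) :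
    x.isoOfDegEq n hx = y.isoOfDegEq n (h ▸ hx) := by
  subst h
  rfl

lemma ext_of_isoOfDegEq {x y : GradedCommIso F M} (n : M) (hx : x.deg = n) (hy : y.deg = n)
    (h : x.isoOfDegEq n hx = y.isoOfDegEq n hy) : x = y := by
  obtain ⟨a, e⟩ := x
  obtain ⟨b, e'⟩ := y
  obtain rfl : a = n := hx
  obtain rfl : b = a := hy
  obtain rfl : e = e' := h
  rfl

noncomputable instance : Mul (GradedCommIso F M) := ⟨fun x y ↦ ⟨x.deg + y.deg, isoAdd x.iso y.iso⟩⟩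

noncomputable instance : One (GradedCommIso F M) := ⟨⟨0, isoZero F M⟩⟩

lemma deg_mul (x y : GradedCommIso F M) : (x * y).deg = x.deg + y.deg := rfl

lemma deg_one : (1 : GradedCommIso F M).deg = 0 := rfl

lemma isoOfDegEq_mul (x y : GradedCommIso F M) {a b c : M} (ha : x.deg = a) (hb : y.deg = b)
    (h : a + b = c) :
    (x * y).isoOfDegEq c (by rw [deg_mul, ha, hb, h]) =
      isoAdd' h (x.isoOfDegEq a ha) (y.isoOfDegEq b hb) := by
  subst ha hb h
  rfl

noncomputable instance : Monoid (GradedCommIso F M) where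
  mul_assoc x y z := by
    apply ext_of_isoOfDegEq (x.deg + y.deg + z.deg) rfl (by simp [deg_mul, add_assoc])
    rw [isoOfDegEq_mul (x * y) z (deg_mul x y) rfl rfl, isoOfDegEq_mul x y rfl rfl rfl,
      isoOfDegEq_mul x (y * z) rfl (deg_mul y z) (add_assoc _ _ _).symm,
      isoOfDegEq_mul y z rfl rfl rfl]
    exact isoAdd'_assoc _ _ _ rfl rfl rfl
  one_mul x := by
    apply ext_of_isoOfDegEq x.deg (by simp [deg_mul, deg_one]) rfl
    rw [isoOfDegEq_mul 1 x rfl rfl (zero_add _)]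
    exact isoZero_isoAdd'_ _
  mul_one x := by
    apply ext_of_isoOfDegEq x.deg (by simp [deg_mul, deg_one]) rfl
    rw [isoOfDegEq_mul x 1 rfl rfl (add_zero _)]
    exact isoAdd'_isoZero _

variable (F M) in
/-- The degree, as a homomorphism. -/
noncomputable def degHom : GradedCommIso F M →* Multiplicative M where
  toFun x := Multiplicative.ofAdd x.deg
  map_one' := rfl
  map_mul' _ _ := rfl

end AddMonoid

section AddGroup

variable {G : Type*} [AddGroup G] [HasShift C G] [HasShift D G]

lemma exists_isoAdd'_eq_isoZero {a b : G} (h : b + a = 0)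
    (e : shiftFunctor C a ⋙ F ≅ F ⋙ shiftFunctor D a) :
    ∃ e' : shiftFunctor C b ⋙ F ≅ F ⋙ shiftFunctor D b,
      isoAdd' h e' e = isoZero F G := by
  let t : (shiftFunctor C b ⋙ F) ⋙ shiftFunctor D a ≅
      (F ⋙ shiftFunctor D b) ⋙ shiftFunctor D a :=
    Functor.associator _ _ _ ≪≫ Functor.isoWhiskerLeft _ e.symm ≪≫
      (Functor.associator _ _ _).symm ≪≫
      Functor.isoWhiskerRight (shiftFunctorAdd' C b a 0 h).symm F ≪≫ isoZero F G ≪≫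
      Functor.isoWhiskerLeft F (shiftFunctorAdd' D b a 0 h) ≪≫ (Functor.associator _ _ _).symm
  let whisker := (Functor.FullyFaithful.ofFullyFaithful (shiftFunctor D a)).whiskeringRight C
  refine ⟨whisker.preimageIso t, ?_⟩
  ext X
  have hX : (shiftFunctor D a).map ((whisker.preimageIso t).hom.app X) = e.inv.app (X⟦b⟧) ≫
      F.map ((shiftFunctorAdd' C b a 0 h).inv.app X) ≫ (isoZero F G).hom.app X ≫
      (shiftFunctorAdd' D b a 0 h).hom.app (F.obj X) := by
    simpa [t] using congr($(whisker.map_preimage t.hom).app X)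
  have h₁ := e.hom_inv_id_app (X⟦b⟧)
  have h₂ := F.congr_map ((shiftFunctorAdd' C b a 0 h).hom_inv_id_app X)
  rw [F.map_comp] at h₂
  simp only [isoAdd'_hom_app, hX, Category.assoc, Iso.hom_inv_id_app, reassoc_of% h₁]
  rw [reassoc_of% h₂]
  simp

lemma exists_mul_eq_one (x : GradedCommIso F G) : ∃ y, y * x = 1 := by
  obtain ⟨e', he⟩ := exists_isoAdd'_eq_isoZero (neg_add_cancel x.deg) x.iso
  refine ⟨⟨-x.deg, e'⟩, ext_of_isoOfDegEq 0 (neg_add_cancel x.deg) rfl ?_⟩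
  rw [isoOfDegEq_mul _ x rfl rfl (neg_add_cancel x.deg)]
  exact he

noncomputable instance : Group (GradedCommIso F G) where
  inv x := x.exists_mul_eq_one.choose
  inv_mul_cancel x := x.exists_mul_eq_one.choose_spec

lemma deg_zpow (x : GradedCommIso F G) (n : ℤ) : (x ^ n).deg = n • x.deg :=
  map_zpow (degHom F G) x n

end AddGroup

end GradedCommIso

theorem exists_commShift_of_iso_one {C D : Type*} [Category C] [Category D] [HasShift C ℤ]
    [HasShift D ℤ] (F : C ⥤ D)
    (e : shiftFunctor C (1 : ℤ) ⋙ F ≅ F ⋙ shiftFunctor D (1 : ℤ)) :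
    ∃ h : F.CommShift ℤ, h.commShiftIso 1 = e := by
  let x : GradedCommIso F ℤ := ⟨1, e⟩
  have deg_pow (n : ℤ) : (x ^ n).deg = n := by
    rw [x.deg_zpow, smul_eq_mul, mul_one]
  exact ⟨{
    commShiftIso := fun n ↦ (x ^ n).isoOfDegEq n (deg_pow n)
    commShiftIso_zero := GradedCommIso.isoOfDegEq_congr (zpow_zero x) 0 (deg_pow 0)
    commShiftIso_add := fun a b ↦
      (GradedCommIso.isoOfDegEq_congr (zpow_add x a b) (a + b) (deg_pow _)).trans
        (GradedCommIso.isoOfDegEq_mul _ _ (deg_pow a) (deg_pow b) rfl) },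
    GradedCommIso.isoOfDegEq_congr (zpow_one x) 1 (deg_pow 1)⟩

/-! ### Frobenius categories -/

namespace Frobenius

section Preadditive

variable {C : Type*} [Category C] [Preadditive C]

lemma isPushout_of_exists_desc {X Y Z W : C} {f : X ⟶ Y} {g : X ⟶ Z} {inl : Y ⟶ W} {inr : Z ⟶ W}
    (comm : f ≫ inl = g ≫ inr)
    (hdesc : ∀ ⦃T : C⦄ (a : Y ⟶ T) (b : Z ⟶ T), f ≫ a = g ≫ b → ∃ t, inl ≫ t = a ∧ inr ≫ t = b)
    (hext : ∀ ⦃T : C⦄ (t : W ⟶ T), inl ≫ t = 0 → inr ≫ t = 0 → t = 0) :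
    IsPushout f g inl inr := by
  choose desc inl_desc inr_desc using hdesc
  refine ⟨⟨comm⟩, ⟨PushoutCocone.IsColimit.mk comm (fun s ↦ desc s.inl s.inr s.condition)
    (fun s ↦ inl_desc _ _ _) (fun s ↦ inr_desc _ _ _) (fun s m h₁ h₂ ↦ ?_)⟩⟩
  rw [← sub_eq_zero]
  apply hext
  · rw [Preadditive.comp_sub, h₁, inl_desc, sub_self]
  · rw [Preadditive.comp_sub, h₂, inr_desc, sub_self]

variable [HasBinaryBiproducts C] {D : Type*} [Category D] [Preadditive D]

@[simps]
noncomputable def mapInlIso (F : C ⥤ D) [F.Additive] (X : C) {Q : C} (hQ : IsZero (F.obj Q)) :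
    F.obj X ≅ F.obj (X ⊞ Q) where
  hom := F.map biprod.inl
  inv := F.map biprod.fst
  hom_inv_id := by simp [← F.map_comp]
  inv_hom_id := by
    have h := F.congr_map (biprod.total (X := X) (Y := Q))
    rwa [F.map_add, F.map_comp, F.map_comp, hQ.eq_of_tgt (F.map biprod.snd) 0, zero_comp, add_zero,
      CategoryTheory.Functor.map_id] at h

@[simps]
noncomputable def mapInrIso (F : C ⥤ D) [F.Additive] (X : C) {Q : C} (hQ : IsZero (F.obj Q)) :
    F.obj X ≅ F.obj (Q ⊞ X) where
  hom := F.map biprod.inr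
  inv := F.map biprod.snd
  hom_inv_id := by simp [← F.map_comp]
  inv_hom_id := by
    have h := F.congr_map (biprod.total (X := Q) (Y := X))
    rwa [F.map_add, F.map_comp, F.map_comp, hQ.eq_of_tgt (F.map biprod.fst) 0, zero_comp, zero_add,
      CategoryTheory.Functor.map_id] at h

end Preadditive

section StableCategory

variable {C : Type*} [Category C] [Preadditive C] [HasBinaryBiproducts C] [HasZeroObject C]
  {E : ObjectProperty (ShortComplex C)}

lemma toStable_map_eq_iff {X Y : C} (f g : X ⟶ Y) :
    (toStable E).map f = (toStable E).map g ↔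
      ∃ (Q : C) (_ : relProjective E Q) (a : X ⟶ Q) (b : Q ⟶ Y), f - g = a ≫ b := by
  rw [Quotient.functor_map_eq_iff]
  rfl

lemma toStable_map_eq_of_sub_eq {X Y Q : C} (f g : X ⟶ Y) (hQ : relProjective E Q) (a : X ⟶ Q)
    (b : Q ⟶ Y) (h : f - g = a ≫ b) : (toStable E).map f = (toStable E).map g :=
  (toStable_map_eq_iff f g).2 ⟨Q, hQ, a, b, h⟩

lemma toStable_map_eq_zero_iff {X Y : C} (f : X ⟶ Y) :
    (toStable E).map f = 0 ↔
      ∃ (Q : C) (_ : relProjective E Q) (a : X ⟶ Q) (b : Q ⟶ Y), f = a ≫ b := by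
  rw [← Functor.map_zero (toStable E), toStable_map_eq_iff]
  simp only [sub_zero]

lemma isZero_toStable_obj {Q : C} (hQ : relProjective E Q) : IsZero ((toStable E).obj Q) := by
  rw [IsZero.iff_id_eq_zero, ← (toStable E).map_id, toStable_map_eq_zero_iff]
  exact ⟨Q, hQ, 𝟙 _, 𝟙 _, by simp⟩

instance : HasBinaryBiproducts (StableCategory E) where
  has_binary_biproduct X Y := hasBinaryBiproduct_of_total
    ((toStable E).mapBinaryBicone (BinaryBiproduct.bicone X.as Y.as)) (by
      have := (toStable E).congr_map (biprod.total (X := X.as) (Y := Y.as))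
      rwa [Functor.map_add, Functor.map_comp, Functor.map_comp,
        CategoryTheory.Functor.map_id] at this)

end StableCategory

/-- Frobenius exact categories, given by the class `E` of their conflations. The fields replace
Quillen's conditions by the properties of conflations from which Happel's triangulation is built:
conflations are kernel-cokernel pairs, inflations are stable under pushout (`exists_biprod`) and
composition (`exists_comp`, with the conflation between the cokernels), and there are enough
projectives, all of which are injective. -/
structure IsFrobenius {C : Type*} [Category C] [Preadditive C] [HasBinaryBiproducts C]
    (E : ObjectProperty (ShortComplex C)) : Prop where
  mono_f {S : ShortComplex C} (hS : E S) : Mono S.f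
  epi_g {S : ShortComplex C} (hS : E S) : Epi S.g
  exists_lift {S : ShortComplex C} (hS : E S) {T : C} (t : T ⟶ S.X₂) (ht : t ≫ S.g = 0) :
    ∃ s, s ≫ S.f = t
  exists_desc {S : ShortComplex C} (hS : E S) {T : C} (t : S.X₂ ⟶ T) (ht : S.f ≫ t = 0) :
    ∃ s, S.g ≫ s = t
  exists_biprod {S : ShortComplex C} (hS : E S) {Y : C} (u : S.X₁ ⟶ Y) :
    ∃ (Z : C) (p : S.X₂ ⊞ Y ⟶ Z) (w : biprod.lift S.f u ≫ p = 0),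
      E (ShortComplex.mk (biprod.lift S.f u) p w)
  exists_comp {X₁ X₂ X₃ Z₁₂ Z₂₃ : C} {f₁₂ : X₁ ⟶ X₂} {g₁₂ : X₂ ⟶ Z₁₂} {w₁₂ : f₁₂ ≫ g₁₂ = 0}
    {f₂₃ : X₂ ⟶ X₃} {g₂₃ : X₃ ⟶ Z₂₃} {w₂₃ : f₂₃ ≫ g₂₃ = 0}
    (h₁₂ : E (ShortComplex.mk f₁₂ g₁₂ w₁₂)) (h₂₃ : E (ShortComplex.mk f₂₃ g₂₃ w₂₃)) :
    ∃ (Z₁₃ : C) (g₁₃ : X₃ ⟶ Z₁₃) (w₁₃ : (f₁₂ ≫ f₂₃) ≫ g₁₃ = 0) (m₁ : Z₁₂ ⟶ Z₁₃) (m₃ : Z₁₃ ⟶ Z₂₃)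
      (w : m₁ ≫ m₃ = 0), E (ShortComplex.mk (f₁₂ ≫ f₂₃) g₁₃ w₁₃) ∧ E (ShortComplex.mk m₁ m₃ w) ∧
        g₁₂ ≫ m₁ = f₂₃ ≫ g₁₃ ∧ g₁₃ ≫ m₃ = g₂₃
  isPushout_of_isIso {S S' : ShortComplex C} (hS : E S) (hS' : E S') (φ : S ⟶ S')
    (hφ : IsIso φ.τ₃) : IsPushout S.f φ.τ₁ φ.τ₂ S'.f
  enough_injectives (X : C) : ∃ (I X' : C) (i : X ⟶ I) (p : I ⟶ X') (w : i ≫ p = 0),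
    E (ShortComplex.mk i p w) ∧ relProjective E I
  enough_projectives (X : C) : ∃ (P X' : C) (i : X' ⟶ P) (p : P ⟶ X) (w : i ≫ p = 0),
    E (ShortComplex.mk i p w) ∧ relProjective E P
  relInjective_of_relProjective {X : C} (hX : relProjective E X) : relInjective E X

namespace IsFrobenius

variable {C : Type*} [Category C] [Preadditive C] [HasBinaryBiproducts C]
  {E : ObjectProperty (ShortComplex C)} (hE : IsFrobenius E)

include hE

lemma exists_hom_of_relInjective {S T : ShortComplex C} (hS : E S) (hT : relInjective E T.X₂)
    (a : S.X₁ ⟶ T.X₁) : ∃ φ : S ⟶ T, φ.τ₁ = a := by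
  obtain ⟨b, hb⟩ := hT S hS (a ≫ T.f)
  obtain ⟨c, hc⟩ := hE.exists_desc hS (b ≫ T.g) (by rw [reassoc_of% hb, T.zero, comp_zero])
  exact ⟨⟨a, b, c, hb.symm, hc.symm⟩, rfl⟩

lemma exists_hom_of_relProjective {S T : ShortComplex C} (hT : E T) (hS : relProjective E S.X₂)
    (c : S.X₃ ⟶ T.X₃) : ∃ φ : S ⟶ T, φ.τ₃ = c := by
  obtain ⟨b, hb⟩ := hS T hT (S.g ≫ c)
  obtain ⟨a, ha⟩ := hE.exists_lift hT (S.f ≫ b) (by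
    rw [Category.assoc, hb, S.zero_assoc, zero_comp])
  exact ⟨⟨a, b, c, ha, hb⟩, rfl⟩

lemma isPushout_of_biprod {S : ShortComplex C} {Y Z : C} {u : S.X₁ ⟶ Y}
    {p : S.X₂ ⊞ Y ⟶ Z} {w : biprod.lift S.f u ≫ p = 0}
    (h : E (ShortComplex.mk (biprod.lift S.f u) p w)) :
    IsPushout S.f u (-biprod.inl ≫ p) (biprod.inr ≫ p) := by
  have hw : S.f ≫ biprod.inl ≫ p + u ≫ biprod.inr ≫ p = 0 := by
    rwa [biprod.lift_eq, Preadditive.add_comp, Category.assoc, Category.assoc] at w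
  refine isPushout_of_exists_desc ?_ (fun T a b hab ↦ ?_) (fun T t h₁ h₂ ↦ ?_)
  · rw [Preadditive.comp_neg, neg_eq_iff_add_eq_zero, hw]
  · obtain ⟨t, ht⟩ := hE.exists_desc h (biprod.desc (-a) b) (by simp [hab])
    dsimp at ht
    exact ⟨t, by simp [ht], by simp [ht]⟩
  · have : Epi p := hE.epi_g h
    rw [← cancel_epi p, comp_zero]
    ext
    · simpa using h₁
    · simpa using h₂

lemma isPushout_biprod_lift {S : ShortComplex C} (hS : E S) {I : C} (k : S.X₂ ⟶ I) :
    IsPushout (S.f ≫ k) S.f biprod.inr (biprod.lift S.g k) := by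
  refine isPushout_of_exists_desc (by ext <;> simp) (fun T a b hab ↦ ?_) (fun T t h₁ h₂ ↦ ?_)
  · obtain ⟨c, hc⟩ := hE.exists_desc hS (b - k ≫ a) (by
      rw [Preadditive.comp_sub, ← hab, Category.assoc, sub_self])
    exact ⟨biprod.desc c a, by simp, by simp [hc]⟩
  · have := hE.epi_g hS
    rw [biprod.lift_eq, Preadditive.add_comp, Category.assoc, Category.assoc, h₁, comp_zero,
      add_zero] at h₂
    ext
    · rw [← cancel_epi S.g, h₂, comp_zero, comp_zero]
    · rw [h₁, comp_zero]

lemma isPushout_of_comp {X Y I Z W : C} {f : X ⟶ Y} {g : Y ⟶ Z} {wfg : f ≫ g = 0} {i : Y ⟶ I}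
    {q : I ⟶ W} {wq : (f ≫ i) ≫ q = 0} {z : Z ⟶ W} (h : E (ShortComplex.mk f g wfg))
    (h' : E (ShortComplex.mk (f ≫ i) q wq)) (hz : g ≫ z = i ≫ q) : IsPushout i g q z := by
  refine isPushout_of_exists_desc hz.symm (fun T a b hab ↦ ?_) (fun T t ht _ ↦ ?_)
  · obtain ⟨t, ht : q ≫ t = a⟩ := hE.exists_desc h' a (by
      dsimp
      rw [Category.assoc, hab, reassoc_of% wfg, zero_comp])
    have : Epi g := hE.epi_g h
    refine ⟨t, ht, ?_⟩
    rw [← cancel_epi g, ← hab, reassoc_of% hz, ht]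
  · have : Epi q := hE.epi_g h'
    rw [← cancel_epi q, ht, comp_zero]

/-- The middle term of the chosen conflation starting at `X`. -/
noncomputable def inj (X : C) : C := (hE.enough_injectives X).choose

/-- The last term of the chosen conflation starting at `X`, that is, the suspension of `X`. -/
noncomputable def susp (X : C) : C := (hE.enough_injectives X).choose_spec.choose

/-- The inflation of the chosen conflation starting at `X`. -/
noncomputable def toInj (X : C) : X ⟶ hE.inj X :=
  (hE.enough_injectives X).choose_spec.choose_spec.choose

/-- The deflation of the chosen conflation starting at `X`. -/
noncomputable def toSusp (X : C) : hE.inj X ⟶ hE.susp X :=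
  (hE.enough_injectives X).choose_spec.choose_spec.choose_spec.choose

/-- The chosen conflation starting at `X`, with projective-injective middle term. -/
noncomputable abbrev injSeq (X : C) : ShortComplex C :=
  ShortComplex.mk (hE.toInj X) (hE.toSusp X)
    (hE.enough_injectives X).choose_spec.choose_spec.choose_spec.choose_spec.choose

lemma injSeq_mem (X : C) : E (hE.injSeq X) :=
  (hE.enough_injectives X).choose_spec.choose_spec.choose_spec.choose_spec.choose_spec.1

lemma relProjective_inj (X : C) : relProjective E (hE.inj X) :=
  (hE.enough_injectives X).choose_spec.choose_spec.choose_spec.choose_spec.choose_spec.2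

lemma relInjective_inj (X : C) : relInjective E (hE.inj X) :=
  hE.relInjective_of_relProjective (hE.relProjective_inj X)

/-- An extension of the identity of `S.X₁` to a morphism from a conflation `S` to the chosen one. -/
noncomputable def toInjSeq {S : ShortComplex C} (hS : E S) : S ⟶ hE.injSeq S.X₁ :=
  (hE.exists_hom_of_relInjective (T := hE.injSeq S.X₁) hS (hE.relInjective_inj _) (𝟙 _)).choose

@[simp]
lemma toInjSeq_τ₁ {S : ShortComplex C} (hS : E S) : (hE.toInjSeq hS).τ₁ = 𝟙 S.X₁ :=
  (hE.exists_hom_of_relInjective (T := hE.injSeq S.X₁) hS (hE.relInjective_inj _)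
    (𝟙 _)).choose_spec

/-- An extension of `f : X ⟶ Y` to the chosen conflations. -/
noncomputable def injSeqMap {X Y : C} (f : X ⟶ Y) : hE.injSeq X ⟶ hE.injSeq Y :=
  (hE.exists_hom_of_relInjective (T := hE.injSeq Y) (hE.injSeq_mem X) (hE.relInjective_inj Y)
    f).choose

@[simp]
lemma injSeqMap_τ₁ {X Y : C} (f : X ⟶ Y) : (hE.injSeqMap f).τ₁ = f :=
  (hE.exists_hom_of_relInjective (T := hE.injSeq Y) (hE.injSeq_mem X) (hE.relInjective_inj Y)
    f).choose_spec

variable [HasZeroObject C]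

lemma map_τ₃_eq_zero {S T : ShortComplex C} (hS : E S) (hT : relProjective E T.X₂)
    (φ : S ⟶ T) (h : (toStable E).map φ.τ₁ = 0) : (toStable E).map φ.τ₃ = 0 := by
  obtain ⟨Q, hQ, a, b, hab⟩ := (toStable_map_eq_zero_iff _).1 h
  obtain ⟨c, hc⟩ := hE.relInjective_of_relProjective hQ S hS a
  obtain ⟨k, hk⟩ := hE.exists_desc hS (φ.τ₂ - c ≫ b ≫ T.f) (by
    rw [Preadditive.comp_sub, reassoc_of% hc, ← φ.comm₁₂, hab, Category.assoc, sub_self])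
  refine (toStable_map_eq_zero_iff _).2 ⟨_, hT, k, T.g, ?_⟩
  have := hE.epi_g hS
  rw [← cancel_epi S.g, ← φ.comm₂₃, reassoc_of% hk, Preadditive.sub_comp]
  simp

lemma map_τ₁_eq_zero {S T : ShortComplex C} (hT : E T) (hS : relProjective E S.X₂)
    (φ : S ⟶ T) (h : (toStable E).map φ.τ₃ = 0) : (toStable E).map φ.τ₁ = 0 := by
  obtain ⟨Q, hQ, a, b, hab⟩ := (toStable_map_eq_zero_iff _).1 h
  obtain ⟨c, hc⟩ := hQ T hT b
  obtain ⟨k, hk⟩ := hE.exists_lift hT (φ.τ₂ - S.g ≫ a ≫ c) (by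
    rw [Preadditive.sub_comp, Category.assoc, Category.assoc, hc, φ.comm₂₃, hab, sub_self])
  refine (toStable_map_eq_zero_iff _).2 ⟨_, hS, S.f, k, ?_⟩
  have := hE.mono_f hT
  rw [← cancel_mono T.f, φ.comm₁₂, Category.assoc, hk, Preadditive.comp_sub]
  simp

lemma map_τ₃_eq {S T : ShortComplex C} (hS : E S) (hT : relProjective E T.X₂)
    (φ ψ : S ⟶ T) (h : (toStable E).map φ.τ₁ = (toStable E).map ψ.τ₁) :
    (toStable E).map φ.τ₃ = (toStable E).map ψ.τ₃ := by
  rw [← sub_eq_zero, ← Functor.map_sub] at h ⊢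
  exact hE.map_τ₃_eq_zero hS hT (φ - ψ) h

lemma map_τ₁_eq {S T : ShortComplex C} (hT : E T) (hS : relProjective E S.X₂)
    (φ ψ : S ⟶ T) (h : (toStable E).map φ.τ₃ = (toStable E).map ψ.τ₃) :
    (toStable E).map φ.τ₁ = (toStable E).map ψ.τ₁ := by
  rw [← sub_eq_zero, ← Functor.map_sub] at h ⊢
  exact hE.map_τ₁_eq_zero hT hS (φ - ψ) h

/-- The suspension functor, before passing to the stable category at the source. -/
noncomputable def suspBase : C ⥤ StableCategory E where
  obj X := (toStable E).obj (hE.susp X)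
  map f := (toStable E).map (hE.injSeqMap f).τ₃
  map_id X := by
    rw [← CategoryTheory.Functor.map_id]
    exact hE.map_τ₃_eq (hE.injSeq_mem X) (hE.relProjective_inj X) _ (𝟙 (hE.injSeq X)) (by simp)
  map_comp {X Y Z} f g := by
    rw [← Functor.map_comp]
    exact hE.map_τ₃_eq (hE.injSeq_mem X) (hE.relProjective_inj Z) _
      (hE.injSeqMap f ≫ hE.injSeqMap g) (by simp)

/-- The suspension functor of the stable category. -/
noncomputable def suspension : StableCategory E ⥤ StableCategory E :=
  CategoryTheory.Quotient.lift _ hE.suspBase (fun X Y f g h ↦ by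
    refine hE.map_τ₃_eq (hE.injSeq_mem X) (hE.relProjective_inj Y) (hE.injSeqMap f)
      (hE.injSeqMap g) ?_
    rw [injSeqMap_τ₁, injSeqMap_τ₁]
    exact CategoryTheory.Quotient.sound _ h)

lemma suspension_map_τ₁ {X Y : C} (φ : hE.injSeq X ⟶ hE.injSeq Y) :
    hE.suspension.map ((toStable E).map φ.τ₁) = (toStable E).map φ.τ₃ :=
  hE.map_τ₃_eq (hE.injSeq_mem X) (hE.relProjective_inj Y) (hE.injSeqMap φ.τ₁) φ
    (by rw [injSeqMap_τ₁])

instance : hE.suspension.Faithful where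
  map_injective {X Y f g} h := by
    obtain ⟨X⟩ := X
    obtain ⟨Y⟩ := Y
    obtain ⟨f, rfl⟩ := (toStable E).map_surjective f
    obtain ⟨g, rfl⟩ := (toStable E).map_surjective g
    have := hE.map_τ₁_eq (hE.injSeq_mem Y) (hE.relProjective_inj X) (hE.injSeqMap f)
      (hE.injSeqMap g) h
    rwa [injSeqMap_τ₁, injSeqMap_τ₁] at this

instance : hE.suspension.Full where
  map_surjective {X Y} f := by
    obtain ⟨X⟩ := X
    obtain ⟨Y⟩ := Y
    obtain ⟨f, rfl⟩ := (toStable E).map_surjective (X := hE.susp X) (Y := hE.susp Y) f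
    obtain ⟨φ, rfl⟩ := hE.exists_hom_of_relProjective (S := hE.injSeq X) (T := hE.injSeq Y)
      (hE.injSeq_mem Y) (hE.relProjective_inj X) f
    exact ⟨(toStable E).map φ.τ₁, hE.suspension_map_τ₁ φ⟩

lemma isIso_map_toInjSeq_τ₃ {S : ShortComplex C} (hS : E S) (hp : relProjective E S.X₂) :
    IsIso ((toStable E).map (hE.toInjSeq hS).τ₃) := by
  obtain ⟨ψ, hψ⟩ := hE.exists_hom_of_relInjective (S := hE.injSeq S.X₁) (T := S)
    (hE.injSeq_mem _) (hE.relInjective_of_relProjective hp) (𝟙 _)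
  refine ⟨(toStable E).map ψ.τ₃, ?_, ?_⟩
  · rw [← Functor.map_comp, ← CategoryTheory.Functor.map_id]
    exact hE.map_τ₃_eq hS hp (hE.toInjSeq hS ≫ ψ) (𝟙 S) (by simp [hψ])
  · rw [← Functor.map_comp, ← CategoryTheory.Functor.map_id]
    exact hE.map_τ₃_eq (hE.injSeq_mem _) (hE.relProjective_inj _) (ψ ≫ hE.toInjSeq hS)
      (𝟙 (hE.injSeq S.X₁)) (by simp [hψ])

/-- The identification of the suspension of `S.X₁` with `S.X₃`, for a conflation `S` with
projective-injective middle term. -/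
noncomputable def suspIso {S : ShortComplex C} (hS : E S) (hp : relProjective E S.X₂) :
    (toStable E).obj S.X₃ ≅ hE.suspension.obj ((toStable E).obj S.X₁) :=
  let f : (toStable E).obj S.X₃ ⟶ hE.suspension.obj ((toStable E).obj S.X₁) :=
    (toStable E).map (hE.toInjSeq hS).τ₃
  have : IsIso f := hE.isIso_map_toInjSeq_τ₃ hS hp
  asIso f

lemma suspIso_naturality {S S' : ShortComplex C} (φ : S ⟶ S') (hS : E S)
    (hp : relProjective E S.X₂) (hS' : E S') (hp' : relProjective E S'.X₂) :
    (toStable E).map φ.τ₃ ≫ (hE.suspIso hS' hp').hom =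
      (hE.suspIso hS hp).hom ≫ hE.suspension.map ((toStable E).map φ.τ₁) := by
  have h := hE.map_τ₃_eq hS (hE.relProjective_inj _) (φ ≫ hE.toInjSeq hS')
    (hE.toInjSeq hS ≫ hE.injSeqMap φ.τ₁) (by simp)
  rw [ShortComplex.comp_τ₃, ShortComplex.comp_τ₃, Functor.map_comp, Functor.map_comp] at h
  exact h

instance : hE.suspension.EssSurj where
  mem_essImage X := by
    obtain ⟨X⟩ := X
    obtain ⟨P, X', j, q, w, h, hP⟩ := hE.enough_projectives X
    exact ⟨(toStable E).obj X', ⟨(hE.suspIso h hP).symm⟩⟩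

instance : hE.suspension.IsEquivalence where

end IsFrobenius

lemma exists_homs_of_comp {C : Type*} [Category C] [Preadditive C] {X₁ X₂ X₃ Z₁₂ Z₂₃ Z₁₃ : C}
    {f₁₂ : X₁ ⟶ X₂} {g₁₂ : X₂ ⟶ Z₁₂} {f₂₃ : X₂ ⟶ X₃} {g₂₃ : X₃ ⟶ Z₂₃} {g₁₃ : X₃ ⟶ Z₁₃}
    (epi₁₂ : Epi g₁₂)
    (desc₁₂ : ∀ {T : C} (t : X₂ ⟶ T), f₁₂ ≫ t = 0 → ∃ s, g₁₂ ≫ s = t)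
    (desc₁₃ : ∀ {T : C} (t : X₃ ⟶ T), (f₁₂ ≫ f₂₃) ≫ t = 0 → ∃ s, g₁₃ ≫ s = t)
    (w₁₃ : (f₁₂ ≫ f₂₃) ≫ g₁₃ = 0) (w₂₃ : f₂₃ ≫ g₂₃ = 0) :
    ∃ (m₁ : Z₁₂ ⟶ Z₁₃) (m₃ : Z₁₃ ⟶ Z₂₃), m₁ ≫ m₃ = 0 ∧
      g₁₂ ≫ m₁ = f₂₃ ≫ g₁₃ ∧ g₁₃ ≫ m₃ = g₂₃ := by
  obtain ⟨m₁, hm₁⟩ := desc₁₂ (f₂₃ ≫ g₁₃) (by rw [← Category.assoc, w₁₃])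
  obtain ⟨m₃, hm₃⟩ := desc₁₃ g₂₃ (by rw [Category.assoc, w₂₃, comp_zero])
  exact ⟨m₁, m₃, by rw [← cancel_epi g₁₂, reassoc_of% hm₁, hm₃, w₂₃, comp_zero], hm₁, hm₃⟩

lemma relProjective_biprod {C : Type*} [Category C] [Preadditive C] [HasBinaryBiproducts C]
    {E : ObjectProperty (ShortComplex C)} {P Q : C} (hP : relProjective E P)
    (hQ : relProjective E Q) : relProjective E (P ⊞ Q) := by
  intro S hS f
  obtain ⟨g, hg⟩ := hP S hS (biprod.inl ≫ f)
  obtain ⟨g', hg'⟩ := hQ S hS (biprod.inr ≫ f)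
  exact ⟨biprod.desc g g', by ext <;> simp [hg, hg']⟩

section TriangleIso

variable {D : Type*} [Category D] [HasShift D ℤ] {X Y Z X' Y' Z' : D}
  {f : X ⟶ Y} {g : Y ⟶ Z} {h : Z ⟶ X⟦(1 : ℤ)⟧} {f' : X' ⟶ Y'} {g' : Y' ⟶ Z'}
  {h' : Z' ⟶ X'⟦(1 : ℤ)⟧}

lemma exists_isos_of_triangle_iso (e : Triangle.mk f g h ≅ Triangle.mk f' g' h') :
    ∃ (e₁ : X ≅ X') (e₂ : Y ≅ Y') (e₃ : Z ≅ Z'), f ≫ e₂.hom = e₁.hom ≫ f' ∧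
      g ≫ e₃.hom = e₂.hom ≫ g' ∧ h ≫ e₁.hom⟦(1 : ℤ)⟧' = e₃.hom ≫ h' :=
  ⟨Triangle.π₁.mapIso e, Triangle.π₂.mapIso e, Triangle.π₃.mapIso e,
    e.hom.comm₁, e.hom.comm₂, e.hom.comm₃⟩

lemma nonempty_triangle_iso (e₁ : X ≅ X') (e₂ : Y ≅ Y') (e₃ : Z ≅ Z')
    (h₁ : f ≫ e₂.hom = e₁.hom ≫ f') (h₂ : g ≫ e₃.hom = e₂.hom ≫ g')
    (h₃ : h ≫ e₁.hom⟦(1 : ℤ)⟧' = e₃.hom ≫ h') :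
    Nonempty (Triangle.mk f g h ≅ Triangle.mk f' g' h') :=
  ⟨Triangle.isoMk _ _ e₁ e₂ e₃ h₁ h₂ h₃⟩

end TriangleIso

variable {C : Type*} [Category C] [Preadditive C] {E : ObjectProperty (ShortComplex C)}

variable (E) in
/-- A natural identification of the translation with the cokernels of inflations into projective
objects; it determines the connecting morphisms of conflations and the standard triangles. -/
structure ShiftData [HasShift (StableCategory E) ℤ] where
  /-- The isomorphism attached to a conflation with projective middle term. -/
  iso {S : ShortComplex C} (hS : E S) (hp : relProjective E S.X₂) :
    (toStable E).obj S.X₃ ≅ ((toStable E).obj S.X₁)⟦(1 : ℤ)⟧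
  naturality {S S' : ShortComplex C} (φ : S ⟶ S') (hS : E S) (hp : relProjective E S.X₂)
    (hS' : E S') (hp' : relProjective E S'.X₂) :
    (toStable E).map φ.τ₃ ≫ (iso hS' hp').hom =
      (iso hS hp).hom ≫ ((toStable E).map φ.τ₁)⟦(1 : ℤ)⟧'

lemma IsFrobenius.exists_conflations_of_stable_comp [HasBinaryBiproducts C] [HasZeroObject C]
    (hE : IsFrobenius E) {X₁ X₂ X₃ : StableCategory E} (u₁₂ : X₁ ⟶ X₂) (u₂₃ : X₂ ⟶ X₃) :
    ∃ (Y₂ Y₃ Z₁₂ Z₂₃ : C) (f₁₂ : X₁.as ⟶ Y₂) (g₁₂ : Y₂ ⟶ Z₁₂) (w₁₂ : f₁₂ ≫ g₁₂ = 0)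
      (f₂₃ : Y₂ ⟶ Y₃) (g₂₃ : Y₃ ⟶ Z₂₃) (w₂₃ : f₂₃ ≫ g₂₃ = 0)
      (_ : E (ShortComplex.mk f₁₂ g₁₂ w₁₂)) (_ : E (ShortComplex.mk f₂₃ g₂₃ w₂₃))
      (e₂ : X₂ ≅ (toStable E).obj Y₂) (e₃ : X₃ ≅ (toStable E).obj Y₃),
      u₁₂ ≫ e₂.hom = (toStable E).map f₁₂ ∧ u₂₃ ≫ e₃.hom = e₂.hom ≫ (toStable E).map f₂₃ := by
  obtain ⟨X₁⟩ := X₁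
  obtain ⟨X₂⟩ := X₂
  obtain ⟨X₃⟩ := X₃
  obtain ⟨u₁₂, rfl⟩ := (toStable E).map_surjective u₁₂
  obtain ⟨u₂₃, rfl⟩ := (toStable E).map_surjective u₂₃
  obtain ⟨Z₁₂, p₁₂, w₁₂, h₁₂⟩ := hE.exists_biprod (hE.injSeq_mem X₁) u₁₂
  obtain ⟨Z₂₃, p₂₃, w₂₃, h₂₃⟩ := hE.exists_biprod (hE.injSeq_mem (hE.inj X₁ ⊞ X₂))
    (biprod.snd ≫ u₂₃)
  have hX₁ := hE.relProjective_inj X₁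
  have hX₂ := hE.relProjective_inj (hE.inj X₁ ⊞ X₂)
  refine ⟨_, _, _, _, _, _, _, _, _, _, h₁₂, h₂₃,
    mapInrIso (toStable E) X₂ (isZero_toStable_obj hX₁),
    mapInrIso (toStable E) X₃ (isZero_toStable_obj hX₂), ?_, ?_⟩
  · rw [mapInrIso_hom, ← Functor.map_comp]
    refine toStable_map_eq_of_sub_eq _ _ hX₁ (-hE.toInj X₁) biprod.inl ?_
    ext <;> simp
  · rw [mapInrIso_hom, mapInrIso_hom, ← Functor.map_comp, ← Functor.map_comp]
    refine toStable_map_eq_of_sub_eq _ _ hX₂ (-(biprod.inr ≫ hE.toInj _)) biprod.inl ?_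
    ext <;> simp

namespace ShiftData

variable [HasShift (StableCategory E) ℤ] (d : ShiftData E)

/-- The standard triangles `X ⟶ Y ⟶ Z ⟶ X⟦1⟧`: `Z` is the pushout of an inflation of `X` into a
projective object along some `u : X ⟶ Y`. -/
def IsStd (T : Triangle (StableCategory E)) : Prop :=
  ∃ (S : ShortComplex C) (hS : E S) (hp : relProjective E S.X₂) (Y Z : C) (u : S.X₁ ⟶ Y)
    (v : Y ⟶ Z) (x : S.X₂ ⟶ Z) (w : Z ⟶ S.X₃),
    IsPushout S.f u x v ∧ x ≫ w = S.g ∧ v ≫ w = 0 ∧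
    Nonempty (T ≅ Triangle.mk ((toStable E).map u) ((toStable E).map v)
      ((toStable E).map w ≫ (d.iso hS hp).hom))

variable {d} in
lemma IsStd.of_iso {T T' : Triangle (StableCategory E)} (h : d.IsStd T) (e : T' ≅ T) :
    d.IsStd T' := by
  obtain ⟨S, hS, hp, Y, Z, u, v, x, w, sq, hx, hv, ⟨e'⟩⟩ := h
  exact ⟨S, hS, hp, Y, Z, u, v, x, w, sq, hx, hv, ⟨e ≪≫ e'⟩⟩

variable [HasBinaryBiproducts C]

section Connecting

variable (hE : IsFrobenius E)

/-- The connecting morphism of a conflation. -/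
noncomputable def δ {S : ShortComplex C} (hS : E S) :
    (toStable E).obj S.X₃ ⟶ ((toStable E).obj S.X₁)⟦(1 : ℤ)⟧ :=
  (toStable E).map (hE.toInjSeq hS).τ₃ ≫
    (d.iso (hE.injSeq_mem S.X₁) (hE.relProjective_inj S.X₁)).hom

lemma δ_eq_iso_hom {S : ShortComplex C} (hS : E S) (hp : relProjective E S.X₂) :
    d.δ hE hS = (d.iso hS hp).hom := by
  rw [δ, d.naturality (hE.toInjSeq hS) hS hp (hE.injSeq_mem _) (hE.relProjective_inj _),
    hE.toInjSeq_τ₁, CategoryTheory.Functor.map_id, CategoryTheory.Functor.map_id,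
    Category.comp_id]

variable [HasZeroObject C]

lemma δ_naturality {S S' : ShortComplex C} (φ : S ⟶ S') (hS : E S) (hS' : E S') :
    (toStable E).map φ.τ₃ ≫ d.δ hE hS' = d.δ hE hS ≫ ((toStable E).map φ.τ₁)⟦(1 : ℤ)⟧' := by
  have h := hE.map_τ₃_eq hS (hE.relProjective_inj _) (φ ≫ hE.toInjSeq hS')
    (hE.toInjSeq hS ≫ hE.injSeqMap φ.τ₁) (by simp)
  have h' := d.naturality (hE.injSeqMap φ.τ₁) (hE.injSeq_mem _) (hE.relProjective_inj _)
    (hE.injSeq_mem _) (hE.relProjective_inj _)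
  rw [hE.injSeqMap_τ₁] at h'
  rw [ShortComplex.comp_τ₃, ShortComplex.comp_τ₃, Functor.map_comp, Functor.map_comp] at h
  rw [δ, δ, reassoc_of% h, h', Category.assoc]

lemma map_comp_δ {X Y Z Y' Z' : C} {f : X ⟶ Y} {g : Y ⟶ Z} {w : f ≫ g = 0} {f' : X ⟶ Y'}
    {g' : Y' ⟶ Z'} {w' : f' ≫ g' = 0} (h : E (ShortComplex.mk f g w))
    (h' : E (ShortComplex.mk f' g' w')) {b : Y ⟶ Y'} {c : Z ⟶ Z'} (hb : f ≫ b = f')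
    (hc : g ≫ c = b ≫ g') : (toStable E).map c ≫ d.δ hE h' = d.δ hE h := by
  have hδ := d.δ_naturality hE (S := ShortComplex.mk f g w) (S' := ShortComplex.mk f' g' w')
    { τ₁ := 𝟙 X, τ₂ := b, τ₃ := c, comm₁₂ := by simp [hb], comm₂₃ := hc.symm } h h'
  rwa [CategoryTheory.Functor.map_id, CategoryTheory.Functor.map_id, Category.comp_id] at hδ

lemma δ_eq_δ_comp_map {X X' Y Y' Z : C} {f : X ⟶ Y} {g : Y ⟶ Z} {w : f ≫ g = 0} {f' : X' ⟶ Y'}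
    {g' : Y' ⟶ Z} {w' : f' ≫ g' = 0} (h : E (ShortComplex.mk f g w))
    (h' : E (ShortComplex.mk f' g' w')) {a : X ⟶ X'} {b : Y ⟶ Y'} (hb : a ≫ f' = f ≫ b)
    (hc : b ≫ g' = g) : d.δ hE h' = d.δ hE h ≫ ((toStable E).map a)⟦(1 : ℤ)⟧' := by
  have hδ := d.δ_naturality hE (S := ShortComplex.mk f g w) (S' := ShortComplex.mk f' g' w')
    { τ₁ := a, τ₂ := b, τ₃ := 𝟙 Z, comm₁₂ := hb, comm₂₃ := by simp [hc] } h h'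
  rwa [CategoryTheory.Functor.map_id, Category.id_comp] at hδ

/-- The triangle attached to a conflation. -/
noncomputable abbrev tri {S : ShortComplex C} (hS : E S) : Triangle (StableCategory E) :=
  Triangle.mk ((toStable E).map S.f) ((toStable E).map S.g) (-d.δ hE hS)

lemma isStd_tri {S : ShortComplex C} (hS : E S) : d.IsStd (d.tri hE hS) := by
  set φ := hE.toInjSeq hS
  have hf : S.f ≫ φ.τ₂ = hE.toInj S.X₁ := by
    rw [← φ.comm₁₂, hE.toInjSeq_τ₁, Category.id_comp]
  have sq := hE.isPushout_biprod_lift hS φ.τ₂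
  rw [hf] at sq
  refine ⟨hE.injSeq S.X₁, hE.injSeq_mem _, hE.relProjective_inj _, S.X₂, S.X₃ ⊞ hE.inj S.X₁, S.f,
    biprod.lift S.g φ.τ₂, biprod.inr, biprod.desc (-φ.τ₃) (hE.toSusp S.X₁), sq, by simp, ?_,
    nonempty_triangle_iso (Iso.refl _) (Iso.refl _)
      (mapInlIso (toStable E) S.X₃ (isZero_toStable_obj (hE.relProjective_inj S.X₁))) ?_ ?_ ?_⟩
  · have := φ.comm₂₃
    dsimp at this
    simp [this]
  · rw [Iso.refl_hom, Iso.refl_hom, Category.comp_id, Category.id_comp]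
  · rw [mapInlIso_hom, Iso.refl_hom, Category.id_comp, ← Functor.map_comp]
    refine toStable_map_eq_of_sub_eq _ _ (hE.relProjective_inj S.X₁) (-φ.τ₂) biprod.inr ?_
    ext <;> simp
  · rw [mapInlIso_hom, Iso.refl_hom, CategoryTheory.Functor.map_id, Category.comp_id,
      ← Functor.map_comp_assoc, biprod.inl_desc, Functor.map_neg, Preadditive.neg_comp]
    rfl

lemma exists_tri_of_isStd {T : Triangle (StableCategory E)} (hT : d.IsStd T) :
    ∃ (S : ShortComplex C) (hS : E S), Nonempty (T ≅ d.tri hE hS) := by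
  obtain ⟨S, hS, hp, Y, Z, u, v, x, w, sq, hx, hv, ⟨e⟩⟩ := hT
  obtain ⟨Z', p, w', h⟩ := hE.exists_biprod hS u
  have sq' := hE.isPushout_of_biprod h
  let c : Z ≅ Z' := sq.isoIsPushout _ _ sq'
  have hxc : x ≫ c.hom = -biprod.inl ≫ p := sq.inl_isoIsPushout_hom _ _ sq'
  have hvc : v ≫ c.hom = biprod.inr ≫ p := sq.inr_isoIsPushout_hom _ _ sq'
  obtain ⟨t, ht⟩ := hE.exists_desc h (biprod.fst ≫ S.g) (by simp)
  dsimp at ht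
  have hct : c.hom ≫ t = -w := by
    apply sq.hom_ext
    · rw [reassoc_of% hxc]; simp [ht, hx]
    · rw [reassoc_of% hvc]; simp [ht, hv]
  have hδ : (toStable E).map t ≫ (d.iso hS hp).hom = d.δ hE h := by
    rw [← d.δ_eq_iso_hom hE hS hp]
    exact d.map_comp_δ hE h hS (by simp) ht
  obtain ⟨e'⟩ : Nonempty (Triangle.mk ((toStable E).map u) ((toStable E).map v)
      ((toStable E).map w ≫ (d.iso hS hp).hom) ≅ d.tri hE h) := by
    refine nonempty_triangle_iso (Iso.refl _)
      (mapInrIso (toStable E) Y (isZero_toStable_obj hp)) ((toStable E).mapIso c) ?_ ?_ ?_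
    · rw [mapInrIso_hom, Iso.refl_hom, Category.id_comp, ← Functor.map_comp]
      refine toStable_map_eq_of_sub_eq _ _ hp (-S.f) biprod.inl ?_
      ext <;> simp
    · rw [mapInrIso_hom, Functor.mapIso_hom, ← Functor.map_comp, ← Functor.map_comp, hvc]
    · rw [Iso.refl_hom, CategoryTheory.Functor.map_id, Category.comp_id, Preadditive.comp_neg, ← hδ,
        Functor.mapIso_hom, ← Functor.map_comp_assoc, hct, Functor.map_neg, Preadditive.neg_comp,
        neg_neg]
  exact ⟨_, h, ⟨e ≪≫ e'⟩⟩

end Connecting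

section Pretriangulated

variable (hE : IsFrobenius E)

include hE in
lemma exists_isStd {X Y : StableCategory E} (f : X ⟶ Y) :
    ∃ (Z : StableCategory E) (g : Y ⟶ Z) (h : Z ⟶ X⟦(1 : ℤ)⟧), d.IsStd (Triangle.mk f g h) := by
  obtain ⟨X⟩ := X
  obtain ⟨Y⟩ := Y
  obtain ⟨u, rfl⟩ := (toStable E).map_surjective f
  obtain ⟨Z, p, w, h⟩ := hE.exists_biprod (hE.injSeq_mem X) u
  obtain ⟨t, ht⟩ := hE.exists_desc h (biprod.fst ≫ (-hE.toSusp X)) (by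
    dsimp
    rw [biprod.lift_fst_assoc, Preadditive.comp_neg, (hE.injSeq X).zero, neg_zero])
  dsimp at ht
  exact ⟨_, _, _, hE.injSeq X, hE.injSeq_mem X, hE.relProjective_inj X, Y, Z, u, _, _, t,
    hE.isPushout_of_biprod h, by simp [ht], by simp [ht], ⟨Iso.refl _⟩⟩

variable [HasZeroObject C]

include hE in
lemma isStd_contractible (X : StableCategory E) : d.IsStd (contractibleTriangle X) := by
  obtain ⟨X⟩ := X
  have h := isZero_toStable_obj (hE.relProjective_inj X)
  refine ⟨hE.injSeq X, hE.injSeq_mem X, hE.relProjective_inj X, X, hE.inj X, 𝟙 X, hE.toInj X,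
    𝟙 _, hE.toSusp X, IsPushout.id_vert _, Category.id_comp _, (hE.injSeq X).zero,
    nonempty_triangle_iso (Iso.refl _) (Iso.refl _) ((isZero_zero _).iso h) ?_
      (h.eq_of_tgt _ _) ((isZero_zero _).eq_of_src _ _)⟩
  rw [CategoryTheory.Functor.map_id]
  rfl

lemma exists_hom_tri {S S' : ShortComplex C} (hS : E S) (hS' : E S')
    (a : (toStable E).obj S.X₁ ⟶ (toStable E).obj S'.X₁)
    (b : (toStable E).obj S.X₂ ⟶ (toStable E).obj S'.X₂)
    (comm : (toStable E).map S.f ≫ b = a ≫ (toStable E).map S'.f) :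
    ∃ c : (toStable E).obj S.X₃ ⟶ (toStable E).obj S'.X₃,
      (toStable E).map S.g ≫ c = b ≫ (toStable E).map S'.g ∧
        (-d.δ hE hS) ≫ a⟦(1 : ℤ)⟧' = c ≫ (-d.δ hE hS') := by
  obtain ⟨a, rfl⟩ := (toStable E).map_surjective a
  obtain ⟨b, rfl⟩ := (toStable E).map_surjective b
  rw [← Functor.map_comp, ← Functor.map_comp, toStable_map_eq_iff] at comm
  obtain ⟨Q, hQ, s, t, hst⟩ := comm
  obtain ⟨k, hk⟩ := hE.relInjective_of_relProjective hQ S hS s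
  -- The square commutes in `C` after correcting `b` by a morphism factoring through `Q`.
  have hb : S.f ≫ (b - k ≫ t) = a ≫ S'.f := by
    rw [Preadditive.comp_sub, reassoc_of% hk, ← hst, sub_sub_cancel]
  have hb' : (toStable E).map (b - k ≫ t) = (toStable E).map b :=
    toStable_map_eq_of_sub_eq _ _ hQ (-k) t (by simp)
  obtain ⟨c, hc⟩ := hE.exists_desc hS ((b - k ≫ t) ≫ S'.g) (by
    rw [reassoc_of% hb, S'.zero, comp_zero])
  refine ⟨(toStable E).map c, ?_, ?_⟩
  · rw [← hb', ← Functor.map_comp, ← Functor.map_comp, hc]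
  · rw [Preadditive.neg_comp, Preadditive.comp_neg, neg_inj]
    exact (d.δ_naturality hE ⟨a, b - k ≫ t, c, hb.symm, hc.symm⟩ hS hS').symm

include hE in
lemma exists_hom_of_isStd {T T' : Triangle (StableCategory E)} (hT : d.IsStd T)
    (hT' : d.IsStd T') (a : T.obj₁ ⟶ T'.obj₁) (b : T.obj₂ ⟶ T'.obj₂)
    (comm : T.mor₁ ≫ b = a ≫ T'.mor₁) :
    ∃ c : T.obj₃ ⟶ T'.obj₃, T.mor₂ ≫ c = b ≫ T'.mor₂ ∧ T.mor₃ ≫ a⟦(1 : ℤ)⟧' = c ≫ T'.mor₃ := by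
  obtain ⟨S, hS, ⟨e⟩⟩ := d.exists_tri_of_isStd hE hT
  obtain ⟨S', hS', ⟨e'⟩⟩ := d.exists_tri_of_isStd hE hT'
  have comm' : (d.tri hE hS).mor₁ ≫ e.inv.hom₂ ≫ b ≫ e'.hom.hom₂ =
      (e.inv.hom₁ ≫ a ≫ e'.hom.hom₁) ≫ (d.tri hE hS').mor₁ := by
    rw [Category.assoc, Category.assoc, ← e'.hom.comm₁, ← reassoc_of% comm,
      e.inv.comm₁_assoc]
  obtain ⟨c, hc₁, hc₂⟩ := d.exists_hom_tri hE hS hS' _ _ comm'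
  let ψ : T ⟶ T' :=
    e.hom ≫ Triangle.homMk (d.tri hE hS) (d.tri hE hS') _ _ c comm' hc₁ hc₂ ≫ e'.inv
  have hψ₁ : ψ.hom₁ = a := by
    change e.hom.hom₁ ≫ (e.inv.hom₁ ≫ a ≫ e'.hom.hom₁) ≫ e'.inv.hom₁ = a
    simp
  have hψ₂ : ψ.hom₂ = b := by
    change e.hom.hom₂ ≫ (e.inv.hom₂ ≫ b ≫ e'.hom.hom₂) ≫ e'.inv.hom₂ = b
    simp
  exact ⟨ψ.hom₃, by rw [ψ.comm₂, hψ₂], by rw [← hψ₁, ψ.comm₃]⟩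

lemma isStd_rotate_tri {S : ShortComplex C} (hS : E S) :
    d.IsStd (Triangle.mk ((toStable E).map S.g) (-d.δ hE hS)
      (-((toStable E).map S.f)⟦(1 : ℤ)⟧')) := by
  obtain ⟨X', q, wq, z, w, hzw, h, -, hz, hw⟩ :=
    hE.exists_comp (w₁₂ := S.zero) (w₂₃ := (hE.injSeq S.X₂).zero) hS (hE.injSeq_mem S.X₂)
  have hp := hE.relProjective_inj S.X₂
  have hδS : (toStable E).map z ≫ (d.iso h hp).hom = d.δ hE hS := by
    rw [← d.δ_eq_iso_hom hE h hp]
    exact d.map_comp_δ hE hS h rfl hz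
  have hδX : (toStable E).map w ≫ (d.iso (hE.injSeq_mem S.X₂) hp).hom =
      (d.iso h hp).hom ≫ ((toStable E).map S.f)⟦(1 : ℤ)⟧' :=
    d.naturality (S := ShortComplex.mk (S.f ≫ hE.toInj S.X₂) q wq) (S' := hE.injSeq S.X₂)
      ⟨S.f, 𝟙 _, w, by simp, by simp [hw]⟩ h hp (hE.injSeq_mem S.X₂) hp
  refine ⟨hE.injSeq S.X₂, hE.injSeq_mem _, hp, S.X₃, X', S.g, z, q, w,
    hE.isPushout_of_comp hS h hz, hw, hzw,
    nonempty_triangle_iso (Iso.refl _) (Iso.refl _) (-(d.iso h hp).symm) ?_ ?_ ?_⟩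
  · rw [Iso.refl_hom, Iso.refl_hom, Category.comp_id, Category.id_comp]
  · rw [Iso.refl_hom, Category.id_comp, Preadditive.neg_iso_hom, Iso.symm_hom,
      Preadditive.neg_comp_neg, Iso.comp_inv_eq, hδS]
  · rw [Iso.refl_hom, CategoryTheory.Functor.map_id, Category.comp_id, Preadditive.neg_iso_hom,
      Iso.symm_hom, Preadditive.neg_comp, neg_inj, Iso.eq_inv_comp, hδX]

include hE in
lemma isStd_rotate {T : Triangle (StableCategory E)} (hT : d.IsStd T) : d.IsStd T.rotate := by
  obtain ⟨S, hS, ⟨e⟩⟩ := d.exists_tri_of_isStd hE hT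
  exact (d.isStd_rotate_tri hE hS).of_iso ((rotate _).mapIso e)

include hE in
lemma isStd_of_rotate {X Y Z : StableCategory E} {f : X ⟶ Y} {g : Y ⟶ Z} {h : Z ⟶ X⟦(1 : ℤ)⟧}
    (hT : d.IsStd (Triangle.mk g h (-f⟦(1 : ℤ)⟧'))) : d.IsStd (Triangle.mk f g h) := by
  obtain ⟨S, hS, ⟨e⟩⟩ := d.exists_tri_of_isStd hE hT
  obtain ⟨P, X', j, q, hjq, hX', hP⟩ := hE.enough_projectives S.X₃
  obtain ⟨φ, hφ⟩ := hE.exists_hom_of_relProjective (S := ShortComplex.mk j q hjq) hS hP (𝟙 _)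
  have sq := hE.isPushout_of_isIso hX' hS φ (by rw [hφ]; infer_instance)
  have hg : φ.τ₂ ≫ S.g = q := by rw [φ.comm₂₃, hφ]; exact Category.comp_id _
  have hδ : d.δ hE hS = (d.iso hX' hP).hom ≫ ((toStable E).map φ.τ₁)⟦(1 : ℤ)⟧' := by
    rw [← d.δ_eq_iso_hom hE hX' hP]
    exact d.δ_eq_δ_comp_map hE hX' hS φ.comm₁₂ hg
  obtain ⟨e₁, e₂, e₃, h₁, h₂, h₃⟩ := exists_isos_of_triangle_iso e
  let e₀ : X ≅ (toStable E).obj X' :=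
    (shiftFunctor (StableCategory E) (1 : ℤ)).preimageIso (e₃ ≪≫ d.iso hX' hP)
  have he₀ : e₀.hom⟦(1 : ℤ)⟧' = e₃.hom ≫ (d.iso hX' hP).hom :=
    (shiftFunctor (StableCategory E) (1 : ℤ)).map_preimage _
  refine ⟨ShortComplex.mk j q hjq, hX', hP, S.X₁, S.X₂, φ.τ₁, S.f, φ.τ₂, S.g, sq, hg, S.zero,
    nonempty_triangle_iso e₀ e₁ e₂ ?_ h₁ ?_⟩
  · apply (shiftFunctor (StableCategory E) (1 : ℤ)).map_injective
    rw [Preadditive.neg_comp, Preadditive.comp_neg, neg_inj, hδ] at h₃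
    rw [Functor.map_comp, Functor.map_comp, he₀, Category.assoc, h₃]
  · rw [he₀, reassoc_of% h₂]

variable [∀ n : ℤ, (shiftFunctor (StableCategory E) n).Additive]

/-- Happel's pretriangulated structure, with the standard triangles as distinguished ones. -/
@[reducible]
noncomputable def pretriangulated : Pretriangulated (StableCategory E) where
  distinguishedTriangles := {T | d.IsStd T}
  isomorphic_distinguished _ hT _ e := hT.of_iso e
  contractible_distinguished := d.isStd_contractible hE
  distinguished_cocone_triangle := d.exists_isStd hE
  rotate_distinguished_triangle _ := ⟨d.isStd_rotate hE, fun h ↦ d.isStd_of_rotate hE h⟩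
  complete_distinguished_triangle_morphism _ _ hT hT' a b comm :=
    d.exists_hom_of_isStd hE hT hT' a b comm

section Octahedron

variable {X₁ X₂ X₃ Z₁₂ Z₂₃ : C} {f₁₂ : X₁ ⟶ X₂} {g₁₂ : X₂ ⟶ Z₁₂} {w₁₂ : f₁₂ ≫ g₁₂ = 0}
  {f₂₃ : X₂ ⟶ X₃} {g₂₃ : X₃ ⟶ Z₂₃} {w₂₃ : f₂₃ ≫ g₂₃ = 0}

lemma exists_octahedron (h₁₂ : E (ShortComplex.mk f₁₂ g₁₂ w₁₂))
    (h₂₃ : E (ShortComplex.mk f₂₃ g₂₃ w₂₃)) :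
    letI := d.pretriangulated hE
    ∃ (Z₁₃ : StableCategory E) (v₁₃ : (toStable E).obj X₃ ⟶ Z₁₃)
      (w₁₃ : Z₁₃ ⟶ ((toStable E).obj X₁)⟦(1 : ℤ)⟧)
      (h₁₃ : d.IsStd (Triangle.mk ((toStable E).map f₁₂ ≫ (toStable E).map f₂₃) v₁₃ w₁₃)),
      Nonempty (Triangulated.Octahedron (u₁₂ := (toStable E).map f₁₂) (v₁₂ := (toStable E).map g₁₂)
        (u₂₃ := (toStable E).map f₂₃) (v₂₃ := (toStable E).map g₂₃) (v₁₃ := v₁₃) (w₁₃ := w₁₃)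
        rfl (d.isStd_tri hE h₁₂) (d.isStd_tri hE h₂₃) h₁₃) := by
  let _ := d.pretriangulated hE
  obtain ⟨Z₁₃, g₁₃, w₁₃, m₁, m₃, w, h₁₃, h, hm₁, hm₃⟩ := hE.exists_comp h₁₂ h₂₃
  have hδ : -d.δ hE h = (-d.δ hE h₂₃) ≫ ((toStable E).map g₁₂)⟦(1 : ℤ)⟧' := by
    rw [Preadditive.neg_comp, neg_inj, d.δ_eq_δ_comp_map hE h₂₃ h hm₁ hm₃]
  have mem := d.isStd_tri hE h
  rw [tri, hδ] at mem
  refine ⟨_, (toStable E).map g₁₃, -d.δ hE h₁₃, ?_, ⟨⟨(toStable E).map m₁, (toStable E).map m₃,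
    ?_, ?_, ?_, ?_, mem⟩⟩⟩
  · rw [← Functor.map_comp]
    exact d.isStd_tri hE h₁₃
  · rw [← Functor.map_comp, ← Functor.map_comp, hm₁]
  · rw [Preadditive.comp_neg, neg_inj, d.map_comp_δ hE h₁₂ h₁₃ rfl hm₁]
  · rw [← Functor.map_comp, hm₃]
  · rw [Preadditive.neg_comp, Preadditive.comp_neg, neg_inj]
    exact (d.δ_naturality hE (S := ShortComplex.mk _ _ w₁₃) (S' := ShortComplex.mk _ _ w₂₃)
      ⟨f₁₂, 𝟙 X₃, m₃, by simp, by simp [hm₃]⟩ h₁₃ h₂₃).symm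

end Octahedron

lemma isTriangulated :
    letI := d.pretriangulated hE
    IsTriangulated (StableCategory E) := by
  let _ := d.pretriangulated hE
  refine IsTriangulated.mk' fun X₁ X₂ X₃ u₁₂ u₂₃ ↦ ?_
  obtain ⟨Y₂, Y₃, Z₁₂, Z₂₃, f₁₂, g₁₂, w₁₂, f₂₃, g₂₃, w₂₃, h₁₂, h₂₃, e₂, e₃, he₂, he₃⟩ :=
    hE.exists_conflations_of_stable_comp u₁₂ u₂₃
  obtain ⟨Z₁₃, v₁₃, w₁₃, h₁₃, o⟩ := d.exists_octahedron hE h₁₂ h₂₃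
  exact ⟨_, _, _, _, _, _, _, _, Iso.refl _, e₂, e₃, by rw [he₂, Iso.refl_hom, Category.id_comp],
    he₃, _, _, d.isStd_tri hE h₁₂, _, _, d.isStd_tri hE h₂₃, _, _, h₁₃, o⟩

end Pretriangulated

end ShiftData

variable [HasBinaryBiproducts C] [HasZeroObject C]

namespace IsFrobenius

variable (hE : IsFrobenius E)

lemma nonempty_shiftData [HasShift (StableCategory E) ℤ]
    (θ : shiftFunctor (StableCategory E) (1 : ℤ) ≅ hE.suspension) : Nonempty (ShiftData E) := by
  refine ⟨⟨fun {S} hS hp ↦ hE.suspIso hS hp ≪≫ (θ.app ((toStable E).obj S.X₁)).symm,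
    fun φ hS hp hS' hp' ↦ ?_⟩⟩
  rw [Iso.trans_hom, Iso.trans_hom, reassoc_of% (hE.suspIso_naturality φ hS hp hS' hp'),
    Category.assoc]
  exact congrArg ((hE.suspIso hS hp).hom ≫ ·) (θ.inv.naturality _)

include hE in
theorem nonempty_stableTriangulation : Nonempty (StableTriangulation E) := by
  obtain ⟨_, ⟨θ⟩⟩ := exists_hasShift_of_isEquivalence hE.suspension
  obtain ⟨d⟩ := hE.nonempty_shiftData θ
  have shift_additive (n : ℤ) : (shiftFunctor (StableCategory E) n).Additive :=
    Functor.additive_of_preserves_binary_products _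
  exact ⟨{
    hasShift := inferInstance
    shift_additive
    pretriangulated := d.pretriangulated hE
    isTriangulated := d.isTriangulated hE
    shiftIso := fun _ hS hp _ ↦ d.iso hS hp
    shiftIso_naturality := fun φ hS hp _ hS' hp' _ ↦ d.naturality φ hS hp hS' hp'
    distinguished_iff := fun _ ↦
      ⟨fun ⟨S, hS, hp, h⟩ ↦ ⟨S, hS, hp, hE.relInjective_of_relProjective hp, h⟩,
        fun ⟨S, hS, hp, _, h⟩ ↦ ⟨S, hS, hp, h⟩⟩ }⟩

end IsFrobenius

section StableTriangulation

variable {C : Type*} [Category C] [Preadditive C] [HasBinaryBiproducts C] [HasZeroObject C]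
  {E : ObjectProperty (ShortComplex C)}

lemma relProjective_of_isZero {X : C} (h : IsZero ((toStable E).obj X)) : relProjective E X := by
  obtain ⟨Q, hQ, a, b, hab⟩ := (toStable_map_eq_zero_iff (𝟙 X)).1 (h.eq_of_src _ _)
  intro S hS f
  obtain ⟨g, hg⟩ := hQ S hS (b ≫ f)
  exact ⟨a ≫ g, by rw [Category.assoc, hg, ← Category.assoc, ← hab, Category.id_comp]⟩

variable [StableTriangulation E] (hE : IsFrobenius E)

/-- The identification of the translation that is part of a triangulation. -/
def shiftData : ShiftData E where
  iso hS hp := StableTriangulation.shiftIso _ hS hp (hE.relInjective_of_relProjective hp)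
  naturality φ hS hp hS' hp' := StableTriangulation.shiftIso_naturality φ hS hp _ hS' hp' _

lemma distinguished_iff_isStd (T : Triangle (StableCategory E)) :
    T ∈ distTriang (StableCategory E) ↔ (shiftData hE).IsStd T :=
  (StableTriangulation.distinguished_iff T).trans
    ⟨fun ⟨S, hS, hp, _, h⟩ ↦ ⟨S, hS, hp, h⟩,
      fun ⟨S, hS, hp, h⟩ ↦ ⟨S, hS, hp, hE.relInjective_of_relProjective hp, h⟩⟩

lemma tri_distinguished {S : ShortComplex C} (hS : E S) :
    (shiftData hE).tri hE hS ∈ distTriang (StableCategory E) :=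
  (distinguished_iff_isStd hE _).2 ((shiftData hE).isStd_tri hE hS)

end StableTriangulation

section Functor

variable {C : Type*} [Category C] [Preadditive C] {E : ObjectProperty (ShortComplex C)}
  {C' : Type*} [Category C'] [Preadditive C'] [HasBinaryBiproducts C'] [HasZeroObject C']
  {E' : ObjectProperty (ShortComplex C')} (F : C ⥤ C') [F.Additive]
  (hFp : ∀ ⦃P : C⦄, relProjective E P → relProjective E' (F.obj P))

/-- The functor between stable categories induced by a functor that preserves projectives. -/
def stableFunctor : StableCategory E ⥤ StableCategory E' :=
  CategoryTheory.Quotient.lift _ (F ⋙ toStable E') (by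
    rintro X Y f g ⟨Q, hQ, a, b, h⟩
    refine toStable_map_eq_of_sub_eq _ _ (hFp hQ) (F.map a) (F.map b) ?_
    rw [← Functor.map_sub, h, Functor.map_comp])

variable [StableTriangulation E'] (hE' : IsFrobenius E')
  (hF : ∀ ⦃S : ShortComplex C⦄, E S → E' (S.map F))

/-- The connecting morphism of the image under `F` of a conflation. -/
noncomputable def mapδ {S : ShortComplex C} (hS : E S) :
    (stableFunctor F hFp).obj ((toStable E).obj S.X₃) ⟶
      ((stableFunctor F hFp).obj ((toStable E).obj S.X₁))⟦(1 : ℤ)⟧ :=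
  (shiftData hE').δ hE' (hF hS)

lemma mapδ_naturality {S S' : ShortComplex C} (φ : S ⟶ S') (hS : E S) (hS' : E S') :
    (stableFunctor F hFp).map ((toStable E).map φ.τ₃) ≫ mapδ F hFp hE' hF hS' =
      mapδ F hFp hE' hF hS ≫ ((stableFunctor F hFp).map ((toStable E).map φ.τ₁))⟦(1 : ℤ)⟧' :=
  (shiftData hE').δ_naturality hE' (F.mapShortComplex.map φ) (hF hS) (hF hS')

lemma isIso_mapδ {S : ShortComplex C} (hS : E S) (hp : relProjective E S.X₂) :
    IsIso (mapδ F hFp hE' hF hS) := by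
  have h : mapδ F hFp hE' hF hS = ((shiftData hE').iso (hF hS) (hFp hp)).hom :=
    (shiftData hE').δ_eq_iso_hom hE' (hF hS) (hFp hp)
  rw [h]
  exact Iso.isIso_hom _

variable [HasBinaryBiproducts C] [HasZeroObject C]

instance : (stableFunctor F hFp).Additive where
  map_add {X Y f g} := by
    obtain ⟨X⟩ := X
    obtain ⟨Y⟩ := Y
    obtain ⟨f, rfl⟩ := (toStable E).map_surjective f
    obtain ⟨g, rfl⟩ := (toStable E).map_surjective g
    rw [← Functor.map_add]
    exact ((toStable E').congr_map F.map_add).trans (toStable E').map_add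

variable [StableTriangulation E] (hE : IsFrobenius E)

/-- The commutation of the induced functor with the translation, on objects: both sides are the
image of the last term of a conflation with projective middle term. -/
noncomputable def stableFunctorObjShiftIso (X : C) :
    (stableFunctor F hFp).obj (((toStable E).obj X)⟦(1 : ℤ)⟧) ≅
      ((stableFunctor F hFp).obj ((toStable E).obj X))⟦(1 : ℤ)⟧ :=
  have := isIso_mapδ F hFp hE' hF (hE.injSeq_mem X) (hE.relProjective_inj X)
  (stableFunctor F hFp).mapIso
      ((shiftData hE).iso (hE.injSeq_mem X) (hE.relProjective_inj X)).symm ≪≫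
    asIso (mapδ F hFp hE' hF (hE.injSeq_mem X))

lemma map_iso_comp_stableFunctorObjShiftIso (X : C) :
    (stableFunctor F hFp).map
        ((shiftData hE).iso (hE.injSeq_mem X) (hE.relProjective_inj X)).hom ≫
      (stableFunctorObjShiftIso F hFp hE' hF hE X).hom =
        mapδ F hFp hE' hF (hE.injSeq_mem X) := by
  rw [stableFunctorObjShiftIso, Iso.trans_hom, Functor.mapIso_hom, Iso.symm_hom, asIso_hom,
    ← Functor.map_comp_assoc, Iso.hom_inv_id, CategoryTheory.Functor.map_id, Category.id_comp]

lemma map_δ_comp_stableFunctorObjShiftIso {S : ShortComplex C} (hS : E S) :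
    (stableFunctor F hFp).map ((shiftData hE).δ hE hS) ≫
      (stableFunctorObjShiftIso F hFp hE' hF hE S.X₁).hom = mapδ F hFp hE' hF hS := by
  rw [ShiftData.δ, Functor.map_comp, Category.assoc, map_iso_comp_stableFunctorObjShiftIso,
    mapδ_naturality F hFp hE' hF _ hS, hE.toInjSeq_τ₁, CategoryTheory.Functor.map_id,
    CategoryTheory.Functor.map_id, CategoryTheory.Functor.map_id, Category.comp_id]

lemma stableFunctorObjShiftIso_naturality {X Y : C} (f : X ⟶ Y) :
    (stableFunctor F hFp).map (((toStable E).map f)⟦(1 : ℤ)⟧') ≫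
        (stableFunctorObjShiftIso F hFp hE' hF hE Y).hom =
      (stableFunctorObjShiftIso F hFp hE' hF hE X).hom ≫
        ((stableFunctor F hFp).map ((toStable E).map f))⟦(1 : ℤ)⟧' := by
  have h := (shiftData hE).naturality (hE.injSeqMap f) (hE.injSeq_mem X)
    (hE.relProjective_inj X) (hE.injSeq_mem Y) (hE.relProjective_inj Y)
  have h' := mapδ_naturality F hFp hE' hF (hE.injSeqMap f) (hE.injSeq_mem X) (hE.injSeq_mem Y)
  rw [hE.injSeqMap_τ₁] at h h'
  rw [← cancel_epi ((stableFunctor F hFp).map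
      ((shiftData hE).iso (hE.injSeq_mem X) (hE.relProjective_inj X)).hom),
    ← Functor.map_comp_assoc, ← h, Functor.map_comp, Category.assoc,
    map_iso_comp_stableFunctorObjShiftIso, h', ← Category.assoc,
    map_iso_comp_stableFunctorObjShiftIso]

/-- The commutation of the induced functor with the translation. -/
noncomputable def stableFunctorShiftIso :
    shiftFunctor (StableCategory E) (1 : ℤ) ⋙ stableFunctor F hFp ≅
      stableFunctor F hFp ⋙ shiftFunctor (StableCategory E') (1 : ℤ) :=
  NatIso.ofComponents (fun X ↦ stableFunctorObjShiftIso F hFp hE' hF hE X.as) (by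
    rintro ⟨X⟩ ⟨Y⟩ f
    obtain ⟨f, rfl⟩ := (toStable E).map_surjective f
    exact stableFunctorObjShiftIso_naturality F hFp hE' hF hE f)

include hE' hF hE in
theorem exists_isTriangulated_stableFunctor :
    ∃ (_ : (stableFunctor F hFp).CommShift ℤ), (stableFunctor F hFp).IsTriangulated := by
  obtain ⟨h, he⟩ := exists_commShift_of_iso_one _ (stableFunctorShiftIso F hFp hE' hF hE)
  refine ⟨h, ⟨fun T hT ↦ ?_⟩⟩
  obtain ⟨S, hS, ⟨e⟩⟩ := (shiftData hE).exists_tri_of_isStd hE ((distinguished_iff_isStd hE T).1 hT)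
  let G := stableFunctor F hFp
  have hG : Triangle.mk (G.map ((toStable E).map S.f)) (G.map ((toStable E).map S.g))
      (-mapδ F hFp hE' hF hS) ∈ distTriang (StableCategory E') :=
    tri_distinguished hE' (hF hS)
  have hδ : G.map (-(shiftData hE).δ hE hS) ≫
      (G.commShiftIso (1 : ℤ)).hom.app ((toStable E).obj S.X₁) = -mapδ F hFp hE' hF hS := by
    rw [he, Functor.map_neg, Preadditive.neg_comp]
    exact congrArg Neg.neg (map_δ_comp_stableFunctorObjShiftIso F hFp hE' hF hE hS)
  rw [← hδ] at hG
  exact isomorphic_distinguished _ hG _ (G.mapTriangle.mapIso e)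

end Functor

end Frobenius

/-! ### Stable t-structures and recollements -/

namespace Recoll

section Adjoints

variable {C D : Type*} [Category C] [Category D]

lemma isRightAdjoint_of_bijective (F : C ⥤ D)
    (h : ∀ X : D, ∃ (A : C) (u : X ⟶ F.obj A),
      ∀ Y : C, Function.Bijective fun f : A ⟶ Y ↦ u ≫ F.map f) : F.IsRightAdjoint := by
  choose A u hu using h
  exact (Adjunction.adjunctionOfEquivLeft (G := F) (F_obj := A)
    (fun X Y ↦ Equiv.ofBijective _ (hu X Y)) (fun X Y Y' g f ↦ by simp)).isRightAdjoint

lemma isLeftAdjoint_of_bijective (F : C ⥤ D)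
    (h : ∀ X : D, ∃ (A : C) (u : F.obj A ⟶ X),
      ∀ Y : C, Function.Bijective fun f : Y ⟶ A ↦ F.map f ≫ u) : F.IsLeftAdjoint := by
  choose A u hu using h
  refine (Adjunction.adjunctionOfEquivRight (F := F) (G_obj := A)
    (fun Y X ↦ (Equiv.ofBijective _ (hu X Y)).symm) fun Y' Y X f g ↦ ?_).isLeftAdjoint
  have hg := (Equiv.ofBijective _ (hu X Y)).apply_symm_apply g
  rw [Equiv.ofBijective_apply] at hg
  rw [Equiv.symm_apply_eq, Equiv.ofBijective_apply, Functor.map_comp, Category.assoc, hg]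

end Adjoints

section Inclusion

variable {C : Type*} [Category C] {P : ObjectProperty C}

lemma essImage_ι [P.IsClosedUnderIsomorphisms] : P.ι.essImage = P := by
  ext X
  exact ⟨fun ⟨Y, ⟨e⟩⟩ ↦ P.prop_of_iso e Y.property, fun hX ↦ ⟨⟨X, hX⟩, ⟨Iso.refl _⟩⟩⟩

variable [Preadditive C]

lemma kernel_leftAdjoint_ι {F : C ⥤ P.FullSubcategory} (adj : F ⊣ P.ι) :
    F.kernel = P.leftOrthogonal := by
  ext X
  refine ⟨fun hX Y f hY ↦ ?_, fun hX ↦ (IsZero.iff_id_eq_zero (F.obj X)).2 ?_⟩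
  · obtain ⟨g, rfl⟩ := (adj.homEquiv X ⟨Y, hY⟩).surjective f
    rw [IsZero.eq_of_src hX g 0, Adjunction.homEquiv_unit, Functor.map_zero, comp_zero]
  · apply (adj.homEquiv X (F.obj X)).injective
    exact (hX _ (F.obj X).property).trans (hX _ (F.obj X).property).symm

lemma kernel_rightAdjoint_ι {F : C ⥤ P.FullSubcategory} (adj : P.ι ⊣ F) :
    F.kernel = P.rightOrthogonal := by
  ext X
  refine ⟨fun hX Y f hY ↦ ?_, fun hX ↦ (IsZero.iff_id_eq_zero (F.obj X)).2 ?_⟩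
  · obtain ⟨g, rfl⟩ := (adj.homEquiv ⟨Y, hY⟩ X).symm.surjective f
    rw [IsZero.eq_of_tgt hX g 0, Adjunction.homEquiv_counit, Functor.map_zero, zero_comp]
  · apply (adj.homEquiv (F.obj X) X).symm.injective
    exact (hX _ (F.obj X).property).trans (hX _ (F.obj X).property).symm

end Inclusion

section StableTStructure

variable {D : Type*} [Category D] [HasZeroObject D] [HasShift D ℤ] [Preadditive D]
  [∀ n : ℤ, (shiftFunctor D n).Additive] [Pretriangulated D]

lemma eq_rightOrthogonal_of_exists_triangle {U V : ObjectProperty D}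
    [V.IsClosedUnderIsomorphisms] (hU : ∀ X, U X → U (X⟦(1 : ℤ)⟧))
    (hom_eq_zero : ∀ ⦃X Y⦄, U X → V Y → ∀ f : X ⟶ Y, f = 0)
    (exists_triangle : ∀ X, ∃ (A B : D) (_ : U A) (_ : V B) (f : A ⟶ X) (g : X ⟶ B)
      (h : B ⟶ A⟦(1 : ℤ)⟧), Triangle.mk f g h ∈ distTriang D) :
    V = U.rightOrthogonal := by
  ext X
  refine ⟨fun hX Y f hY ↦ hom_eq_zero hY hX f, fun hX ↦ ?_⟩
  obtain ⟨A, B, hA, hB, f, g, k, hT⟩ := exists_triangle X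
  obtain ⟨r, hr⟩ : ∃ r : A⟦(1 : ℤ)⟧ ⟶ B, 𝟙 (A⟦(1 : ℤ)⟧) = r ≫ k :=
    Triangle.coyoneda_exact₁ _ hT _ ((Category.id_comp _).trans
      (((shiftFunctor D (1 : ℤ)).congr_map (hX f hA)).trans (Functor.map_zero ..)))
  have hA₀ : IsZero A := by
    rw [IsZero.iff_id_eq_zero]
    apply (shiftFunctor D (1 : ℤ)).map_injective
    rw [CategoryTheory.Functor.map_id, hr, hom_eq_zero (hU A hA) hB r, zero_comp, Functor.map_zero]
  have : IsIso g := (Triangle.isZero₁_iff_isIso₂ _ hT).1 hA₀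
  exact V.prop_of_iso (asIso g).symm hB

lemma isStableTStructure_of_exists_triangle {U V : ObjectProperty D} [U.IsStableUnderShift ℤ]
    [U.IsClosedUnderIsomorphisms] [V.IsClosedUnderIsomorphisms]
    (hom_eq_zero : ∀ ⦃X Y⦄, U X → V Y → ∀ f : X ⟶ Y, f = 0)
    (exists_triangle : ∀ X, ∃ (A B : D) (_ : U A) (_ : V B) (f : A ⟶ X) (g : X ⟶ B)
      (h : B ⟶ A⟦(1 : ℤ)⟧), Triangle.mk f g h ∈ distTriang D) :
    IsStableTStructure U V where
  shift_left X := U.prop_shift_iff_of_isStableUnderShift X 1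
  shift_right X := by
    rw [eq_rightOrthogonal_of_exists_triangle (fun X hX ↦ U.le_shift 1 X hX) hom_eq_zero
      exists_triangle]
    exact U.rightOrthogonal.prop_shift_iff_of_isStableUnderShift X 1
  hom_eq_zero := hom_eq_zero
  exists_triangle := exists_triangle

namespace IsStableTStructure

variable {U V : ObjectProperty D} (h : IsStableTStructure U V)

include h

lemma leftOrthogonal {X : D} (hX : U X) : V.leftOrthogonal X :=
  fun _ f hY ↦ h.hom_eq_zero hX hY f

lemma rightOrthogonal {X : D} (hX : V X) : U.rightOrthogonal X :=
  fun _ f hY ↦ h.hom_eq_zero hY hX f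

lemma eq_leftOrthogonal [U.IsClosedUnderIsomorphisms] : U = V.leftOrthogonal := by
  ext X
  refine ⟨h.leftOrthogonal, fun hX ↦ ?_⟩
  obtain ⟨A, B, hA, hB, f, g, k, hT⟩ := h.exists_triangle X
  obtain ⟨r, hr⟩ : ∃ r : A⟦(1 : ℤ)⟧ ⟶ B, 𝟙 B = k ≫ r :=
    Triangle.yoneda_exact₃ _ hT _ ((Category.comp_id g).trans (hX g hB))
  have hB₀ : IsZero B := by
    rw [IsZero.iff_id_eq_zero, hr, h.hom_eq_zero ((h.shift_left A).2 hA) hB r, comp_zero]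
  have : IsIso f := (Triangle.isZero₃_iff_isIso₁ _ hT).1 hB₀
  exact U.prop_of_iso (asIso f) hA

lemma eq_rightOrthogonal [V.IsClosedUnderIsomorphisms] : V = U.rightOrthogonal :=
  eq_rightOrthogonal_of_exists_triangle (fun X ↦ (h.shift_left X).2) h.hom_eq_zero
    h.exists_triangle

lemma isRightAdjoint_ι : V.ι.IsRightAdjoint := by
  refine isRightAdjoint_of_bijective _ fun X ↦ ?_
  obtain ⟨A, B, hA, hB, f, g, k, hT⟩ := h.exists_triangle X
  refine ⟨⟨B, hB⟩, g, fun Y ↦ ⟨fun a b hab ↦ ObjectProperty.hom_ext _ (sub_eq_zero.1 ?_),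
    fun a ↦ ?_⟩⟩
  · obtain ⟨c, hc⟩ : ∃ c : A⟦(1 : ℤ)⟧ ⟶ Y.obj, a.hom - b.hom = k ≫ c :=
      Triangle.yoneda_exact₃ _ hT _ ((Preadditive.comp_sub ..).trans (sub_eq_zero.2 hab))
    rw [hc, h.hom_eq_zero ((h.shift_left A).2 hA) Y.property c, comp_zero]
  · obtain ⟨b, hb⟩ := Triangle.yoneda_exact₂ _ hT a (h.hom_eq_zero hA Y.property _)
    exact ⟨ObjectProperty.homMk b, hb.symm⟩

lemma isLeftAdjoint_ι : U.ι.IsLeftAdjoint := by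
  refine isLeftAdjoint_of_bijective _ fun X ↦ ?_
  obtain ⟨A, B, hA, hB, f, g, k, hT⟩ := h.exists_triangle X
  refine ⟨⟨A, hA⟩, f, fun Y ↦ ⟨fun a b hab ↦ ObjectProperty.hom_ext _ (sub_eq_zero.1 ?_),
    fun a ↦ ?_⟩⟩
  · apply (shiftFunctor D (1 : ℤ)).map_injective
    have hab' : (a.hom - b.hom) ≫ f = 0 := (Preadditive.sub_comp ..).trans (sub_eq_zero.2 hab)
    obtain ⟨c, hc⟩ : ∃ c : Y.obj⟦(1 : ℤ)⟧ ⟶ B, (a.hom - b.hom)⟦(1 : ℤ)⟧' = c ≫ k :=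
      Triangle.coyoneda_exact₁ _ hT _ ((Functor.map_comp ..).symm.trans
        (((shiftFunctor D (1 : ℤ)).congr_map hab').trans (Functor.map_zero ..)))
    rw [hc, h.hom_eq_zero ((h.shift_left _).2 Y.property) hB c, zero_comp, Functor.map_zero]
  · obtain ⟨b, hb⟩ := Triangle.coyoneda_exact₂ _ hT a (h.hom_eq_zero Y.property hB _)
    exact ⟨ObjectProperty.homMk b, hb.symm⟩

lemma exists_iso_Q_obj_of_right (Z : V.trW.Localization) :
    ∃ A : D, U A ∧ Nonempty (V.trW.Q.obj A ≅ Z) := by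
  obtain ⟨A, B, hA, hB, f, g, k, hT⟩ := h.exists_triangle (V.trW.Q.objPreimage Z)
  have := Localization.inverts V.trW.Q V.trW f (ObjectProperty.trW.mk V hT hB)
  exact ⟨A, hA, ⟨asIso (V.trW.Q.map f) ≪≫ V.trW.Q.objObjPreimageIso Z⟩⟩

lemma exists_iso_Q_obj_of_left [U.IsStableUnderShift ℤ] (Z : U.trW.Localization) :
    ∃ B : D, V B ∧ Nonempty (U.trW.Q.obj B ≅ Z) := by
  obtain ⟨A, B, hA, hB, f, g, k, hT⟩ := h.exists_triangle (U.trW.Q.objPreimage Z)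
  have := Localization.inverts U.trW.Q U.trW g (ObjectProperty.trW.mk' U hT hA)
  exact ⟨B, hB, ⟨(asIso (U.trW.Q.map g)).symm ≪≫ U.trW.Q.objObjPreimageIso Z⟩⟩

end IsStableTStructure

section Quotient

variable [IsTriangulated D]

section

variable {V : ObjectProperty D} [V.IsTriangulated]

lemma isZero_Q_obj {X : D} (hX : V X) : IsZero (V.trW.Q.obj X) := by
  have : IsIso (V.trW.Q.map (0 : 0 ⟶ X)) := Localization.inverts V.trW.Q V.trW _
    (ObjectProperty.trW.mk V (contractible_distinguished₁ X) hX)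
  exact (Functor.map_isZero _ (isZero_zero D)).of_iso (asIso (V.trW.Q.map (0 : 0 ⟶ X))).symm

lemma leftOrthogonal_leftAdjoint_Q {F : V.trW.Localization ⥤ D} (adj : F ⊣ V.trW.Q)
    (Z : V.trW.Localization) : V.leftOrthogonal (F.obj Z) :=
  fun Y _ hY ↦ (adj.homEquiv Z Y).injective ((isZero_Q_obj hY).eq_of_tgt _ _)

lemma rightOrthogonal_rightAdjoint_Q {F : V.trW.Localization ⥤ D} (adj : V.trW.Q ⊣ F)
    (Z : V.trW.Localization) : V.rightOrthogonal (F.obj Z) :=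
  fun Y _ hY ↦ (adj.homEquiv Y Z).symm.injective ((isZero_Q_obj hY).eq_of_src _ _)

lemma isIso_counit_Q_app {F : V.trW.Localization ⥤ D} (adj : F ⊣ V.trW.Q) {X : D}
    (hX : V.leftOrthogonal X) : IsIso (adj.counit.app X) := by
  refine isIso_of_coyoneda_map_bijective _ fun T ↦ ?_
  simpa [Function.comp_def, Adjunction.homEquiv_counit] using
    (adj.homEquiv (V.trW.Q.obj X) T).symm.bijective.comp
      (hX.map_bijective_of_isTriangulated V.trW.Q T)

lemma isIso_unit_Q_app {F : V.trW.Localization ⥤ D} (adj : V.trW.Q ⊣ F) {X : D}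
    (hX : V.rightOrthogonal X) : IsIso (adj.unit.app X) := by
  refine isIso_of_yoneda_map_bijective _ fun T ↦ ?_
  simpa [Function.comp_def, Adjunction.homEquiv_unit] using
    (adj.homEquiv T (V.trW.Q.obj X)).bijective.comp
      (hX.map_bijective_of_isTriangulated V.trW.Q T)

lemma essImage_leftAdjoint_Q {F : V.trW.Localization ⥤ D} (adj : F ⊣ V.trW.Q) :
    F.essImage = V.leftOrthogonal := by
  ext X
  refine ⟨fun ⟨Z, ⟨e⟩⟩ ↦ V.leftOrthogonal.prop_of_iso e (leftOrthogonal_leftAdjoint_Q adj Z),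
    fun hX ↦ ?_⟩
  have := isIso_counit_Q_app adj hX
  exact ⟨_, ⟨asIso (adj.counit.app X)⟩⟩

lemma essImage_rightAdjoint_Q {F : V.trW.Localization ⥤ D} (adj : V.trW.Q ⊣ F) :
    F.essImage = V.rightOrthogonal := by
  ext X
  refine ⟨fun ⟨Z, ⟨e⟩⟩ ↦ V.rightOrthogonal.prop_of_iso e (rightOrthogonal_rightAdjoint_Q adj Z),
    fun hX ↦ ?_⟩
  have := isIso_unit_Q_app adj hX
  exact ⟨_, ⟨(asIso (adj.unit.app X)).symm⟩⟩

end

namespace IsStableTStructure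

variable {U V : ObjectProperty D} (h : IsStableTStructure U V)

include h

section Right

variable [V.IsTriangulated]

lemma isRightAdjoint_Q : V.trW.Q.IsRightAdjoint := by
  refine isRightAdjoint_of_bijective _ fun Z ↦ ?_
  obtain ⟨A, hA, ⟨e⟩⟩ := h.exists_iso_Q_obj_of_right Z
  exact ⟨A, e.inv, fun Y ↦ e.homFromEquiv.bijective.comp
    ((h.leftOrthogonal hA).map_bijective_of_isTriangulated V.trW.Q Y)⟩

lemma isIso_unit_Q {F : V.trW.Localization ⥤ D} (adj : F ⊣ V.trW.Q) : IsIso adj.unit := by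
  have (Z : V.trW.Localization) : IsIso (adj.unit.app Z) := by
    obtain ⟨A, hA, ⟨e⟩⟩ := h.exists_iso_Q_obj_of_right Z
    have := isIso_counit_Q_app adj (h.leftOrthogonal hA)
    rw [← NatTrans.isIso_app_iff_of_iso adj.unit e]
    rw [IsIso.eq_inv_of_inv_hom_id (adj.right_triangle_components A)]
    infer_instance
  exact NatIso.isIso_of_isIso_app _

lemma kernel_Q [V.IsClosedUnderIsomorphisms] : V.trW.Q.kernel = V := by
  ext X
  refine ⟨fun hX ↦ ?_, isZero_Q_obj⟩
  obtain ⟨A, B, hA, hB, f, g, k, hT⟩ := h.exists_triangle X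
  have : IsIso (V.trW.Q.map f) :=
    Localization.inverts V.trW.Q V.trW f (ObjectProperty.trW.mk V hT hB)
  have hA₀ : IsZero A := by
    rw [IsZero.iff_id_eq_zero]
    apply ((h.leftOrthogonal hA).map_bijective_of_isTriangulated V.trW.Q A).1
    exact (IsZero.of_iso hX (asIso (V.trW.Q.map f))).eq_of_tgt _ _
  have : IsIso g := (Triangle.isZero₁_iff_isIso₂ _ hT).1 hA₀
  exact V.prop_of_iso (asIso g).symm hB

end Right

section Left

variable [U.IsTriangulated]

lemma isLeftAdjoint_Q : U.trW.Q.IsLeftAdjoint := by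
  refine isLeftAdjoint_of_bijective _ fun Z ↦ ?_
  obtain ⟨B, hB, ⟨e⟩⟩ := h.exists_iso_Q_obj_of_left Z
  exact ⟨B, e.hom, fun Y ↦ e.homToEquiv.bijective.comp
    ((h.rightOrthogonal hB).map_bijective_of_isTriangulated U.trW.Q Y)⟩

lemma isIso_counit_Q {F : U.trW.Localization ⥤ D} (adj : U.trW.Q ⊣ F) : IsIso adj.counit := by
  have (Z : U.trW.Localization) : IsIso (adj.counit.app Z) := by
    obtain ⟨B, hB, ⟨e⟩⟩ := h.exists_iso_Q_obj_of_left Z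
    have := isIso_unit_Q_app adj (h.rightOrthogonal hB)
    rw [← NatTrans.isIso_app_iff_of_iso adj.counit e]
    rw [IsIso.eq_inv_of_hom_inv_id (adj.left_triangle_components B)]
    infer_instance
  exact NatIso.isIso_of_isIso_app _

end Left

end IsStableTStructure

theorem exists_recollement {U V W : ObjectProperty D} [V.IsTriangulated]
    [U.IsClosedUnderIsomorphisms] [V.IsClosedUnderIsomorphisms] [W.IsClosedUnderIsomorphisms]
    (hUV : IsStableTStructure U V) (hVW : IsStableTStructure V W) :
    ∃ r : Recollement V.ι V.trW.Q, r.jShriek.essImage = U ∧ r.jStar.essImage = W := by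
  have := hUV.isRightAdjoint_ι
  have := hVW.isLeftAdjoint_ι
  have := hUV.isRightAdjoint_Q
  have := hVW.isLeftAdjoint_Q
  let adj₁ := Adjunction.ofIsRightAdjoint V.ι
  let adj₂ := Adjunction.ofIsLeftAdjoint V.ι
  let adj₃ := Adjunction.ofIsRightAdjoint V.trW.Q
  let adj₄ := Adjunction.ofIsLeftAdjoint V.trW.Q
  let _ := adj₁.leftAdjointCommShift ℤ
  let _ := adj₂.rightAdjointCommShift ℤ
  let _ := adj₃.leftAdjointCommShift ℤ
  let _ := adj₄.rightAdjointCommShift ℤ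
  have := adj₁.commShift_of_rightAdjoint ℤ
  have := adj₂.commShift_of_leftAdjoint ℤ
  have := adj₃.commShift_of_rightAdjoint ℤ
  have := adj₄.commShift_of_leftAdjoint ℤ
  have := hUV.isIso_unit_Q adj₃
  have := hVW.isIso_counit_Q adj₄
  exact ⟨{
    iStar := V.ι.leftAdjoint
    iShriek := V.ι.rightAdjoint
    jShriek := V.trW.Q.leftAdjoint
    jStar := V.trW.Q.rightAdjoint
    iStar_commShift := inferInstance
    iShriek_commShift := inferInstance
    jShriek_commShift := inferInstance
    jStar_commShift := inferInstance
    iStar_isTriangulated := adj₁.isTriangulated_leftAdjoint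
    iShriek_isTriangulated := adj₂.isTriangulated_rightAdjoint
    jShriek_isTriangulated := adj₃.isTriangulated_leftAdjoint
    jStar_isTriangulated := adj₄.isTriangulated_rightAdjoint
    i_full := inferInstance
    i_faithful := inferInstance
    jShriek_full := adj₃.fullyFaithfulLOfIsIsoUnit.full
    jShriek_faithful := adj₃.fullyFaithfulLOfIsIsoUnit.faithful
    jStar_full := adj₄.fullyFaithfulROfIsIsoCounit.full
    jStar_faithful := adj₄.fullyFaithfulROfIsIsoCounit.faithful
    adj_iStar := adj₁
    adj_iShriek := adj₂
    adj_jShriek := adj₃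
    adj_jStar := adj₄
    essImage_jShriek := (essImage_leftAdjoint_Q adj₃).trans (kernel_leftAdjoint_ι adj₁).symm
    essImage_i := essImage_ι.trans hUV.kernel_Q.symm
    essImage_jStar := (essImage_rightAdjoint_Q adj₄).trans (kernel_rightAdjoint_ι adj₂).symm },
    (essImage_leftAdjoint_Q adj₃).trans hUV.eq_leftOrthogonal.symm,
    (essImage_rightAdjoint_Q adj₄).trans hVW.eq_rightOrthogonal.symm⟩

end Quotient

end StableTStructure

section Models

variable {M A B : Type*} [Category M] [Category A] [Category B] {P P' : ObjectProperty M}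
  {q : M ⥤ A} {F : A ⥤ B}

lemma hom_eq_zero_of_models [Preadditive A] [q.Full]
    (h : ∀ ⦃α β⦄, P α → P' β → ∀ f : α ⟶ β, q.map f = 0) ⦃X Y : A⦄ (hX : P.map q X)
    (hY : P'.map q Y) (f : X ⟶ Y) : f = 0 := by
  obtain ⟨α, hα, ⟨a⟩⟩ := hX
  obtain ⟨β, hβ, ⟨b⟩⟩ := hY
  obtain ⟨g, hg⟩ := q.map_surjective (a.hom ≫ f ≫ b.inv)
  rw [← cancel_epi a.hom, ← cancel_mono b.inv, Category.assoc, ← hg, h hα hβ g]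
  simp

lemma full_ι_comp
    (hfull : ∀ ⦃α β⦄, P α → P β → ∀ g : F.obj (q.obj α) ⟶ F.obj (q.obj β), ∃ f, F.map f = g) :
    ((P.map q).ι ⋙ F).Full where
  map_surjective {X Y} g := by
    obtain ⟨X, α, hα, ⟨a⟩⟩ := X
    obtain ⟨Y, β, hβ, ⟨b⟩⟩ := Y
    obtain ⟨f, hf⟩ := hfull hα hβ (F.map a.hom ≫ g ≫ F.map b.inv)
    refine ⟨ObjectProperty.homMk (a.inv ≫ f ≫ b.hom), ?_⟩
    change F.map (a.inv ≫ f ≫ b.hom) = g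
    rw [F.map_comp, F.map_comp, hf]
    simp [← F.map_comp, ← F.map_comp_assoc]

lemma faithful_ι_comp [Preadditive A] [Preadditive B] [F.Additive]
    (hfaithful : ∀ ⦃α β⦄, P α → P β → ∀ f : q.obj α ⟶ q.obj β, F.map f = 0 → f = 0) :
    ((P.map q).ι ⋙ F).Faithful where
  map_injective {X Y f g} h := by
    obtain ⟨X, α, hα, ⟨a⟩⟩ := X
    obtain ⟨Y, β, hβ, ⟨b⟩⟩ := Y
    have hfg : F.map f.hom = F.map g.hom := h
    have h₀ : a.hom ≫ (f.hom - g.hom) ≫ b.inv = 0 := hfaithful hα hβ _ (by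
      rw [F.map_comp, F.map_comp, F.map_sub, hfg, sub_self, zero_comp, comp_zero])
    apply ObjectProperty.hom_ext
    rw [← sub_eq_zero, ← cancel_epi a.hom, ← cancel_mono b.inv, Category.assoc, h₀]
    simp

end Models

section TriangleEquivalent

variable {A B : Type*} [Category A] [HasZeroObject A] [HasShift A ℤ] [Preadditive A]
  [∀ n : ℤ, (shiftFunctor A n).Additive] [Pretriangulated A]

instance isTriangulated_isZero : ObjectProperty.IsTriangulated (C := A) IsZero := by
  have : (IsZero : ObjectProperty A) = (⊤ : ObjectProperty A).rightOrthogonal := by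
    ext X
    exact ⟨fun h Y f _ ↦ h.eq_of_tgt _ _, fun h ↦ (IsZero.iff_id_eq_zero X).2 (h _ trivial)⟩
  rw [this]
  infer_instance

variable [Category B] [HasZeroObject B] [HasShift B ℤ] [Preadditive B]
  [∀ n : ℤ, (shiftFunctor B n).Additive] [Pretriangulated B]

lemma triangleEquivalent_of_isEquivalence (F : A ⥤ B) [F.CommShift ℤ] [F.IsTriangulated]
    [F.IsEquivalence] : TriangleEquivalent B A := by
  let adj : F ⊣ F.inv := F.asEquivalence.toAdjunction
  let _ := adj.rightAdjointCommShift ℤ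
  have := adj.commShift_of_leftAdjoint ℤ
  exact ⟨F.inv, inferInstance, adj.isTriangulated_rightAdjoint, inferInstance⟩

lemma triangleEquivalent_of_models {M : Type*} [Category M] {P : ObjectProperty M} {q : M ⥤ A}
    [(P.map q).IsTriangulated] (F : A ⥤ B) [F.CommShift ℤ] [F.IsTriangulated]
    (hfull : ∀ ⦃α β⦄, P α → P β → ∀ g : F.obj (q.obj α) ⟶ F.obj (q.obj β), ∃ f, F.map f = g)
    (hfaithful : ∀ ⦃α β⦄, P α → P β → ∀ f : q.obj α ⟶ q.obj β, F.map f = 0 → f = 0)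
    (hsurj : ∀ X : B, ∃ α, P α ∧ Nonempty (F.obj (q.obj α) ≅ X)) :
    TriangleEquivalent B (P.map q).FullSubcategory := by
  have := full_ι_comp hfull
  have := faithful_ι_comp hfaithful
  have : ((P.map q).ι ⋙ F).EssSurj := ⟨fun X ↦
    have ⟨_, hα, ⟨e⟩⟩ := hsurj X
    ⟨⟨_, P.prop_map_obj q hα⟩, ⟨e⟩⟩⟩
  have : ((P.map q).ι ⋙ F).IsEquivalence := { }
  exact triangleEquivalent_of_isEquivalence ((P.map q).ι ⋙ F)

end TriangleEquivalent

end Recoll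

/-! ### Cohen-Macaulay modules -/

namespace Gorenstein

section ExtVanishing

open Abelian

universe w v u'

variable {A : Type u'} [Category.{v} A] [Abelian A] [HasExt.{w} A]

/-- The objects `X` with `Ext^i(X, M) = 0` for all `i > 0`. For `M` the regular module this is the
homological half of the Cohen-Macaulay condition. -/
def extVanishing (M : A) : ObjectProperty A := fun X ↦
  ∀ i : ℕ, 0 < i → Subsingleton (Ext.{w} X M i)

lemma extVanishing_of_projective (P M : A) [Projective P] : extVanishing.{w} M P := fun i hi ↦ by
  obtain ⟨j, rfl⟩ := Nat.exists_eq_succ_of_ne_zero hi.ne'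
  exact Ext.subsingleton_of_projective P M j

variable {S : ShortComplex A} (hS : S.ShortExact) {M : A}

include hS

lemma exists_f_comp_eq_of_subsingleton_ext (h₃ : Subsingleton (Ext.{w} S.X₃ M 1))
    (f : S.X₁ ⟶ M) : ∃ g : S.X₂ ⟶ M, S.f ≫ g = f := by
  obtain ⟨x, hx⟩ := Ext.contravariant_sequence_exact₁ hS M (Ext.mk₀ f) (add_zero 1)
    (Subsingleton.elim _ _)
  obtain ⟨g, rfl⟩ := Ext.addEquiv₀.symm.surjective x
  exact ⟨g, Ext.addEquiv₀.symm.injective (Eq.trans (by simp) hx)⟩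

lemma subsingleton_ext_X₁ {i : ℕ} (h₂ : Subsingleton (Ext.{w} S.X₂ M i))
    (h₃ : Subsingleton (Ext.{w} S.X₃ M (i + 1))) : Subsingleton (Ext.{w} S.X₁ M i) := by
  refine subsingleton_of_forall_eq 0 fun x ↦ ?_
  obtain ⟨y, rfl⟩ := Ext.contravariant_sequence_exact₁ hS M x (add_comm 1 i)
    (Subsingleton.elim _ _)
  rw [Subsingleton.elim y 0, Ext.comp_zero]

lemma extVanishing_X₁ (h₂ : extVanishing.{w} M S.X₂) (h₃ : extVanishing.{w} M S.X₃) :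
    extVanishing.{w} M S.X₁ := fun i hi ↦
  subsingleton_ext_X₁ hS (h₂ i hi) (h₃ (i + 1) i.succ_pos)

lemma extVanishing_X₃ (h₁ : extVanishing.{w} M S.X₁) (h₂ : extVanishing.{w} M S.X₂)
    (hf : ∀ f : S.X₁ ⟶ M, ∃ g : S.X₂ ⟶ M, S.f ≫ g = f) : extVanishing.{w} M S.X₃ := by
  intro i hi
  refine subsingleton_of_forall_eq 0 fun x ↦ ?_
  have := h₂ i hi
  obtain ⟨j, rfl⟩ := Nat.exists_eq_add_of_le hi
  obtain ⟨y, rfl⟩ := Ext.contravariant_sequence_exact₃ hS M x (Subsingleton.elim _ _)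
    (show 1 + j = _ by lia)
  rcases Nat.eq_zero_or_pos j with rfl | hj
  · obtain ⟨f, rfl⟩ := Ext.addEquiv₀.symm.surjective y
    obtain ⟨g, rfl⟩ := hf f
    have hfg : Ext.addEquiv₀.symm (S.f ≫ g) = (Ext.mk₀ S.f).comp (Ext.mk₀ g) (zero_add 0) := by
      simp
    rw [hfg, ← Ext.comp_assoc _ _ _ (add_zero 1) (zero_add 0) (by lia),
      ShortComplex.ShortExact.extClass_comp, Ext.zero_comp]
  · have := h₁ j hj
    rw [Subsingleton.elim y 0, Ext.comp_zero]

end ExtVanishing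

section LinearMap

variable {A : Type*} [Ring A]

lemma exists_comp_eq_of_surjective {M N P : Type*} [AddCommGroup M] [Module A M]
    [AddCommGroup N] [Module A N] [AddCommGroup P] [Module A P] {f : M →ₗ[A] N} {g : M →ₗ[A] P}
    (hf : Function.Surjective f) (hfg : ∀ x, f x = 0 → g x = 0) :
    ∃ t : N →ₗ[A] P, t ∘ₗ f = g := by
  refine ⟨(LinearMap.ker f).liftQ g hfg ∘ₗ (f.quotKerEquivOfSurjective hf).symm.toLinearMap, ?_⟩
  ext x
  rw [LinearMap.comp_apply, LinearMap.comp_apply, LinearEquiv.coe_coe,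
    LinearMap.quotKerEquivOfSurjective_symm_apply]
  exact Submodule.liftQ_apply _ _ _

lemma shortExact_ofHom {X Y Z : Type u} [AddCommGroup X] [Module A X]
    [AddCommGroup Y] [Module A Y] [AddCommGroup Z] [Module A Z] {f : X →ₗ[A] Y} {g : Y →ₗ[A] Z}
    (hf : Function.Injective f) (hfg : Function.Exact f g) (hg : Function.Surjective g) :
    (ShortComplex.mk (ModuleCat.ofHom f) (ModuleCat.ofHom g)
      (ModuleCat.hom_ext hfg.linearMap_comp_eq_zero)).ShortExact :=
  ModuleCat.shortComplex_shortExact _ hfg hf hg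

end LinearMap

section Dual

variable {R : Type u} [Ring R]

instance : Module.Free Rᵐᵒᵖ R := .of_equiv (MulOpposite.opLinearEquiv Rᵐᵒᵖ).symm

instance : Module.Finite Rᵐᵒᵖ R := .equiv (MulOpposite.opLinearEquiv Rᵐᵒᵖ).symm

section Free

variable (M : Type*) [AddCommGroup M] [Module Rᵐᵒᵖ M] [Module.Free Rᵐᵒᵖ M] [Module.Finite Rᵐᵒᵖ M]

instance : Module.Projective R (M →ₗ[Rᵐᵒᵖ] R) := by
  classical exact .of_equiv ((Module.Free.chooseBasis Rᵐᵒᵖ M).constr R)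

instance : Module.Finite R (M →ₗ[Rᵐᵒᵖ] R) := by
  classical exact .equiv ((Module.Free.chooseBasis Rᵐᵒᵖ M).constr R)

variable {M}

lemma exists_forall_apply_eq_of_free (φ : (M →ₗ[Rᵐᵒᵖ] R) →ₗ[R] R) :
    ∃ q : M, ∀ f, φ f = f q := by
  classical
  let b := Module.Free.chooseBasis Rᵐᵒᵖ M
  let a i : R := φ (b.constr R fun j ↦ if i = j then 1 else 0)
  refine ⟨∑ i, MulOpposite.op (a i) • b i, fun f ↦ ?_⟩
  obtain ⟨x, rfl⟩ := (b.constr R).surjective f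
  have hφ := LinearMap.pi_apply_eq_sum_univ (φ ∘ₗ (b.constr R).toLinearMap) x
  simpa [a, Module.Basis.constr_basis] using hφ

end Free

section Exact

variable {X Y Z : Type u} [AddCommGroup X] [Module Rᵐᵒᵖ X] [AddCommGroup Y] [Module Rᵐᵒᵖ Y]
  [AddCommGroup Z] [Module Rᵐᵒᵖ Z] {f : X →ₗ[Rᵐᵒᵖ] Y} {g : Y →ₗ[Rᵐᵒᵖ] Z}

lemma exact_lcomp (hfg : Function.Exact f g) (hg : Function.Surjective g) :
    Function.Exact (g.lcomp R R) (f.lcomp R R) := by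
  intro h
  constructor
  · intro hh
    refine exists_comp_eq_of_surjective hg fun y hy ↦ ?_
    obtain ⟨x, rfl⟩ := (hfg y).1 hy
    exact LinearMap.congr_fun hh x
  · rintro ⟨k, rfl⟩
    ext x
    simp [hfg.apply_apply_eq_zero]

lemma lcomp_surjective_of_isCM (hf : Function.Injective f) (hfg : Function.Exact f g)
    (hg : Function.Surjective g) (hZ : isCM R (ModuleCat.of Rᵐᵒᵖ Z)) :
    Function.Surjective (f.lcomp R R) := fun h ↦ by
  obtain ⟨k, hk⟩ := exists_f_comp_eq_of_subsingleton_ext (shortExact_ofHom hf hfg hg)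
    (hZ.2 1 one_pos) (ModuleCat.ofHom h)
  exact ⟨k.hom, congrArg ModuleCat.Hom.hom hk⟩

lemma shortExact_lcomp_of_isCM (hf : Function.Injective f) (hfg : Function.Exact f g)
    (hg : Function.Surjective g) (hZ : isCM R (ModuleCat.of Rᵐᵒᵖ Z)) :
    (ShortComplex.mk (ModuleCat.ofHom (g.lcomp R R)) (ModuleCat.ofHom (f.lcomp R R))
      (ModuleCat.hom_ext (exact_lcomp hfg hg).linearMap_comp_eq_zero)).ShortExact :=
  shortExact_ofHom (LinearMap.lcomp_injective_of_surjective g hg) (exact_lcomp hfg hg)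
    (lcomp_surjective_of_isCM hf hfg hg hZ)

end Exact

variable [IsNoetherianRing Rᵐᵒᵖ] {X : ModuleCat.{u} Rᵐᵒᵖ}

lemma isCM_of_finite [Module.Finite Rᵐᵒᵖ X] (hX : extVanishing.{u} (ModuleCat.of Rᵐᵒᵖ R) X) :
    isCM R X :=
  ⟨Module.finitePresentation_of_finite _ _, hX⟩

lemma isCM_of_projective [Module.Finite Rᵐᵒᵖ X] [Module.Projective Rᵐᵒᵖ X] : isCM R X :=
  isCM_of_finite (extVanishing_of_projective _ _)

lemma exists_syzygy (hX : isCM R X) :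
    ∃ (n : ℕ) (K : ModuleCat.{u} Rᵐᵒᵖ) (i : K →ₗ[Rᵐᵒᵖ] (Fin n → R)) (p : (Fin n → R) →ₗ[Rᵐᵒᵖ] X),
      isCM R K ∧ Function.Injective i ∧ Function.Exact i p ∧ Function.Surjective p := by
  have := hX.1
  obtain ⟨n, p', hp'⟩ := Module.Finite.exists_fin' Rᵐᵒᵖ X
  let e : (Fin n → R) ≃ₗ[Rᵐᵒᵖ] (Fin n → Rᵐᵒᵖ) :=
    .piCongrRight fun _ ↦ MulOpposite.opLinearEquiv Rᵐᵒᵖ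
  let p : (Fin n → R) →ₗ[Rᵐᵒᵖ] X := p' ∘ₗ e.toLinearMap
  have hi := (LinearMap.ker p).injective_subtype
  have hip := LinearMap.exact_subtype_ker_map p
  have hp : Function.Surjective p := hp'.comp e.surjective
  have hfree : isCM R (ModuleCat.of Rᵐᵒᵖ (Fin n → R)) := isCM_of_projective
  exact ⟨n, ModuleCat.of _ (LinearMap.ker p), (LinearMap.ker p).subtype, p,
    isCM_of_finite (extVanishing_X₁ (shortExact_ofHom hi hip hp) hfree.2 hX.2), hi, hip, hp⟩

/-- Dualizing a free presentation shifts the degree of the vanishing `Ext` by one, so `m` syzygies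
bring any degree beyond the injective dimension. -/
lemma subsingleton_ext_dual {n : ℕ} (hn : HasInjectiveDimensionLE (ModuleCat.of.{u} R R) n)
    (m : ℕ) (hX : isCM R X) {i : ℕ} (hi : 0 < i) (him : n < i + m) :
    Subsingleton
      (Abelian.Ext.{u} (ModuleCat.of.{u} R (X →ₗ[Rᵐᵒᵖ] R)) (ModuleCat.of.{u} R R) i) := by
  induction m generalizing X i with
  | zero => exact HasInjectiveDimensionLT.subsingleton _ (n + 1) i (by lia) _
  | succ m ih =>
    obtain ⟨k, K, f, g, hK, hf, hfg, hg⟩ := exists_syzygy hX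
    exact subsingleton_ext_X₁ (shortExact_lcomp_of_isCM hf hfg hg hX)
      (extVanishing_of_projective _ _ i hi) (ih hK i.succ_pos (by lia))

lemma extVanishing_dual (hinj : ∃ n, HasInjectiveDimensionLE (ModuleCat.of.{u} R R) n)
    (hX : isCM R X) :
    extVanishing.{u} (ModuleCat.of.{u} R R) (ModuleCat.of.{u} R (X →ₗ[Rᵐᵒᵖ] R)) := fun i hi ↦ by
  obtain ⟨n, hn⟩ := hinj
  exact subsingleton_ext_dual hn n hX hi (by lia)

lemma exists_forall_apply_eq_of_isCM
    (hinj : ∃ n, HasInjectiveDimensionLE (ModuleCat.of.{u} R R) n) (hX : isCM R X)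
    (φ : (X →ₗ[Rᵐᵒᵖ] R) →ₗ[R] R) : ∃ x : X, ∀ f, φ f = f x := by
  obtain ⟨k, K, i, p, hK, hi, hip, hp⟩ := exists_syzygy hX
  obtain ⟨ψ, hψ⟩ := exists_f_comp_eq_of_subsingleton_ext (shortExact_lcomp_of_isCM hi hip hp hX)
    (extVanishing_dual hinj hK 1 one_pos) (ModuleCat.ofHom φ)
  obtain ⟨q, hq⟩ := exists_forall_apply_eq_of_free ψ.hom
  exact ⟨p q, fun f ↦ (ConcreteCategory.congr_hom hψ f).symm.trans (hq (f ∘ₗ p))⟩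

lemma eq_zero_of_forall_linearForm_eq_zero
    (hinj : ∃ n, HasInjectiveDimensionLE (ModuleCat.of.{u} R R) n) (hX : isCM R X) {x : X}
    (hx : ∀ f : X →ₗ[Rᵐᵒᵖ] R, f x = 0) : x = 0 := by
  obtain ⟨k, K, i, p, hK, hi, hip, hp⟩ := exists_syzygy hX
  obtain ⟨y, rfl⟩ := hp x
  -- Evaluation at `y` kills the forms coming from `X`, so it descends to the dual of `K`, where
  -- it is the evaluation at some `z`; then `y = i z`.
  obtain ⟨φ, hφ⟩ := exists_comp_eq_of_surjective (g := LinearMap.applyₗ' R y)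
    (lcomp_surjective_of_isCM hi hip hp hX) (fun f hf ↦ by
      obtain ⟨g, rfl⟩ := (exact_lcomp hip hp f).1 hf
      exact hx g)
  obtain ⟨z, hz⟩ := exists_forall_apply_eq_of_isCM hinj hK φ
  have hy : y = i z := by
    ext j
    exact (LinearMap.congr_fun hφ (LinearMap.proj j)).symm.trans (hz (LinearMap.proj j ∘ₗ i))
  rw [hy, hip.apply_apply_eq_zero]

lemma finite_dual [IsNoetherianRing R] (hX : isCM R X) : Module.Finite R (X →ₗ[Rᵐᵒᵖ] R) := by
  obtain ⟨k, K, i, p, -, -, -, hp⟩ := exists_syzygy hX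
  exact .of_injective (p.lcomp R R) (LinearMap.lcomp_injective_of_surjective p hp)

lemma exists_injective_lcomp_surjective [IsNoetherianRing R]
    (hinj : ∃ n, HasInjectiveDimensionLE (ModuleCat.of.{u} R R) n) (hX : isCM R X) :
    ∃ (n : ℕ) (f : X →ₗ[Rᵐᵒᵖ] (Fin n → R)), Function.Injective f ∧
      Function.Surjective (f.lcomp R R) := by
  have := finite_dual hX
  obtain ⟨n, s, hs⟩ := Module.Finite.exists_fin (R := R) (M := X →ₗ[Rᵐᵒᵖ] R)
  have hsurj : Function.Surjective ((LinearMap.pi s).lcomp R R) := by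
    rw [← LinearMap.range_eq_top, eq_top_iff, ← hs, Submodule.span_le]
    rintro _ ⟨j, rfl⟩
    exact ⟨LinearMap.proj j, LinearMap.proj_pi _ _⟩
  refine ⟨n, LinearMap.pi s, (injective_iff_map_eq_zero _).2 fun x hx ↦ ?_, hsurj⟩
  refine eq_zero_of_forall_linearForm_eq_zero hinj hX fun f ↦ ?_
  obtain ⟨g, rfl⟩ := hsurj f
  exact (congrArg g hx).trans (map_zero g)

end Dual

open Frobenius Recoll

section LinearMap

variable {A : Type*} [Ring A] {X Y Z X' Y' Z' : Type*} [AddCommGroup X] [Module A X]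
  [AddCommGroup Y] [Module A Y] [AddCommGroup Z] [Module A Z] [AddCommGroup X'] [Module A X']
  [AddCommGroup Y'] [Module A Y'] [AddCommGroup Z'] [Module A Z'] {f : X →ₗ[A] Y} {g : Y →ₗ[A] Z}
  {f' : X' →ₗ[A] Y'} {g' : Y' →ₗ[A] Z'} {a : X →ₗ[A] X'} {b : Y →ₗ[A] Y'} {c : Z →ₗ[A] Z'}

lemma coprod_surjective_of_exact (hg : Function.Surjective g) (hfg' : Function.Exact f' g')
    (hc : Function.Surjective c) (hbc : g' ∘ₗ b = c ∘ₗ g) :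
    Function.Surjective (b.coprod f') := fun y' ↦ by
  obtain ⟨y, hy⟩ := (hc.comp hg) (g' y')
  obtain ⟨x', hx'⟩ := (hfg' (y' - b y)).1 (by
    rw [map_sub, sub_eq_zero, ← hy]
    exact (LinearMap.congr_fun hbc y).symm)
  exact ⟨(y, x'), by simp [hx']⟩

lemma exists_eq_of_add_eq_zero_of_exact (hfg : Function.Exact f g) (hf' : Function.Injective f')
    (hfg' : Function.Exact f' g') (hc : Function.Injective c) (hab : b ∘ₗ f = f' ∘ₗ a)
    (hbc : g' ∘ₗ b = c ∘ₗ g) {y : Y} {x' : X'} (h : b y + f' x' = 0) :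
    ∃ x, f x = y ∧ a x = -x' := by
  have hy : c (g y) = 0 := by
    have hgy := congrArg g' h
    rw [map_add, hfg'.apply_apply_eq_zero, add_zero, map_zero] at hgy
    exact (LinearMap.congr_fun hbc y).symm.trans hgy
  obtain ⟨x, rfl⟩ := (hfg y).1 ((map_eq_zero_iff c hc).1 hy)
  refine ⟨x, rfl, hf' ?_⟩
  rw [map_neg, ← add_eq_zero_iff_eq_neg, ← h]
  exact congrArg (· + f' x') (LinearMap.congr_fun hab x).symm

end LinearMap

variable {R : Type u} [Ring R]

variable (R) in
/-- The category of Cohen-Macaulay modules. -/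
abbrev CM : Type _ := (isCM R).FullSubcategory

namespace CM

/-- The linear map underlying a morphism of Cohen-Macaulay modules. -/
abbrev lin {X Y : CM R} (f : X ⟶ Y) : X.obj →ₗ[Rᵐᵒᵖ] Y.obj := f.hom.hom

/-- The morphism of Cohen-Macaulay modules given by a linear map. -/
def ofLin {X Y : CM R} (f : X.obj →ₗ[Rᵐᵒᵖ] Y.obj) : X ⟶ Y :=
  ObjectProperty.homMk (ModuleCat.ofHom f)

lemma hom_ext {X Y : CM R} {f g : X ⟶ Y} (h : ∀ x, lin f x = lin g x) : f = g :=
  ObjectProperty.hom_ext _ (ModuleCat.hom_ext (LinearMap.ext h))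

lemma lin_congr {X Y : CM R} {f g : X ⟶ Y} (h : f = g) (x : X.obj) : lin f x = lin g x := by
  rw [h]

lemma mono_of_injective {X Y : CM R} {f : X ⟶ Y} (h : Function.Injective (lin f)) : Mono f :=
  ⟨fun _ _ hab ↦ hom_ext fun x ↦ h (lin_congr hab x)⟩

lemma epi_of_surjective {X Y : CM R} {f : X ⟶ Y} (h : Function.Surjective (lin f)) : Epi f :=
  ⟨fun _ _ hab ↦ hom_ext (h.forall.2 fun x ↦ lin_congr hab x)⟩

lemma surjective_of_section {X Y : CM R} {s : X ⟶ Y} {p : Y ⟶ X} (h : s ≫ p = 𝟙 X) :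
    Function.Surjective (lin p) := fun x ↦ ⟨lin s x, lin_congr h x⟩

lemma projective_of_retract {X Y : CM R} {s : X ⟶ Y} {p : Y ⟶ X} (h : s ≫ p = 𝟙 X)
    [Module.Projective Rᵐᵒᵖ Y.obj] : Module.Projective Rᵐᵒᵖ X.obj :=
  .of_split (lin s) (lin p) (LinearMap.ext (lin_congr h))

lemma exists_lift_of_projective {P X Y : CM R} (hP : Module.Projective Rᵐᵒᵖ P.obj) {p : X ⟶ Y}
    (hp : Function.Surjective (lin p)) (f : P ⟶ Y) : ∃ g : P ⟶ X, g ≫ p = f := by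
  obtain ⟨g, hg⟩ := Module.projective_lifting_property (lin p) (lin f) hp
  exact ⟨ofLin g, hom_ext fun x ↦ LinearMap.congr_fun hg x⟩

lemma conflation_iff {S : ShortComplex (CM R)} : cmConflation R S ↔
    Function.Injective (lin S.f) ∧ Function.Exact (lin S.f) (lin S.g) ∧
      Function.Surjective (lin S.g) :=
  ⟨fun h ↦ ⟨h.moduleCat_injective_f,
    (ShortComplex.ShortExact.moduleCat_exact_iff_function_exact _).1 h.exact,
    h.moduleCat_surjective_g⟩,
  fun ⟨hf, hfg, hg⟩ ↦ ModuleCat.shortComplex_shortExact _ hfg hf hg⟩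

section Conflation

variable {X Y Z : CM R} {f : X ⟶ Y} {g : Y ⟶ Z} {w : f ≫ g = 0}
  (h : cmConflation R (ShortComplex.mk f g w))

include h

lemma injective_of_conflation : Function.Injective (lin f) := (conflation_iff.1 h).1

lemma exact_of_conflation : Function.Exact (lin f) (lin g) := (conflation_iff.1 h).2.1

lemma surjective_of_conflation : Function.Surjective (lin g) := (conflation_iff.1 h).2.2

lemma mono_of_conflation : Mono f := mono_of_injective (injective_of_conflation h)

lemma epi_of_conflation : Epi g := epi_of_surjective (surjective_of_conflation h)

lemma exists_desc {T : CM R} (t : Y ⟶ T) (ht : f ≫ t = 0) : ∃ s, g ≫ s = t := by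
  have := h.epi_g
  obtain ⟨s, hs⟩ := h.exact.desc' t.hom ((isCM R).ι.congr_map ht)
  exact ⟨ObjectProperty.homMk s, ObjectProperty.hom_ext _ hs⟩

lemma exists_lift {T : CM R} (t : T ⟶ Y) (ht : t ≫ g = 0) : ∃ s, s ≫ f = t := by
  have := h.mono_f
  obtain ⟨s, hs⟩ := h.exact.lift' t.hom ((isCM R).ι.congr_map ht)
  exact ⟨ObjectProperty.homMk s, ObjectProperty.hom_ext _ hs⟩

end Conflation

lemma isPushout_of_isIso {S S' : ShortComplex (CM R)} (hS : cmConflation R S)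
    (hS' : cmConflation R S') (φ : S ⟶ S') (hφ : IsIso φ.τ₃) : IsPushout S.f φ.τ₁ φ.τ₂ S'.f := by
  have hτ : Function.Bijective (lin φ.τ₃) :=
    ConcreteCategory.bijective_of_isIso ((isCM R).ι.map φ.τ₃)
  have hab : lin φ.τ₂ ∘ₗ lin S.f = lin S'.f ∘ₗ lin φ.τ₁ :=
    congrArg (lin ·) φ.comm₁₂.symm
  have hbc : lin S'.g ∘ₗ lin φ.τ₂ = lin φ.τ₃ ∘ₗ lin S.g :=
    congrArg (lin ·) φ.comm₂₃
  have hsurj := coprod_surjective_of_exact (surjective_of_conflation hS) (exact_of_conflation hS')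
    hτ.2 hbc
  refine isPushout_of_exists_desc φ.comm₁₂.symm (fun T a b h ↦ ?_) fun T t h₁ h₂ ↦ hom_ext ?_
  · obtain ⟨t, ht⟩ := exists_comp_eq_of_surjective (g := (lin a).coprod (lin b)) hsurj
      (fun ⟨y, x'⟩ hyx ↦ by
        obtain ⟨x, rfl, hx⟩ := exists_eq_of_add_eq_zero_of_exact (exact_of_conflation hS)
          (injective_of_conflation hS') (exact_of_conflation hS') hτ.1 hab hbc (x' := x') hyx
        have habx : lin a (lin S.f x) = lin b (lin φ.τ₁ x) := lin_congr h x
        rw [hx, map_neg] at habx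
        exact add_eq_zero_iff_eq_neg.2 habx)
    have htb : t ∘ₗ lin S'.f = lin b := by
      rw [← LinearMap.coprod_inr (lin φ.τ₂) (lin S'.f), ← LinearMap.comp_assoc, ht,
        LinearMap.coprod_inr]
    have hta : t ∘ₗ lin φ.τ₂ = lin a := by
      rw [← LinearMap.coprod_inl (lin φ.τ₂) (lin S'.f), ← LinearMap.comp_assoc, ht,
        LinearMap.coprod_inl]
    exact ⟨ofLin t, hom_ext (LinearMap.congr_fun hta), hom_ext (LinearMap.congr_fun htb)⟩
  · refine hsurj.forall.2 fun ⟨y, x'⟩ ↦ ?_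
    rw [LinearMap.coprod_apply, map_add]
    exact (congrArg₂ (· + ·) (lin_congr h₁ y) (lin_congr h₂ x')).trans (add_zero _)

lemma conflation_of_comp {X₁ X₂ X₃ Z₁₂ Z₂₃ Z₁₃ : CM R} {f₁₂ : X₁ ⟶ X₂} {g₁₂ : X₂ ⟶ Z₁₂}
    {w₁₂ : f₁₂ ≫ g₁₂ = 0} {f₂₃ : X₂ ⟶ X₃} {g₂₃ : X₃ ⟶ Z₂₃} {w₂₃ : f₂₃ ≫ g₂₃ = 0}
    {g₁₃ : X₃ ⟶ Z₁₃} {w₁₃ : (f₁₂ ≫ f₂₃) ≫ g₁₃ = 0} {m₁ : Z₁₂ ⟶ Z₁₃} {m₃ : Z₁₃ ⟶ Z₂₃}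
    (w : m₁ ≫ m₃ = 0)
    (h₁₂ : cmConflation R (ShortComplex.mk f₁₂ g₁₂ w₁₂))
    (h₂₃ : cmConflation R (ShortComplex.mk f₂₃ g₂₃ w₂₃))
    (h₁₃ : cmConflation R (ShortComplex.mk (f₁₂ ≫ f₂₃) g₁₃ w₁₃))
    (hm₁ : g₁₂ ≫ m₁ = f₂₃ ≫ g₁₃) (hm₃ : g₁₃ ≫ m₃ = g₂₃) :
    cmConflation R (ShortComplex.mk m₁ m₃ w) := by
  have hm₁' (x) : lin m₁ (lin g₁₂ x) = lin g₁₃ (lin f₂₃ x) := lin_congr hm₁ x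
  have hm₃' (x) : lin m₃ (lin g₁₃ x) = lin g₂₃ x := lin_congr hm₃ x
  refine conflation_iff.2 ⟨(injective_iff_map_eq_zero _).2 fun z hz ↦ ?_, fun z ↦ ⟨fun hz ↦ ?_, ?_⟩,
    fun z ↦ ?_⟩
  · obtain ⟨x, rfl⟩ := surjective_of_conflation h₁₂ z
    obtain ⟨y, hy⟩ := (exact_of_conflation h₁₃ (lin f₂₃ x)).1 ((hm₁' x).symm.trans hz)
    exact (exact_of_conflation h₁₂ x).2 ⟨y, injective_of_conflation h₂₃ hy⟩
  · obtain ⟨x, rfl⟩ := surjective_of_conflation h₁₃ z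
    obtain ⟨y, rfl⟩ := (exact_of_conflation h₂₃ x).1 ((hm₃' x).symm.trans hz)
    exact ⟨lin g₁₂ y, hm₁' y⟩
  · rintro ⟨y, rfl⟩
    exact lin_congr w y
  · obtain ⟨x, rfl⟩ := surjective_of_conflation h₂₃ z
    exact ⟨lin g₁₃ x, hm₃' x⟩

/-- The inflations of `CM R`, that is, the first maps of conflations. By the long exact sequence of
`Ext(-, R)`, the cokernel of an injective map is Cohen-Macaulay when every linear form extends. -/
def IsInflation {X Y : CM R} (f : X ⟶ Y) : Prop :=
  Function.Injective (lin f) ∧ Function.Surjective ((lin f).lcomp R R)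

lemma IsInflation.comp {X Y Z : CM R} {f : X ⟶ Y} {g : Y ⟶ Z} (hf : IsInflation f)
    (hg : IsInflation g) : IsInflation (f ≫ g) :=
  ⟨hg.1.comp hf.1, hf.2.comp hg.2⟩

lemma IsInflation.of_comp {X Y Z : CM R} {f : X ⟶ Y} {g : Y ⟶ Z} (h : IsInflation (f ≫ g)) :
    IsInflation f :=
  ⟨.of_comp h.1, .of_comp (g := (lin g).lcomp R R) h.2⟩

lemma isInflation_of_conflation {X Y Z : CM R} {f : X ⟶ Y} {g : Y ⟶ Z} {w : f ≫ g = 0}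
    (h : cmConflation R (ShortComplex.mk f g w)) : IsInflation f :=
  ⟨injective_of_conflation h, lcomp_surjective_of_isCM (injective_of_conflation h)
    (exact_of_conflation h) (surjective_of_conflation h) Z.property⟩

lemma eq_zero_of_isZero {X : CM R} (h : IsZero X) (x : X.obj) : x = 0 :=
  lin_congr (h.eq_of_src (𝟙 X) 0) x

lemma subsingleton_of_isZero {X : CM R} (h : IsZero X) : Subsingleton X.obj :=
  subsingleton_of_forall_eq 0 (eq_zero_of_isZero h)

lemma projective_of_isZero {X : CM R} (h : IsZero X) : Module.Projective Rᵐᵒᵖ X.obj := by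
  have := subsingleton_of_isZero h
  infer_instance

lemma surjective_of_isZero {X Y : CM R} (h : IsZero Y) (f : X ⟶ Y) :
    Function.Surjective (lin f) := by
  have := subsingleton_of_isZero h
  exact Function.surjective_to_subsingleton _

lemma bijective_of_isIso {X Y : CM R} (f : X ⟶ Y) [IsIso f] : Function.Bijective (lin f) :=
  Function.bijective_iff_has_inverse.2
    ⟨lin (inv f), lin_congr (IsIso.hom_inv_id f), lin_congr (IsIso.inv_hom_id f)⟩

lemma conflation_of_isZero_of_isIso {X Y Z : CM R} (hX : IsZero X) (f : X ⟶ Y) (g : Y ⟶ Z)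
    [IsIso g] : cmConflation R (ShortComplex.mk f g (hX.eq_of_src _ _)) := by
  have := subsingleton_of_isZero hX
  refine conflation_iff.2 ⟨Function.injective_of_subsingleton _, fun y ↦ ⟨fun hy ↦ ⟨0, ?_⟩, ?_⟩,
    (bijective_of_isIso g).2⟩
  · exact (map_zero _).trans ((map_eq_zero_iff _ (bijective_of_isIso g).1).1 hy).symm
  · rintro ⟨x, rfl⟩
    exact lin_congr (hX.eq_of_src (f ≫ g) 0) x

variable [IsNoetherianRing Rᵐᵒᵖ]

lemma exists_conflation_of_isInflation {X Y : CM R} {f : X ⟶ Y} (hf : IsInflation f) :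
    ∃ (Z : CM R) (p : Y ⟶ Z) (w : f ≫ p = 0), cmConflation R (ShortComplex.mk f p w) := by
  have := Y.property.1
  have hexact := LinearMap.exact_map_mkQ_range (lin f)
  have hsurj := (LinearMap.range (lin f)).mkQ_surjective
  let Z : CM R := ⟨ModuleCat.of Rᵐᵒᵖ (Y.obj ⧸ LinearMap.range (lin f)), isCM_of_finite
    (extVanishing_X₃ (shortExact_ofHom hf.1 hexact hsurj) X.property.2 Y.property.2 fun h ↦ by
      obtain ⟨k, hk⟩ := hf.2 h.hom
      exact ⟨ModuleCat.ofHom k, ModuleCat.hom_ext hk⟩)⟩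
  exact ⟨Z, ofLin (Y := Z) (LinearMap.range (lin f)).mkQ,
    hom_ext hexact.apply_apply_eq_zero, conflation_iff.2 ⟨hf.1, hexact, hsurj⟩⟩

lemma exists_conflation_of_surjective {X Y : CM R} {p : X ⟶ Y}
    (hp : Function.Surjective (lin p)) :
    ∃ (K : CM R) (i : K ⟶ X) (w : i ≫ p = 0), cmConflation R (ShortComplex.mk i p w) := by
  have := X.property.1
  have hinj := (LinearMap.ker (lin p)).injective_subtype
  have hexact := LinearMap.exact_subtype_ker_map (lin p)
  let K : CM R := ⟨ModuleCat.of Rᵐᵒᵖ (LinearMap.ker (lin p)), isCM_of_finite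
    (extVanishing_X₁ (shortExact_ofHom hinj hexact hp) X.property.2 Y.property.2)⟩
  exact ⟨K, ofLin (X := K) (LinearMap.ker (lin p)).subtype, hom_ext hexact.apply_apply_eq_zero,
    conflation_iff.2 ⟨hinj, hexact, hp⟩⟩

variable (R) in
/-- The Cohen-Macaulay module `R^n`. -/
def free (n : ℕ) : CM R := ⟨ModuleCat.of Rᵐᵒᵖ (Fin n → R), isCM_of_projective⟩

instance (n : ℕ) : Module.Projective Rᵐᵒᵖ (free R n).obj :=
  inferInstanceAs (Module.Projective Rᵐᵒᵖ (Fin n → R))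

lemma exists_surjective_free (X : CM R) :
    ∃ (n : ℕ) (p : free R n ⟶ X), Function.Surjective (lin p) := by
  obtain ⟨n, K, i, p, -, -, -, hp⟩ := exists_syzygy X.property
  exact ⟨n, ofLin (X := free R n) p, hp⟩

lemma relProjective_iff {X : CM R} :
    relProjective (cmConflation R) X ↔ Module.Projective Rᵐᵒᵖ X.obj := by
  refine ⟨fun hX ↦ ?_, fun hX S hS f ↦ exists_lift_of_projective hX (surjective_of_conflation hS) f⟩
  obtain ⟨n, p, hp⟩ := exists_surjective_free X
  obtain ⟨K, i, w, h⟩ := exists_conflation_of_surjective hp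
  obtain ⟨s, hs⟩ := hX _ h (𝟙 X)
  exact projective_of_retract hs

lemma IsInflation.exists_comp_eq {X Y P : CM R} {f : X ⟶ Y} (hf : IsInflation f)
    (hP : Module.Projective Rᵐᵒᵖ P.obj) (g : X ⟶ P) : ∃ h : Y ⟶ P, f ≫ h = g := by
  obtain ⟨n, p, hp⟩ := exists_surjective_free P
  obtain ⟨s, hsp⟩ := exists_lift_of_projective hP hp (𝟙 P)
  let gs : X.obj →ₗ[Rᵐᵒᵖ] (Fin n → R) := lin (g ≫ s)
  choose k hk using fun j ↦ hf.2 (LinearMap.proj j ∘ₗ gs)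
  have hks : f ≫ ofLin (Y := free R n) (LinearMap.pi k) = g ≫ s :=
    hom_ext fun x ↦ funext fun j ↦ LinearMap.congr_fun (hk j) x
  exact ⟨ofLin (Y := free R n) (LinearMap.pi k) ≫ p, by
    rw [reassoc_of% hks, hsp, Category.comp_id]⟩

lemma exists_isInflation_free [IsNoetherianRing R]
    (hinj : ∃ n, HasInjectiveDimensionLE (ModuleCat.of.{u} R R) n) (X : CM R) :
    ∃ (n : ℕ) (f : X ⟶ free R n), IsInflation f := by
  obtain ⟨n, f, hf⟩ := exists_injective_lcomp_surjective hinj X.property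
  exact ⟨n, ofLin (Y := free R n) f, hf⟩

theorem isFrobenius [IsNoetherianRing R]
    (hinj : ∃ n, HasInjectiveDimensionLE (ModuleCat.of.{u} R R) n) :
    IsFrobenius (cmConflation R) where
  mono_f := mono_of_conflation
  epi_g := epi_of_conflation
  exists_lift hS _ := exists_lift hS
  exists_desc hS _ := exists_desc hS
  exists_biprod {S} hS Y u := exists_conflation_of_isInflation <|
    .of_comp (g := biprod.fst) (by
      rw [biprod.lift_fst]
      exact isInflation_of_conflation hS)
  exists_comp {_ _ _ _ _ _ _ _ _ _ w₂₃} h₁₂ h₂₃ := by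
    obtain ⟨Z₁₃, g₁₃, w₁₃, h₁₃⟩ := exists_conflation_of_isInflation
      ((isInflation_of_conflation h₁₂).comp (isInflation_of_conflation h₂₃))
    obtain ⟨m₁, m₃, w, hm₁, hm₃⟩ := exists_homs_of_comp (epi_of_conflation h₁₂) (exists_desc h₁₂)
      (exists_desc h₁₃) w₁₃ w₂₃
    exact ⟨Z₁₃, g₁₃, w₁₃, m₁, m₃, w, h₁₃, conflation_of_comp w h₁₂ h₂₃ h₁₃ hm₁ hm₃, hm₁, hm₃⟩
  isPushout_of_isIso := isPushout_of_isIso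
  enough_injectives X := by
    obtain ⟨n, f, hf⟩ := exists_isInflation_free hinj X
    obtain ⟨Z, p, w, h⟩ := exists_conflation_of_isInflation hf
    exact ⟨_, Z, f, p, w, h, relProjective_iff.2 inferInstance⟩
  enough_projectives X := by
    obtain ⟨n, p, hp⟩ := exists_surjective_free X
    obtain ⟨K, i, w, h⟩ := exists_conflation_of_surjective hp
    exact ⟨_, K, i, p, w, h, relProjective_iff.2 inferInstance⟩
  relInjective_of_relProjective hX _ hS f :=
    (isInflation_of_conflation hS).exists_comp_eq (relProjective_iff.1 hX) f

instance projective_biprod (P Q : CM R)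
    [hP : Module.Projective Rᵐᵒᵖ P.obj] [hQ : Module.Projective Rᵐᵒᵖ Q.obj] :
    Module.Projective Rᵐᵒᵖ (P ⊞ Q).obj :=
  relProjective_iff.1 (relProjective_biprod (relProjective_iff.2 hP) (relProjective_iff.2 hQ))

end CM

/-! ### Surjections of Cohen-Macaulay modules -/

variable (R) in
/-- The category of surjective maps of Cohen-Macaulay modules. -/
abbrev MorE : Type _ := (isMorE R).FullSubcategory

namespace MorE

open CM

variable (R) in
/-- The functor that sends a surjective map of Cohen-Macaulay modules to its source. -/
def source : MorE R ⥤ CM R :=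
  ObjectProperty.lift _ ((isMorE R).ι ⋙ Arrow.leftFunc) fun α ↦ α.property.1

variable (R) in
/-- The functor that sends a surjective map of Cohen-Macaulay modules to its target. -/
def target : MorE R ⥤ CM R :=
  ObjectProperty.lift _ ((isMorE R).ι ⋙ Arrow.rightFunc) fun α ↦ α.property.2.1

instance : (source R).Additive where
  map_add := rfl

instance : (target R).Additive where
  map_add := rfl

/-- The surjective map that an object of `MorE R` consists of. -/
def toTarget (α : MorE R) : (source R).obj α ⟶ (target R).obj α := ObjectProperty.homMk α.obj.hom

lemma toTarget_surjective (α : MorE R) : Function.Surjective (lin (toTarget α)) :=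
  α.property.2.2

lemma toTarget_naturality {α β : MorE R} (f : α ⟶ β) :
    (source R).map f ≫ toTarget β = toTarget α ≫ (target R).map f :=
  ObjectProperty.hom_ext _ f.hom.w

/-- The object of `MorE R` given by a surjective map of Cohen-Macaulay modules. -/
abbrev mk {X T : CM R} (f : X ⟶ T) (hf : Function.Surjective (lin f)) : MorE R :=
  ⟨Arrow.mk f.hom, X.property, T.property, hf⟩

section HomMk

variable {α β : MorE R} (a : (source R).obj α ⟶ (source R).obj β)
  (b : (target R).obj α ⟶ (target R).obj β) (w : a ≫ toTarget β = toTarget α ≫ b)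

/-- The morphism of `MorE R` given by a commutative square. -/
def homMk : α ⟶ β :=
  ObjectProperty.homMk (Arrow.homMk a.hom b.hom ((isCM R).ι.congr_map w))

@[simp]
lemma source_map_homMk : (source R).map (homMk a b w) = a := rfl

@[simp]
lemma target_map_homMk : (target R).map (homMk a b w) = b := rfl

end HomMk

lemma hom_ext {α β : MorE R} {f g : α ⟶ β} (h₁ : (source R).map f = (source R).map g)
    (h₂ : (target R).map f = (target R).map g) : f = g :=
  ObjectProperty.hom_ext _
    (Arrow.hom_ext _ _ ((isCM R).ι.congr_map h₁) ((isCM R).ι.congr_map h₂))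

lemma mono_of_map {α β : MorE R} {f : α ⟶ β} (h₁ : Mono ((source R).map f))
    (h₂ : Mono ((target R).map f)) : Mono f :=
  ⟨fun a b h ↦ hom_ext
    (by rw [← cancel_mono ((source R).map f), ← Functor.map_comp, h, Functor.map_comp])
    (by rw [← cancel_mono ((target R).map f), ← Functor.map_comp, h, Functor.map_comp])⟩

lemma epi_of_map {α β : MorE R} {f : α ⟶ β} (h₁ : Epi ((source R).map f))
    (h₂ : Epi ((target R).map f)) : Epi f :=
  ⟨fun a b h ↦ hom_ext
    (by rw [← cancel_epi ((source R).map f), ← Functor.map_comp, h, Functor.map_comp])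
    (by rw [← cancel_epi ((target R).map f), ← Functor.map_comp, h, Functor.map_comp])⟩

lemma isPushout_of_map {α β γ δ : MorE R} {f : α ⟶ β} {g : α ⟶ γ} {i : β ⟶ δ} {j : γ ⟶ δ}
    (h₁ : IsPushout ((source R).map f) ((source R).map g) ((source R).map i) ((source R).map j))
    (h₂ : IsPushout ((target R).map f) ((target R).map g) ((target R).map i) ((target R).map j)) :
    IsPushout f g i j := by
  refine isPushout_of_exists_desc (hom_ext ?_ ?_) (fun T a b h ↦ ?_) fun T t hi hj ↦ hom_ext ?_ ?_
  · rw [Functor.map_comp, h₁.w, Functor.map_comp]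
  · rw [Functor.map_comp, h₂.w, Functor.map_comp]
  · have w₁ := (source R).congr_map h
    have w₂ := (target R).congr_map h
    rw [Functor.map_comp, Functor.map_comp] at w₁ w₂
    refine ⟨homMk (h₁.desc _ _ w₁) (h₂.desc _ _ w₂) (h₁.hom_ext ?_ ?_), hom_ext ?_ ?_,
      hom_ext ?_ ?_⟩
    · rw [h₁.inl_desc_assoc, reassoc_of% toTarget_naturality, h₂.inl_desc, toTarget_naturality]
    · rw [h₁.inr_desc_assoc, reassoc_of% toTarget_naturality, h₂.inr_desc, toTarget_naturality]
    · rw [Functor.map_comp, source_map_homMk, h₁.inl_desc]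
    · rw [Functor.map_comp, target_map_homMk, h₂.inl_desc]
    · rw [Functor.map_comp, source_map_homMk, h₁.inr_desc]
    · rw [Functor.map_comp, target_map_homMk, h₂.inr_desc]
  · apply h₁.hom_ext <;> rw [← Functor.map_comp] <;> simp [hi, hj]
  · apply h₂.hom_ext <;> rw [← Functor.map_comp] <;> simp [hi, hj]

lemma conflation_iff {α β γ : MorE R} {f : α ⟶ β} {g : β ⟶ γ} {w : f ≫ g = 0} :
    morEConflation R (ShortComplex.mk f g w) ↔
      cmConflation R (ShortComplex.mk ((source R).map f) ((source R).map g)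
        (by rw [← Functor.map_comp, w, Functor.map_zero])) ∧
      cmConflation R (ShortComplex.mk ((target R).map f) ((target R).map g)
        (by rw [← Functor.map_comp, w, Functor.map_zero])) := Iff.rfl

section Conflation

variable {α β γ : MorE R} {f : α ⟶ β} {g : β ⟶ γ} {w : f ≫ g = 0}
  (h : morEConflation R (ShortComplex.mk f g w))

include h

lemma mono_of_conflation : Mono f :=
  mono_of_map (CM.mono_of_conflation (conflation_iff.1 h).1)
    (CM.mono_of_conflation (conflation_iff.1 h).2)

lemma epi_of_conflation : Epi g :=
  epi_of_map (CM.epi_of_conflation (conflation_iff.1 h).1)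
    (CM.epi_of_conflation (conflation_iff.1 h).2)

lemma exists_desc {τ : MorE R} (t : β ⟶ τ) (ht : f ≫ t = 0) : ∃ s, g ≫ s = t := by
  obtain ⟨h₁, h₂⟩ := conflation_iff.1 h
  obtain ⟨a, ha⟩ := CM.exists_desc h₁ ((source R).map t) (by
    rw [← Functor.map_comp, ht, Functor.map_zero])
  obtain ⟨b, hb⟩ := CM.exists_desc h₂ ((target R).map t) (by
    rw [← Functor.map_comp, ht, Functor.map_zero])
  have := CM.epi_of_conflation h₁
  refine ⟨homMk a b ?_, hom_ext ?_ ?_⟩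
  · rw [← cancel_epi ((source R).map g), reassoc_of% ha, toTarget_naturality,
      reassoc_of% toTarget_naturality, hb]
  · rw [Functor.map_comp, source_map_homMk, ha]
  · rw [Functor.map_comp, target_map_homMk, hb]

lemma exists_lift {τ : MorE R} (t : τ ⟶ β) (ht : t ≫ g = 0) : ∃ s, s ≫ f = t := by
  obtain ⟨h₁, h₂⟩ := conflation_iff.1 h
  obtain ⟨a, ha⟩ := CM.exists_lift h₁ ((source R).map t) (by
    rw [← Functor.map_comp, ht, Functor.map_zero])
  obtain ⟨b, hb⟩ := CM.exists_lift h₂ ((target R).map t) (by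
    rw [← Functor.map_comp, ht, Functor.map_zero])
  have := CM.mono_of_conflation h₂
  refine ⟨homMk a b ?_, hom_ext ?_ ?_⟩
  · rw [← cancel_mono ((target R).map f), Category.assoc, ← toTarget_naturality, reassoc_of% ha,
      toTarget_naturality, Category.assoc, hb]
  · rw [Functor.map_comp, source_map_homMk, ha]
  · rw [Functor.map_comp, target_map_homMk, hb]

end Conflation

lemma isPushout_of_isIso {S S' : ShortComplex (MorE R)} (hS : morEConflation R S)
    (hS' : morEConflation R S') (φ : S ⟶ S') (hφ : IsIso φ.τ₃) : IsPushout S.f φ.τ₁ φ.τ₂ S'.f := by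
  obtain ⟨hs, ht⟩ := conflation_iff.1 hS
  obtain ⟨hs', ht'⟩ := conflation_iff.1 hS'
  exact isPushout_of_map
    (CM.isPushout_of_isIso hs hs' ((source R).mapShortComplex.map φ)
      (inferInstanceAs (IsIso ((source R).map φ.τ₃))))
    (CM.isPushout_of_isIso ht ht' ((target R).mapShortComplex.map φ)
      (inferInstanceAs (IsIso ((target R).map φ.τ₃))))

lemma exists_lift_of_projective {S : ShortComplex (MorE R)} (hS : morEConflation R S) {α : MorE R}
    (h₁ : Module.Projective Rᵐᵒᵖ ((source R).obj α).obj)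
    (h₂ : Module.Projective Rᵐᵒᵖ ((target R).obj α).obj) (f : α ⟶ S.X₃) :
    ∃ g : α ⟶ S.X₂, g ≫ S.g = f := by
  obtain ⟨hs, ht⟩ := conflation_iff.1 hS
  obtain ⟨a, ha⟩ := CM.exists_lift_of_projective h₁ (surjective_of_conflation hs)
    ((source R).map f)
  obtain ⟨b, hb⟩ := CM.exists_lift_of_projective h₂ (surjective_of_conflation ht)
    ((target R).map f)
  obtain ⟨d, hd⟩ := CM.exists_lift ht (toTarget α ≫ b - a ≫ toTarget S.X₂) (by
    rw [Preadditive.sub_comp, Category.assoc, hb, Category.assoc, ← toTarget_naturality f,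
      ← toTarget_naturality S.g, reassoc_of% ha, sub_self])
  obtain ⟨e, he⟩ := CM.exists_lift_of_projective h₁ (toTarget_surjective S.X₁) d
  refine ⟨homMk (a + e ≫ (source R).map S.f) b ?_, hom_ext ?_ ?_⟩
  · rw [Preadditive.add_comp, Category.assoc, toTarget_naturality, reassoc_of% he, hd,
      add_sub_cancel]
  · rw [Functor.map_comp, source_map_homMk, Preadditive.add_comp, ha, Category.assoc,
      ← Functor.map_comp, S.zero, Functor.map_zero, comp_zero, add_zero]
  · rw [Functor.map_comp, target_map_homMk, hb]

section Noetherian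

variable [IsNoetherianRing Rᵐᵒᵖ]

lemma exists_conflation_of_isInflation {α β : MorE R} {f : α ⟶ β}
    (h₁ : IsInflation ((source R).map f)) (h₂ : IsInflation ((target R).map f)) :
    ∃ (γ : MorE R) (p : β ⟶ γ) (w : f ≫ p = 0), morEConflation R (ShortComplex.mk f p w) := by
  obtain ⟨Z₁, p₁, w₁, c₁⟩ := CM.exists_conflation_of_isInflation h₁
  obtain ⟨Z₂, p₂, w₂, c₂⟩ := CM.exists_conflation_of_isInflation h₂
  obtain ⟨z, hz⟩ := CM.exists_desc c₁ (toTarget β ≫ p₂) (by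
    rw [reassoc_of% toTarget_naturality, w₂, comp_zero])
  have hz_surj : Function.Surjective (lin (p₁ ≫ z)) := by
    rw [hz]
    exact (surjective_of_conflation c₂).comp (toTarget_surjective β)
  exact ⟨mk z (.of_comp (g := lin p₁) hz_surj), homMk (β := mk z _) p₁ p₂ hz, hom_ext w₁ w₂,
    c₁, c₂⟩

lemma exists_conflation_of_surjective {β α : MorE R} {p : β ⟶ α}
    (h₁ : Function.Surjective (lin ((source R).map p)))
    (h₂ : Function.Surjective (lin ((target R).map p)))
    (h : ∀ z, lin ((target R).map p) z = 0 →
      ∃ x, lin ((source R).map p) x = 0 ∧ lin (toTarget β) x = z) :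
    ∃ (κ : MorE R) (i : κ ⟶ β) (w : i ≫ p = 0), morEConflation R (ShortComplex.mk i p w) := by
  obtain ⟨K₁, i₁, w₁, c₁⟩ := CM.exists_conflation_of_surjective h₁
  obtain ⟨K₂, i₂, w₂, c₂⟩ := CM.exists_conflation_of_surjective h₂
  obtain ⟨k, hk⟩ := CM.exists_lift c₂ (i₁ ≫ toTarget β) (by
    rw [Category.assoc, ← toTarget_naturality, reassoc_of% w₁, zero_comp])
  have hk_surj : Function.Surjective (lin k) := fun z ↦ by
    obtain ⟨x, hx, hxz⟩ := h (lin i₂ z) (lin_congr w₂ z)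
    obtain ⟨y, rfl⟩ := (exact_of_conflation c₁ x).1 hx
    exact ⟨y, injective_of_conflation c₂ ((lin_congr hk y).trans hxz)⟩
  exact ⟨mk k hk_surj, homMk (α := mk k hk_surj) i₁ i₂ hk.symm, hom_ext w₁ w₂, c₁, c₂⟩

lemma exists_conflation_of_free (α : MorE R) :
    ∃ (β κ : MorE R) (i : κ ⟶ β) (p : β ⟶ α) (w : i ≫ p = 0),
      morEConflation R (ShortComplex.mk i p w) ∧
      Module.Projective Rᵐᵒᵖ ((source R).obj β).obj ∧
      Module.Projective Rᵐᵒᵖ ((target R).obj β).obj := by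
  obtain ⟨K, i, w, hK⟩ := CM.exists_conflation_of_surjective (toTarget_surjective α)
  obtain ⟨n, p, hp⟩ := exists_surjective_free ((source R).obj α)
  obtain ⟨m, q, hq⟩ := exists_surjective_free K
  let β : MorE R := mk (biprod.fst : free R n ⊞ free R m ⟶ free R n)
    (surjective_of_section biprod.inl_fst)
  let π : β ⟶ α := homMk (α := β) (biprod.desc p (q ≫ i)) (p ≫ toTarget α) <| by
    change biprod.desc p (q ≫ i) ≫ toTarget α = biprod.fst ≫ p ≫ toTarget α
    apply biprod.hom_ext' <;> simp [w]
  have hπ : Function.Surjective (lin (biprod.inl ≫ biprod.desc p (q ≫ i))) := by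
    rwa [biprod.inl_desc]
  obtain ⟨κ, j, w, h⟩ := exists_conflation_of_surjective (p := π)
    (.of_comp (g := lin biprod.inl) hπ) ((toTarget_surjective α).comp hp) fun z hz ↦ by
      obtain ⟨y, hy⟩ := (exact_of_conflation hK _).1 hz
      obtain ⟨y, rfl⟩ := hq y
      have hpz := lin_congr (biprod.inl_desc p (q ≫ i)) z
      have hqy := lin_congr (biprod.inr_desc p (q ≫ i)) y
      refine ⟨lin (biprod.inl : free R n ⟶ free R n ⊞ free R m) z -
        lin (biprod.inr : free R m ⟶ free R n ⊞ free R m) y, ?_, ?_⟩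
      · exact (map_sub _ _ _).trans (sub_eq_zero.2 (hpz.trans (hy.symm.trans hqy.symm)))
      · exact (map_sub _ _ _).trans <| (congrArg₂ (· - ·) (lin_congr biprod.inl_fst z)
          (lin_congr biprod.inr_fst y)).trans (sub_zero _)
  exact ⟨β, κ, j, π, w, h, CM.projective_biprod _ _,
    inferInstanceAs (Module.Projective Rᵐᵒᵖ (free R n).obj)⟩

lemma relProjective_iff {α : MorE R} : relProjective (morEConflation R) α ↔
    Module.Projective Rᵐᵒᵖ ((source R).obj α).obj ∧
      Module.Projective Rᵐᵒᵖ ((target R).obj α).obj := by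
  refine ⟨fun hα ↦ ?_, fun h _ hS f ↦ exists_lift_of_projective hS h.1 h.2 f⟩
  obtain ⟨β, κ, i, p, w, h, h₁, h₂⟩ := exists_conflation_of_free α
  obtain ⟨s, hs⟩ := hα _ h (𝟙 α)
  exact ⟨projective_of_retract (Functor.map_comp .. |>.symm.trans <| (source R).congr_map hs),
    projective_of_retract (Functor.map_comp .. |>.symm.trans <| (target R).congr_map hs)⟩

lemma exists_comp_eq_of_projective {S : ShortComplex (MorE R)} (hS : morEConflation R S)
    {α : MorE R} (h₁ : Module.Projective Rᵐᵒᵖ ((source R).obj α).obj)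
    (h₂ : Module.Projective Rᵐᵒᵖ ((target R).obj α).obj) (f : S.X₁ ⟶ α) :
    ∃ g : S.X₂ ⟶ α, S.f ≫ g = f := by
  obtain ⟨hs, ht⟩ := conflation_iff.1 hS
  obtain ⟨a, ha⟩ := (isInflation_of_conflation hs).exists_comp_eq h₁ ((source R).map f)
  obtain ⟨b, hb⟩ := (isInflation_of_conflation ht).exists_comp_eq h₂ ((target R).map f)
  obtain ⟨s, hs⟩ := CM.exists_lift_of_projective h₂ (toTarget_surjective α) (𝟙 _)
  refine ⟨homMk (a + (toTarget S.X₂ ≫ b - a ≫ toTarget α) ≫ s) b ?_, hom_ext ?_ ?_⟩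
  · rw [Preadditive.add_comp, Category.assoc, hs, Category.comp_id, add_sub_cancel]
  · rw [Functor.map_comp, source_map_homMk, Preadditive.comp_add, ha, ← Category.assoc,
      Preadditive.comp_sub, reassoc_of% toTarget_naturality, hb, reassoc_of% ha,
      toTarget_naturality, sub_self, zero_comp, add_zero]
  · rw [Functor.map_comp, target_map_homMk, hb]

lemma exists_conflation_to_free [IsNoetherianRing R]
    (hinj : ∃ n, HasInjectiveDimensionLE (ModuleCat.of.{u} R R) n) (α : MorE R) :
    ∃ (β γ : MorE R) (i : α ⟶ β) (p : β ⟶ γ) (w : i ≫ p = 0),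
      morEConflation R (ShortComplex.mk i p w) ∧
      Module.Projective Rᵐᵒᵖ ((source R).obj β).obj ∧
      Module.Projective Rᵐᵒᵖ ((target R).obj β).obj := by
  obtain ⟨n, f, hf⟩ := exists_isInflation_free hinj ((source R).obj α)
  obtain ⟨m, g, hg⟩ := exists_isInflation_free hinj ((target R).obj α)
  let β : MorE R := mk (biprod.snd : free R n ⊞ free R m ⟶ free R m)
    (surjective_of_section biprod.inr_snd)
  let i : α ⟶ β := homMk (β := β) (biprod.lift f (toTarget α ≫ g)) g (biprod.lift_snd _ _)
  have hi : IsInflation (biprod.lift f (toTarget α ≫ g)) :=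
    .of_comp (g := biprod.fst) (by rwa [biprod.lift_fst])
  obtain ⟨γ, p, w, h⟩ := exists_conflation_of_isInflation (f := i) hi hg
  exact ⟨β, γ, i, p, w, h, CM.projective_biprod _ _,
    inferInstanceAs (Module.Projective Rᵐᵒᵖ (free R m).obj)⟩

lemma exists_conflation_comp {α₁ α₂ α₃ ζ₁₂ ζ₂₃ : MorE R} {f₁₂ : α₁ ⟶ α₂} {g₁₂ : α₂ ⟶ ζ₁₂}
    {w₁₂ : f₁₂ ≫ g₁₂ = 0} {f₂₃ : α₂ ⟶ α₃} {g₂₃ : α₃ ⟶ ζ₂₃} {w₂₃ : f₂₃ ≫ g₂₃ = 0}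
    (h₁₂ : morEConflation R (ShortComplex.mk f₁₂ g₁₂ w₁₂))
    (h₂₃ : morEConflation R (ShortComplex.mk f₂₃ g₂₃ w₂₃)) :
    ∃ (ζ₁₃ : MorE R) (g₁₃ : α₃ ⟶ ζ₁₃) (w₁₃ : (f₁₂ ≫ f₂₃) ≫ g₁₃ = 0) (m₁ : ζ₁₂ ⟶ ζ₁₃)
      (m₃ : ζ₁₃ ⟶ ζ₂₃) (w : m₁ ≫ m₃ = 0),
      morEConflation R (ShortComplex.mk (f₁₂ ≫ f₂₃) g₁₃ w₁₃) ∧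
      morEConflation R (ShortComplex.mk m₁ m₃ w) ∧
      g₁₂ ≫ m₁ = f₂₃ ≫ g₁₃ ∧ g₁₃ ≫ m₃ = g₂₃ := by
  obtain ⟨hs₁₂, ht₁₂⟩ := conflation_iff.1 h₁₂
  obtain ⟨hs₂₃, ht₂₃⟩ := conflation_iff.1 h₂₃
  obtain ⟨ζ₁₃, g₁₃, w₁₃, h₁₃⟩ := exists_conflation_of_isInflation (f := f₁₂ ≫ f₂₃)
    ((isInflation_of_conflation hs₁₂).comp (isInflation_of_conflation hs₂₃))
    ((isInflation_of_conflation ht₁₂).comp (isInflation_of_conflation ht₂₃))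
  obtain ⟨hs₁₃, ht₁₃⟩ := conflation_iff.1 h₁₃
  obtain ⟨m₁, m₃, w, hm₁, hm₃⟩ := exists_homs_of_comp (epi_of_conflation h₁₂) (exists_desc h₁₂)
    (exists_desc h₁₃) w₁₃ w₂₃
  exact ⟨ζ₁₃, g₁₃, w₁₃, m₁, m₃, w, h₁₃, conflation_iff.2
    ⟨conflation_of_comp _ hs₁₂ hs₂₃ hs₁₃ (congrArg (source R).map hm₁)
        (congrArg (source R).map hm₃),
      conflation_of_comp _ ht₁₂ ht₂₃ ht₁₃ (congrArg (target R).map hm₁)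
        (congrArg (target R).map hm₃)⟩, hm₁, hm₃⟩

theorem isFrobenius [IsNoetherianRing R]
    (hinj : ∃ n, HasInjectiveDimensionLE (ModuleCat.of.{u} R R) n) :
    IsFrobenius (morEConflation R) where
  mono_f := mono_of_conflation
  epi_g := epi_of_conflation
  exists_lift hS _ := exists_lift hS
  exists_desc hS _ := exists_desc hS
  exists_biprod hS Y u := by
    apply exists_conflation_of_isInflation
    · apply IsInflation.of_comp (g := (source R).map biprod.fst)
      rw [← Functor.map_comp, biprod.lift_fst]
      exact isInflation_of_conflation (conflation_iff.1 hS).1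
    · apply IsInflation.of_comp (g := (target R).map biprod.fst)
      rw [← Functor.map_comp, biprod.lift_fst]
      exact isInflation_of_conflation (conflation_iff.1 hS).2
  exists_comp := exists_conflation_comp
  isPushout_of_isIso := isPushout_of_isIso
  enough_injectives α := by
    obtain ⟨β, γ, i, p, w, h, hβ⟩ := exists_conflation_to_free hinj α
    exact ⟨β, γ, i, p, w, h, relProjective_iff.2 hβ⟩
  enough_projectives α := by
    obtain ⟨β, κ, i, p, w, h, hβ⟩ := exists_conflation_of_free α
    exact ⟨β, κ, i, p, w, h, relProjective_iff.2 hβ⟩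
  relInjective_of_relProjective hα _ hS f :=
    exists_comp_eq_of_projective hS (relProjective_iff.1 hα).1 (relProjective_iff.1 hα).2 f

end Noetherian

/-- The object `X ⟶ 0` of `MorE R`. -/
noncomputable abbrev toZero (X : CM R) : MorE R :=
  mk (0 : X ⟶ 0) (surjective_of_isZero (isZero_zero _) _)

/-- The object `T ⟶ T` of `MorE R`. -/
abbrev ofId (T : CM R) : MorE R := mk (𝟙 T) Function.surjective_id

lemma isZero_target {α : MorE R} (h : IsZero α.obj.right) : IsZero ((target R).obj α) :=
  IsZero.of_full_of_faithful_of_isZero (isCM R).ι _ h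

lemma isZero_toZero_right (X : CM R) : IsZero (toZero X).obj.right :=
  (isCM R).ι.map_isZero (isZero_zero (CM R))

lemma exists_iso_ofId (T : CM R) :
    ∃ M : ModuleCat.{u} Rᵐᵒᵖ, Nonempty ((ofId T).obj ≅ Arrow.mk (𝟙 M)) :=
  ⟨T.obj, ⟨Iso.refl _⟩⟩

lemma isIso_toTarget {α : MorE R}
    (h : ∃ T : ModuleCat.{u} Rᵐᵒᵖ, Nonempty (α.obj ≅ Arrow.mk (𝟙 T))) : IsIso (toTarget α) := by
  obtain ⟨T, ⟨e⟩⟩ := h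
  have hw : e.hom.left = α.obj.hom ≫ e.hom.right := (Category.comp_id _).symm.trans e.hom.w
  have : IsIso (α.obj.hom ≫ e.hom.right) := hw ▸ inferInstanceAs (IsIso e.hom.left)
  have : IsIso ((isCM R).ι.map (toTarget α)) := IsIso.of_isIso_comp_right α.obj.hom e.hom.right
  exact isIso_of_fully_faithful (isCM R).ι (toTarget α)

section Conflations

variable [IsNoetherianRing Rᵐᵒᵖ]

lemma exists_conflation_toZero {α β : MorE R} (p : β ⟶ α)
    (h₁ : Function.Surjective (lin ((source R).map p))) [IsIso ((target R).map p)] :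
    ∃ (K : CM R) (i : toZero K ⟶ β) (w : i ≫ p = 0),
      morEConflation R (ShortComplex.mk i p w) := by
  obtain ⟨K, k, w, h⟩ := CM.exists_conflation_of_surjective h₁
  have hk : k ≫ toTarget β = 0 := by
    rw [← cancel_mono ((target R).map p), Category.assoc, ← toTarget_naturality, reassoc_of% w,
      zero_comp, zero_comp]
  exact ⟨K, homMk (α := toZero K) k (0 : (0 : CM R) ⟶ _) (hk.trans comp_zero.symm),
    hom_ext w ((isZero_zero _).eq_of_src _ _), h,
    conflation_of_isZero_of_isIso (isZero_zero _) _ ((target R).map p)⟩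

lemma exists_conflation_toZero_ofId (α : MorE R) :
    ∃ (K : CM R) (i : toZero K ⟶ α) (p : α ⟶ ofId ((target R).obj α)) (w : i ≫ p = 0),
      morEConflation R (ShortComplex.mk i p w) := by
  let p : α ⟶ ofId ((target R).obj α) :=
    homMk (β := ofId ((target R).obj α)) (toTarget α) (𝟙 _) rfl
  have : IsIso ((target R).map p) := IsIso.id _
  obtain ⟨K, i, w, h⟩ := exists_conflation_toZero p (toTarget_surjective α)
  exact ⟨K, i, p, w, h⟩

lemma exists_conflation_toZero_free (α : MorE R) :
    ∃ (K : CM R) (β : MorE R) (i : toZero K ⟶ β) (p : β ⟶ α) (w : i ≫ p = 0),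
      morEConflation R (ShortComplex.mk i p w) ∧
      Module.Projective Rᵐᵒᵖ ((source R).obj β).obj := by
  obtain ⟨n, f, hf⟩ := exists_surjective_free ((source R).obj α)
  let β : MorE R := mk (f ≫ toTarget α) ((toTarget_surjective α).comp hf)
  let p : β ⟶ α := homMk (α := β) f (𝟙 _) (Category.comp_id _).symm
  have : IsIso ((target R).map p) := IsIso.id _
  obtain ⟨K, i, w, h⟩ := exists_conflation_toZero p hf
  exact ⟨K, β, i, p, w, h, inferInstanceAs (Module.Projective Rᵐᵒᵖ (free R n).obj)⟩

lemma exists_conflation_free_ofId [IsNoetherianRing R]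
    (hinj : ∃ n, HasInjectiveDimensionLE (ModuleCat.of.{u} R R) n) (α : MorE R) :
    ∃ (β : MorE R) (T : CM R) (i : α ⟶ β) (p : β ⟶ ofId T) (w : i ≫ p = 0),
      morEConflation R (ShortComplex.mk i p w) ∧
      Module.Projective Rᵐᵒᵖ ((source R).obj β).obj := by
  obtain ⟨n, f, hf⟩ := exists_isInflation_free hinj ((source R).obj α)
  obtain ⟨T, g, w, h⟩ := CM.exists_conflation_of_isInflation hf
  obtain ⟨K, k, w', h'⟩ := CM.exists_conflation_of_surjective (toTarget_surjective α)
  obtain ⟨S, s, ws, m₁, m₃, wm, hs, hm, hm₁, hm₃⟩ := (CM.isFrobenius hinj).exists_comp h' h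
  let β : MorE R := mk s (surjective_of_conflation hs)
  exact ⟨β, T, homMk (β := β) f m₁ hm₁.symm,
    homMk (α := β) (β := ofId T) g m₃ ((Category.comp_id _).trans hm₃.symm), hom_ext w wm, ⟨h, hm⟩,
    inferInstanceAs (Module.Projective Rᵐᵒᵖ (free R n).obj)⟩

end Conflations

section StableVanishing

variable [IsNoetherianRing Rᵐᵒᵖ] {α β : MorE R} {f : α ⟶ β}

lemma toStable_map_eq_zero_of_isZero_target (hβ : IsZero ((target R).obj β))
    (hf : (toStable (cmConflation R)).map ((source R).map f) = 0) :
    (toStable (morEConflation R)).map f = 0 := by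
  obtain ⟨Q, hQ, a, b, hab⟩ := (toStable_map_eq_zero_iff _).1 hf
  exact (toStable_map_eq_zero_iff f).2 ⟨toZero Q,
    relProjective_iff.2 ⟨CM.relProjective_iff.1 hQ, projective_of_isZero (isZero_zero _)⟩,
    homMk (β := toZero Q) a 0 ((isZero_zero _).eq_of_tgt _ _),
    homMk (α := toZero Q) b 0 (hβ.eq_of_tgt _ _), hom_ext hab (hβ.eq_of_tgt _ _)⟩

lemma toStable_map_eq_zero_of_isIso_toTarget_right [IsIso (toTarget β)]
    (hf : (toStable (cmConflation R)).map ((target R).map f) = 0) :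
    (toStable (morEConflation R)).map f = 0 := by
  obtain ⟨Q, hQ, a, b, hab⟩ := (toStable_map_eq_zero_iff _).1 hf
  have hQ' := CM.relProjective_iff.1 hQ
  have hb : (b ≫ inv (toTarget β)) ≫ toTarget β = 𝟙 Q ≫ b := by simp
  have hf : (source R).map f = (toTarget α ≫ a) ≫ b ≫ inv (toTarget β) := by
    simp [← cancel_mono (toTarget β), toTarget_naturality, hab]
  exact (toStable_map_eq_zero_iff f).2 ⟨ofId Q, relProjective_iff.2 ⟨hQ', hQ'⟩,
    homMk (β := ofId Q) (toTarget α ≫ a) a (Category.comp_id _),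
    homMk (α := ofId Q) (b ≫ inv (toTarget β)) b hb, hom_ext hf hab⟩

lemma toStable_map_eq_zero_of_isIso_toTarget_left [IsIso (toTarget α)]
    (hf : (toStable (cmConflation R)).map ((source R).map f) = 0) :
    (toStable (morEConflation R)).map f = 0 := by
  obtain ⟨Q, hQ, a, b, hab⟩ := (toStable_map_eq_zero_iff _).1 hf
  have hQ' := CM.relProjective_iff.1 hQ
  have ha : a ≫ 𝟙 Q = toTarget α ≫ inv (toTarget α) ≫ a := by simp
  have hf : (target R).map f = (inv (toTarget α) ≫ a) ≫ b ≫ toTarget β := by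
    rw [← cancel_epi (toTarget α), ← toTarget_naturality, hab]
    simp
  exact (toStable_map_eq_zero_iff f).2 ⟨ofId Q, relProjective_iff.2 ⟨hQ', hQ'⟩,
    homMk (β := ofId Q) a (inv (toTarget α) ≫ a) ha,
    homMk (α := ofId Q) b (b ≫ toTarget β) (Category.id_comp _).symm, hom_ext hab hf⟩

lemma toStable_map_eq_zero_of_projective_source
    (hα : Module.Projective Rᵐᵒᵖ ((source R).obj α).obj)
    (hf : (toStable (cmConflation R)).map ((target R).map f) = 0) :
    (toStable (morEConflation R)).map f = 0 := by
  obtain ⟨Q, hQ, a, b, hab⟩ := (toStable_map_eq_zero_iff _).1 hf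
  have hQ' := CM.relProjective_iff.1 hQ
  obtain ⟨c, hc⟩ := CM.exists_lift_of_projective hQ' (toTarget_surjective β) b
  let γ : MorE R := mk (biprod.fst : Q ⊞ (source R).obj α ⟶ Q)
    (surjective_of_section biprod.inl_fst)
  let i : α ⟶ γ := homMk (β := γ) (biprod.lift (toTarget α ≫ a) (𝟙 _)) a (biprod.lift_fst _ _)
  let p : γ ⟶ β := homMk (α := γ) (biprod.desc c ((source R).map f - toTarget α ≫ a ≫ c)) b <| by
    change biprod.desc c ((source R).map f - toTarget α ≫ a ≫ c) ≫ toTarget β = biprod.fst ≫ b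
    apply biprod.hom_ext' <;> simp [hc, toTarget_naturality, hab]
  refine (toStable_map_eq_zero_iff f).2 ⟨γ,
    relProjective_iff.2 ⟨CM.projective_biprod _ _, hQ'⟩, i, p, hom_ext ?_ hab⟩
  change (source R).map f = biprod.lift (toTarget α ≫ a) (𝟙 _) ≫
    biprod.desc c ((source R).map f - toTarget α ≫ a ≫ c)
  simp [biprod.lift_desc]

lemma hom_eq_zero_mor01_mor10 ⦃X Y : StableMorE R⦄ (hX : mor01 R X) (hY : mor10 R Y)
    (f : X ⟶ Y) : f = 0 :=
  hom_eq_zero_of_models (fun α β hα hβ f ↦ toStable_map_eq_zero_of_projective_source hα <| by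
    rw [(isZero_target hβ).eq_of_tgt ((target R).map f) 0, Functor.map_zero]) hX hY f

lemma hom_eq_zero_mor10_mor11 ⦃X Y : StableMorE R⦄ (hX : mor10 R X) (hY : mor11 R Y)
    (f : X ⟶ Y) : f = 0 :=
  hom_eq_zero_of_models (fun α β hα hβ f ↦
    have := isIso_toTarget hβ
    toStable_map_eq_zero_of_isIso_toTarget_right <| by
      rw [(isZero_target hα).eq_of_src ((target R).map f) 0, Functor.map_zero]) hX hY f

lemma hom_eq_zero_mor11_mor01 ⦃X Y : StableMorE R⦄ (hX : mor11 R X) (hY : mor01 R Y)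
    (f : X ⟶ Y) : f = 0 :=
  hom_eq_zero_of_models (fun _ β hα hβ _ ↦
    have := isIso_toTarget hα
    toStable_map_eq_zero_of_isIso_toTarget_left <|
      (isZero_toStable_obj (CM.relProjective_iff (X := (source R).obj β).2 hβ)).eq_of_tgt _ _)
    hX hY f

end StableVanishing

instance : (mor01 R).IsClosedUnderIsomorphisms := by unfold mor01; infer_instance

instance : (mor10 R).IsClosedUnderIsomorphisms := by unfold mor10; infer_instance

instance : (mor11 R).IsClosedUnderIsomorphisms := by unfold mor11; infer_instance

section StableFunctors

variable [IsNoetherianRing Rᵐᵒᵖ]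

lemma relProjective_source ⦃α : MorE R⦄ (h : relProjective (morEConflation R) α) :
    relProjective (cmConflation R) ((source R).obj α) :=
  CM.relProjective_iff.2 (relProjective_iff.1 h).1

lemma relProjective_target ⦃α : MorE R⦄ (h : relProjective (morEConflation R) α) :
    relProjective (cmConflation R) ((target R).obj α) :=
  CM.relProjective_iff.2 (relProjective_iff.1 h).2

variable (R) in
/-- The functor `(X ⟶ T) ↦ X` between the stable categories. -/
abbrev stableSource : StableMorE R ⥤ StableCM R :=
  stableFunctor (source R) relProjective_source

variable (R) in
/-- The functor `(X ⟶ T) ↦ T` between the stable categories. -/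
abbrev stableTarget : StableMorE R ⥤ StableCM R :=
  stableFunctor (target R) relProjective_target

variable (R) in
lemma mor01_eq_kernel : mor01 R = (stableSource R).kernel := by
  ext X
  constructor
  · rintro ⟨α, hα, ⟨e⟩⟩
    exact (isZero_toStable_obj (CM.relProjective_iff (X := (source R).obj α).2 hα)).of_iso
      ((stableSource R).mapIso e.symm)
  · intro hX
    obtain ⟨α⟩ := X
    exact ⟨α, CM.relProjective_iff (X := (source R).obj α).1 (relProjective_of_isZero hX),
      ⟨Iso.refl _⟩⟩

lemma mor10_eq_kernel [IsNoetherianRing R] [StableTriangulation (morEConflation R)]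
    (hinj : ∃ n, HasInjectiveDimensionLE (ModuleCat.of.{u} R R) n) :
    mor10 R = (stableTarget R).kernel := by
  ext X
  constructor
  · rintro ⟨α, hα, ⟨e⟩⟩
    exact ((toStable (cmConflation R)).map_isZero (isZero_target hα)).of_iso
      ((stableTarget R).mapIso e.symm)
  · intro hX
    obtain ⟨α⟩ := X
    obtain ⟨K, i, p, w, h⟩ := exists_conflation_toZero_ofId α
    have hα : Module.Projective Rᵐᵒᵖ ((target R).obj α).obj :=
      CM.relProjective_iff.1 (relProjective_of_isZero hX)
    have h₃ : IsZero ((toStable (morEConflation R)).obj (ofId ((target R).obj α))) :=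
      isZero_toStable_obj (relProjective_iff.2 ⟨hα, hα⟩)
    have : IsIso ((toStable (morEConflation R)).map i) :=
      (Triangle.isZero₃_iff_isIso₁ _ (tri_distinguished (isFrobenius hinj) h)).1 h₃
    exact ⟨toZero K, isZero_toZero_right K, ⟨asIso ((toStable (morEConflation R)).map i)⟩⟩

end StableFunctors

section StableTStructures

variable [IsNoetherianRing R] [IsNoetherianRing Rᵐᵒᵖ] [StableTriangulation (morEConflation R)]
  (hinj : ∃ n, HasInjectiveDimensionLE (ModuleCat.of.{u} R R) n)

include hinj

theorem isStableTStructure_mor01_mor10 [(mor01 R).IsStableUnderShift ℤ]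
    [(mor10 R).IsStableUnderShift ℤ] : IsStableTStructure (mor01 R) (mor10 R) := by
  refine isStableTStructure_of_exists_triangle hom_eq_zero_mor01_mor10 fun ⟨α⟩ ↦ ?_
  obtain ⟨K, β, i, p, w, h, hβ⟩ := exists_conflation_toZero_free α
  exact ⟨_, _, ⟨β, hβ, ⟨Iso.refl _⟩⟩,
    (mor10 R).le_shift (1 : ℤ) _ ⟨toZero K, isZero_toZero_right K, ⟨Iso.refl _⟩⟩, _, _, _,
    rot_of_distTriang _ (tri_distinguished (isFrobenius hinj) h)⟩

theorem isStableTStructure_mor10_mor11 [(mor10 R).IsStableUnderShift ℤ] :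
    IsStableTStructure (mor10 R) (mor11 R) := by
  refine isStableTStructure_of_exists_triangle hom_eq_zero_mor10_mor11 fun ⟨α⟩ ↦ ?_
  obtain ⟨K, i, p, w, h⟩ := exists_conflation_toZero_ofId α
  exact ⟨_, _, ⟨toZero K, isZero_toZero_right K, ⟨Iso.refl _⟩⟩,
    ⟨ofId _, exists_iso_ofId _, ⟨Iso.refl _⟩⟩, _, _, _, tri_distinguished (isFrobenius hinj) h⟩

theorem isStableTStructure_mor11_mor01 [(mor11 R).IsStableUnderShift ℤ] :
    IsStableTStructure (mor11 R) (mor01 R) := by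
  refine isStableTStructure_of_exists_triangle hom_eq_zero_mor11_mor01 fun ⟨α⟩ ↦ ?_
  obtain ⟨β, T, i, p, w, h, hβ⟩ := exists_conflation_free_ofId hinj α
  exact ⟨_, _, (mor11 R).le_shift (-1 : ℤ) _ ⟨ofId T, exists_iso_ofId T, ⟨Iso.refl _⟩⟩,
    ⟨β, hβ, ⟨Iso.refl _⟩⟩, _, _, _,
    inv_rot_of_distTriang _ (tri_distinguished (isFrobenius hinj) h)⟩

end StableTStructures

section Equivalences

variable [StableTriangulation (cmConflation R)] [StableTriangulation (morEConflation R)]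
  [IsNoetherianRing Rᵐᵒᵖ]

theorem triangleEquivalent_mor10 [h : (mor10 R).IsTriangulated] [(stableSource R).CommShift ℤ]
    [(stableSource R).IsTriangulated] :
    TriangleEquivalent (StableCM R) (mor10 R).FullSubcategory := by
  unfold mor10 at h ⊢
  refine triangleEquivalent_of_models (stableSource R) (fun α β _ hβ g ↦ ?_)
    (fun α β _ hβ f hf ↦ ?_)
    fun ⟨X⟩ ↦ ⟨toZero X, isZero_toZero_right X, ⟨Iso.refl _⟩⟩
  · obtain ⟨g, rfl⟩ := (toStable (cmConflation R)).map_surjective (X := (source R).obj α)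
      (Y := (source R).obj β) g
    exact ⟨(toStable _).map (homMk g 0 ((isZero_target hβ).eq_of_tgt _ _)), rfl⟩
  · obtain ⟨f, rfl⟩ := (toStable (morEConflation R)).map_surjective f
    exact toStable_map_eq_zero_of_isZero_target (isZero_target hβ) hf

theorem triangleEquivalent_mor11 [h : (mor11 R).IsTriangulated] [(stableTarget R).CommShift ℤ]
    [(stableTarget R).IsTriangulated] :
    TriangleEquivalent (StableCM R) (mor11 R).FullSubcategory := by
  unfold mor11 at h ⊢
  refine triangleEquivalent_of_models (stableTarget R) (fun α β _ hβ g ↦ ?_)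
    (fun α β _ hβ f hf ↦ ?_) fun ⟨X⟩ ↦ ⟨ofId X, exists_iso_ofId X, ⟨Iso.refl _⟩⟩
  · have := isIso_toTarget hβ
    obtain ⟨g, rfl⟩ := (toStable (cmConflation R)).map_surjective (X := (target R).obj α)
      (Y := (target R).obj β) g
    exact ⟨(toStable _).map (homMk (toTarget α ≫ g ≫ inv (toTarget β)) g (by simp)), rfl⟩
  · have := isIso_toTarget hβ
    obtain ⟨f, rfl⟩ := (toStable (morEConflation R)).map_surjective f
    exact toStable_map_eq_zero_of_isIso_toTarget_right hf

theorem triangleEquivalent_mor01 [h : (mor01 R).IsTriangulated] [(stableTarget R).CommShift ℤ]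
    [(stableTarget R).IsTriangulated] :
    TriangleEquivalent (StableCM R) (mor01 R).FullSubcategory := by
  unfold mor01 at h ⊢
  refine triangleEquivalent_of_models (stableTarget R) (fun α β hα _ g ↦ ?_)
    (fun α β hα _ f hf ↦ ?_) fun ⟨X⟩ ↦ ?_
  · obtain ⟨g, rfl⟩ := (toStable (cmConflation R)).map_surjective (X := (target R).obj α)
      (Y := (target R).obj β) g
    obtain ⟨l, hl⟩ := CM.exists_lift_of_projective (P := (source R).obj α) hα
      (toTarget_surjective β) (toTarget α ≫ g)
    exact ⟨(toStable _).map (homMk l g hl), rfl⟩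
  · obtain ⟨f, rfl⟩ := (toStable (morEConflation R)).map_surjective f
    exact toStable_map_eq_zero_of_projective_source hα hf
  · obtain ⟨n, p, hp⟩ := exists_surjective_free X
    exact ⟨mk p hp, inferInstanceAs (Module.Projective Rᵐᵒᵖ (free R n).obj), ⟨Iso.refl _⟩⟩

end Equivalences

section IsTriangulated

variable [IsNoetherianRing R] [IsNoetherianRing Rᵐᵒᵖ] [StableTriangulation (cmConflation R)]
  [StableTriangulation (morEConflation R)]
  (hinj : ∃ n, HasInjectiveDimensionLE (ModuleCat.of.{u} R R) n)

include hinj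

lemma exists_isTriangulated_stableSource :
    ∃ (_ : (stableSource R).CommShift ℤ), (stableSource R).IsTriangulated :=
  exists_isTriangulated_stableFunctor (source R) relProjective_source (CM.isFrobenius hinj)
    (fun _ hS ↦ hS.1) (isFrobenius hinj)

lemma exists_isTriangulated_stableTarget :
    ∃ (_ : (stableTarget R).CommShift ℤ), (stableTarget R).IsTriangulated :=
  exists_isTriangulated_stableFunctor (target R) relProjective_target (CM.isFrobenius hinj)
    (fun _ hS ↦ hS.2) (isFrobenius hinj)

theorem isTriangulated_mor01 : (mor01 R).IsTriangulated := by
  obtain ⟨_, _⟩ := exists_isTriangulated_stableSource hinj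
  rw [mor01_eq_kernel]
  infer_instance

theorem isTriangulated_mor10 : (mor10 R).IsTriangulated := by
  obtain ⟨_, _⟩ := exists_isTriangulated_stableTarget hinj
  rw [mor10_eq_kernel hinj]
  infer_instance

theorem isTriangulated_mor11 : (mor11 R).IsTriangulated := by
  have := isTriangulated_mor10 hinj
  rw [(isStableTStructure_mor10_mor11 hinj).eq_rightOrthogonal]
  infer_instance

end IsTriangulated

end MorE

end Gorenstein

open Frobenius Recoll Gorenstein in
theorem mainTheorem6_general (R : Type u) [Ring R] [IsNoetherianRing R] [IsNoetherianRing Rᵐᵒᵖ]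
    (hinj : ∃ n, HasInjectiveDimensionLE (ModuleCat.of.{u} R R) n) :
    Nonempty (StableTriangulation (cmConflation R)) ∧
    Nonempty (StableTriangulation (morEConflation R)) ∧
    ∀ [StableTriangulation (cmConflation R)] [StableTriangulation (morEConflation R)],
      ∃ (_ : (mor01 R).IsTriangulated) (_ : (mor10 R).IsTriangulated)
        (_ : (mor11 R).IsTriangulated),
        IsTriangleOfRecollements (mor01 R) (mor10 R) (mor11 R) ∧
        (∃ r : Recollement (mor10 R).ι (mor10 R).trW.Q,
          r.jShriek.essImage = mor01 R ∧ r.jStar.essImage = mor11 R) ∧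
        TriangleEquivalent (StableCM R) (mor10 R).FullSubcategory ∧
        TriangleEquivalent (StableCM R) (mor11 R).FullSubcategory ∧
        TriangleEquivalent (StableCM R) (mor01 R).FullSubcategory := by
  refine ⟨(CM.isFrobenius hinj).nonempty_stableTriangulation,
    (MorE.isFrobenius hinj).nonempty_stableTriangulation, ?_⟩
  intro _ _
  obtain ⟨_, _⟩ := MorE.exists_isTriangulated_stableSource hinj
  obtain ⟨_, _⟩ := MorE.exists_isTriangulated_stableTarget hinj
  have h01 := MorE.isTriangulated_mor01 hinj
  have h10 := MorE.isTriangulated_mor10 hinj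
  have h11 := MorE.isTriangulated_mor11 hinj
  have t01 := MorE.isStableTStructure_mor01_mor10 hinj
  have t10 := MorE.isStableTStructure_mor10_mor11 hinj
  have t11 := MorE.isStableTStructure_mor11_mor01 hinj
  exact ⟨h01, h10, h11, ⟨t01, t10, t11⟩, exists_recollement t01 t10,
    MorE.triangleEquivalent_mor10, MorE.triangleEquivalent_mor11, MorE.triangleEquivalent_mor01⟩

theorem mainTheorem6 (R : Type u) [Ring R] (hR : Gorenstein.IsIwanagaGorenstein R) :
    Nonempty (Frobenius.StableTriangulation (Gorenstein.cmConflation R)) ∧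
    Nonempty (Frobenius.StableTriangulation (Gorenstein.morEConflation R)) ∧
    ∀ [Frobenius.StableTriangulation (Gorenstein.cmConflation R)]
      [Frobenius.StableTriangulation (Gorenstein.morEConflation R)],
      ∃ (_ : (Gorenstein.mor01 R).IsTriangulated) (_ : (Gorenstein.mor10 R).IsTriangulated)
        (_ : (Gorenstein.mor11 R).IsTriangulated),
        Recoll.IsTriangleOfRecollements
          (Gorenstein.mor01 R) (Gorenstein.mor10 R) (Gorenstein.mor11 R) ∧
        (∃ r : Recoll.Recollement (Gorenstein.mor10 R).ι (Gorenstein.mor10 R).trW.Q,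
          r.jShriek.essImage = Gorenstein.mor01 R ∧ r.jStar.essImage = Gorenstein.mor11 R) ∧
        Recoll.TriangleEquivalent
          (Gorenstein.StableCM R) (Gorenstein.mor10 R).FullSubcategory ∧
        Recoll.TriangleEquivalent
          (Gorenstein.StableCM R) (Gorenstein.mor11 R).FullSubcategory ∧
        Recoll.TriangleEquivalent
          (Gorenstein.StableCM R) (Gorenstein.mor01 R).FullSubcategory := by
  have := hR.left_noetherian
  have := hR.right_noetherian
  exact mainTheorem6_general R hR.left_injectiveDimension
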